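/- **Protocols.** A broadcast protocol is a tuple $P=(Q,\Sigma,q_{in},\Delta)$, where $Q$ is a finite set of states, $\Sigma$ a finite set of messages, $q_{in}\in Q$ and $\Delta\subseteq Q\times(\{!!m\mid m\in\Sigma\}\cup\{?m\mid m\in\Sigma\}\cup\{\tau\})\times Q$. For $q\in Q$ let $R(q)=\{m\in\Sigma\mid \exists q'\in Q,\ (q,?m,q')\in\Delta\}$. **Semantics.** A topology is a finite simple undirected graph $\Gamma=(V,E)$; it is a line topology if $V=\{v_1,\dots,v_n\}$ for some $n\in\mathbb N$ (with the $v_i$ pairwise distinct) and its edges are exactly the pairs $\{v_i,v_{i+1}\}$, $1\le i<n$. A configuration is a pair $(\Gamma,L)$ with $L:V\to Q$; it is initial if $L(v)=q_{in}$ for all $v\in V$. There is a step $(\Gamma,L)\to(\Gamma,L')$ if there are $v\in V$ and $(q,\alpha,q')\in\Delta$ with $L(v)=q$ and $L'(v)=q'$ such that either - $\alpha=\tau$ and $L'(u)=L(u)$ for all $u\ne v$; or - $\alpha={!!m}$ for some $m\in\Sigma$, every neighbour $u$ of $v$ satisfies either $(L(u),?m,L'(u))\in\Delta$, or $m\notin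 R(L(u))$ and $L'(u)=L(u)$, and all other vertices $w\neq v$ satisfy $L'(w)=L(w)$. Let $\to^*$ be the reflexive transitive closure of $\to$. The problem $\textsc{Cover}[\textsf{Lines}]$ is: given a broadcast protocol $P$ and a state $q_f\in Q$, are there a line topology $\Gamma$, an initial configuration $(\Gamma,L)$, a configuration $(\Gamma,L')$ with $(\Gamma,L)\to^*(\Gamma,L')$, and a vertex $v$ with $L'(v)=q_f$? **Phase-bounded protocols.** For $k\in\mathbb N$, the protocol $P$ is $k$-phase-bounded if $Q$ can be partitioned into $2k+1$ (possibly empty) sets $Q_0,Q_1^b,Q_1^r,\dots,Q_k^b,Q_k^r$ such that $q_{in}\in Q_0$ and, writing $Q_0^b=Q_0^r=Q_0$, every $(q,\alpha,q')\in\Delta$ satisfies one of the following: 1. $\alpha=\tau$ and $q,q'\in Q_i^\beta$ for some $0\le i\le k$ and $\beta\in\{b,r\}$; 2. $\alpha$ is a broadcast and $q,q'\in Q_i^b$ for some $1\le i\le k$; 3. $\alpha$ is a reception and $q,q'\in Q_i^r$ for some $1\le i\le k$; 4. $\alpha$ is a reception, $q\in Q_i^b$ and $q'\in Q_{i+1}^r$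 for some $0\le i<k$; 5. $\alpha$ is a broadcast, $q\in Q_i^r$ and $q'\in Q_{i+1}^b$ for some $0\le i<k$; 6. $\alpha$ is a reception, $q\in Q_k^b$ and $q'\in Q_k^r$. **Theorem.** For each $k\in\{1,2\}$, the problem $\textsc{Cover}[\textsf{Lines}]$ restricted to $k$-phase-bounded protocols is in P: there are a Turing machine and a polynomial $p$ such that, for every $k$-phase-bounded protocol $P$ and every state $q_f$ of $P$, the machine, started on a word of length $\ell$ that lists $Q$, $\Sigma$, $q_{in}$, $\Delta$ and $q_f$, halts after at most $p(\ell)$ steps and answers whether $(P,q_f)$ is a positive instance of $\textsc{Cover}[\textsf{Lines}]$. -/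

import Mathlib

namespace BroadcastNetwork

/-- The actions of a protocol over the message alphabet `M`:
broadcast `!!m`, reception `?m`, and the internal action `τ`. -/
inductive Action (M : Type) where
  | broadcast (m : M)
  | receive (m : M)
  | internal

/-- A transition `(q, α, q')`. -/
structure Transition (Q M : Type) where
  src : Q
  act : Action M
  tgt : Q

/-- A broadcast protocol `(Q, Σ, q_in, Δ)` with finite sets `Q` of states and `M` of messages. -/
structure Protocol (Q M : Type) [Finite Q] [Finite M] where
  init : Q
  trans : Set (Transition Q M)

section Semantics

variable {Q M : Type} [Finite Q] [Finite M] (P : Protocol Q M)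

/-- `R(q)`: the messages that can be received in state `q`. -/
def Protocol.receivable (q : Q) : Set M :=
  {m | ∃ q', ⟨q, Action.receive m, q'⟩ ∈ P.trans}

variable {V : Type} (G : SimpleGraph V)

/-- The step relation between the configurations `(G, L)` and `(G, L')`, in which the vertex `v`
takes the transition `t`. The topology never changes, so a configuration over `G` is given by its
labelling. A reception is never taken on its own, only as the effect of a broadcast of a neighbour.
-/
def Protocol.StepAt (v : V) (t : Transition Q M) (L L' : V → Q) : Prop :=
  t ∈ P.trans ∧ L v = t.src ∧ L' v = t.tgt ∧
    match t.act with
    | Action.internal => ∀ u, u ≠ v → L' u = L u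
    | Action.broadcast m =>
        (∀ u, G.Adj v u →
          ⟨L u, Action.receive m, L' u⟩ ∈ P.trans ∨ (m ∉ P.receivable (L u) ∧ L' u = L u)) ∧
        (∀ w, w ≠ v → ¬ G.Adj v w → L' w = L w)
    | Action.receive _ => False

/-- `(G, L) → (G, L')`. -/
def Protocol.Step (L L' : V → Q) : Prop :=
  ∃ v t, P.StepAt G v t L L'

/-- `(G, L) →* (G, L')`. -/
def Protocol.Reaches (L L' : V → Q) : Prop :=
  Relation.ReflTransGen (P.Step G) L L'

/-- The state `qf` is coverable with the topology `G`: some execution from the initial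
configuration over `G` reaches a configuration in which some vertex is in state `qf`. -/
def Protocol.CoverableWith (qf : Q) : Prop :=
  ∃ L' : V → Q, P.Reaches G (fun _ => P.init) L' ∧ ∃ v, L' v = qf

/-- A positive instance of the coverability problem over the family `S` of finite topologies. -/
def Protocol.Coverable (S : ∀ V : Type, SimpleGraph V → Prop) (qf : Q) : Prop :=
  ∃ (V : Type) (_ : Finite V) (G : SimpleGraph V), S V G ∧ P.CoverableWith G qf

end Semantics

/-- The line topologies: graphs on vertices `v₁, …, vₙ` whose edges join `vᵢ` and `vᵢ₊₁`. -/
def Lines (V : Type) (G : SimpleGraph V) : Prop :=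
  ∃ n : ℕ, Nonempty (G ≃g SimpleGraph.pathGraph n)

/-- The two kinds of phases: broadcast phases and reception phases. -/
inductive PhaseKind where
  | b
  | r

open PhaseKind in
/-- `P` is `k`-phase-bounded: the states are partitioned into `Q₀ = part 0 b = part 0 r` and
`Qᵢᵇ = part i b`, `Qᵢʳ = part i r` for `1 ≤ i ≤ k`, some of which may be empty, so that `q_in ∈ Q₀`
and every transition respects the order of the phases. -/
def Protocol.IsPhaseBounded {Q M : Type} [Finite Q] [Finite M] (P : Protocol Q M) (k : ℕ) : Prop :=
  ∃ part : ℕ → PhaseKind → Set Q,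
    part 0 b = part 0 r ∧
    (∀ q, ∃ i ≤ k, ∃ β, q ∈ part i β) ∧
    (∀ q, ∀ i ≤ k, ∀ j ≤ k, ∀ β γ, q ∈ part i β → q ∈ part j γ → i = j ∧ (i = 0 ∨ β = γ)) ∧
    P.init ∈ part 0 b ∧
    ∀ t ∈ P.trans,
      (t.act = Action.internal ∧ ∃ i ≤ k, ∃ β, t.src ∈ part i β ∧ t.tgt ∈ part i β) ∨
      ((∃ m, t.act = Action.broadcast m) ∧
        ∃ i, 1 ≤ i ∧ i ≤ k ∧ t.src ∈ part i b ∧ t.tgt ∈ part i b) ∨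
      ((∃ m, t.act = Action.receive m) ∧
        ∃ i, 1 ≤ i ∧ i ≤ k ∧ t.src ∈ part i r ∧ t.tgt ∈ part i r) ∨
      ((∃ m, t.act = Action.receive m) ∧ ∃ i < k, t.src ∈ part i b ∧ t.tgt ∈ part (i + 1) r) ∨
      ((∃ m, t.act = Action.broadcast m) ∧ ∃ i < k, t.src ∈ part i r ∧ t.tgt ∈ part (i + 1) b) ∨
      ((∃ m, t.act = Action.receive m) ∧ t.src ∈ part k b ∧ t.tgt ∈ part k r)

/-- An input of the coverability problem, as it is given to an algorithm: the states and the
messages are numbered, and the transitions are listed. -/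
structure CoverInput where
  numStates : ℕ
  numMessages : ℕ
  init : Fin numStates
  transitions : List (Transition (Fin numStates) (Fin numMessages))
  target : Fin numStates

/-- The protocol that an input describes. -/
def CoverInput.protocol (I : CoverInput) : Protocol (Fin I.numStates) (Fin I.numMessages) where
  init := I.init
  trans := {t | t ∈ I.transitions}

/-- The alphabet in which inputs are written. -/
inductive Symb where
  | bit (x : Bool)
  | fin
  | sep
  | bang
  | quest
  | tau
  deriving DecidableEq, Fintype

/-- A number in binary, followed by an end marker. -/
def encodeName (i : ℕ) : List Symb :=
  (Computability.encodeNat i).map Symb.bit ++ [Symb.fin]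

def encodeAction {s : ℕ} : Action (Fin s) → List Symb
  | Action.broadcast m => Symb.bang :: encodeName m
  | Action.receive m => Symb.quest :: encodeName m
  | Action.internal => [Symb.tau]

def encodeTransition {n s : ℕ} (t : Transition (Fin n) (Fin s)) : List Symb :=
  encodeName t.src ++ encodeAction t.act ++ encodeName t.tgt

/-- The word for an input: the list of all states, the list of all messages, the initial state,
the list of all transitions, and the state to cover. -/
def CoverInput.encode (I : CoverInput) : List Symb :=
  (List.range I.numStates).flatMap encodeName ++ [Symb.sep] ++
  (List.range I.numMessages).flatMap encodeName ++ [Symb.sep] ++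
  encodeName I.init ++ [Symb.sep] ++
  I.transitions.flatMap encodeTransition ++ [Symb.sep] ++
  encodeName I.target

theorem encodeName_append_inj {i j : ℕ} {x y : List Symb}
    (h : encodeName i ++ x = encodeName j ++ y) : i = j ∧ x = y := by
  have key : ∀ (l l' : List Bool), l.map Symb.bit ++ Symb.fin :: x = l'.map Symb.bit ++
      Symb.fin :: y → l = l' ∧ x = y := by
    intro l
    induction l with
    | nil => intro l' h; cases l' <;> simp_all
    | cons a l ih =>
      intro l' h
      cases l' with
      | nil => simp at h
      | cons b l' =>
        simp only [List.map_cons, List.cons_append, List.cons.injEq, Symb.bit.injEq] at h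
        obtain ⟨h1, h2⟩ := ih l' h.2
        exact ⟨by rw [h.1, h1], h2⟩
  obtain ⟨h1, h2⟩ := key _ _ (by simpa [encodeName] using h)
  refine ⟨?_, h2⟩
  rw [← Computability.decode_encodeNat i, h1, Computability.decode_encodeNat]

theorem encodeName_head (i : ℕ) (x y : List Symb) : encodeName i ++ x ≠ Symb.sep :: y := by
  unfold encodeName
  cases Computability.encodeNat i <;> simp

theorem flatMap_append_sep_inj {α : Type} {f : α → List Symb}
    (hf : ∀ a b x y, f a ++ x = f b ++ y → a = b ∧ x = y)
    (hs : ∀ a x y, f a ++ x ≠ Symb.sep :: y) (l l' : List α) (x y : List Symb)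
    (h : l.flatMap f ++ Symb.sep :: x = l'.flatMap f ++ Symb.sep :: y) : l = l' ∧ x = y := by
  induction l generalizing l' with
  | nil =>
    cases l' with
    | nil => simpa using h
    | cons b l' =>
      simp only [List.flatMap_nil, List.nil_append, List.flatMap_cons, List.append_assoc] at h
      exact absurd h.symm (hs _ _ _)
  | cons a l ih =>
    cases l' with
    | nil =>
      simp only [List.flatMap_nil, List.nil_append, List.flatMap_cons, List.append_assoc] at h
      exact absurd h (hs _ _ _)
    | cons b l' =>
      simp only [List.flatMap_cons, List.append_assoc] at h
      obtain ⟨h1, h2⟩ := hf _ _ _ _ h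
      obtain ⟨h3, h4⟩ := ih l' h2
      exact ⟨by rw [h1, h3], h4⟩

theorem encodeTransition_append_inj {n s : ℕ} (t t' : Transition (Fin n) (Fin s))
    (x y : List Symb) (h : encodeTransition t ++ x = encodeTransition t' ++ y) :
    t = t' ∧ x = y := by
  obtain ⟨p, a, q⟩ := t
  obtain ⟨p', a', q'⟩ := t'
  simp only [encodeTransition, List.append_assoc] at h
  obtain ⟨h1, h2⟩ := encodeName_append_inj h
  have h1 := Fin.ext h1
  subst h1
  have act : a = a' ∧ encodeName q ++ x = encodeName q' ++ y := by
    cases a <;> cases a' <;> simp [encodeAction] at h2 ⊢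
    · obtain ⟨h3, h4⟩ := encodeName_append_inj h2
      exact ⟨Fin.ext h3, h4⟩
    · obtain ⟨h3, h4⟩ := encodeName_append_inj h2
      exact ⟨Fin.ext h3, h4⟩
    · exact h2
  obtain ⟨rfl, h3⟩ := act
  obtain ⟨h4, rfl⟩ := encodeName_append_inj h3
  have h4 := Fin.ext h4
  subst h4
  exact ⟨rfl, rfl⟩

/-- Different inputs have different words. -/
theorem CoverInput.encode_injective : Function.Injective CoverInput.encode := by
  rintro ⟨n, s, i, T, f⟩ ⟨n', s', i', T', f'⟩ h
  simp only [CoverInput.encode, List.append_assoc, List.cons_append, List.nil_append] at h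
  obtain ⟨h1, h⟩ := flatMap_append_sep_inj (fun _ _ _ _ => encodeName_append_inj)
    encodeName_head _ _ _ _ h
  obtain ⟨h2, h⟩ := flatMap_append_sep_inj (fun _ _ _ _ => encodeName_append_inj)
    encodeName_head _ _ _ _ h
  have h1 : n = n' := by simpa using congrArg List.length h1
  have h2 : s = s' := by simpa using congrArg List.length h2
  subst h1 h2
  obtain ⟨h3, h'⟩ := encodeName_append_inj h
  have h3 := Fin.ext h3
  subst h3
  have hT := (List.cons.inj h').2
  obtain ⟨h4, hf⟩ := flatMap_append_sep_inj encodeTransition_append_inj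
    (fun t x y => by
      simp only [encodeTransition, List.append_assoc]
      exact encodeName_head _ _ _) _ _ _ _ hT
  subst h4
  obtain ⟨h5, -⟩ := encodeName_append_inj (x := []) (y := []) (by simpa using hf)
  have h5 := Fin.ext h5
  subst h5
  rfl

open Classical in
/-- The decision problem `p` on the inputs `α`, written as words by `enc`, is in P: some Turing
machine (with finitely many stacks as its tapes) halts on the word of every input within a number
of steps that is polynomial in the length of that word, and outputs whether `p` holds. -/
def InPolyTime {α A : Type} (enc : α → List A) (p : α → Prop) : Prop :=
  Nonempty (Turing.TM2ComputableInPolyTime enc Computability.encodeBool (fun a => decide (p a)))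

end BroadcastNetwork

/-! For `k ≤ 2` the life of a vertex has at most three stages. While idle it does not broadcast, and
it may receive; its first broadcast makes it active; a reception by an active vertex leads to the
last reception phase, after which it never broadcasts again (done). An active vertex therefore
ignores a message or is lost as a sender. This is all that the argument uses of phase-boundedness,
and `Protocol.Staging` records it.

Influence along a line is therefore short-sighted. Fix the vertex to be covered, the center. Its
future depends on an inner neighbour only as long as that neighbour is not done, and an inner
neighbour listens usefully to the outer vertex behind it only while it is idle. During that time the
inner vertex sends nothing, so the outer vertex is fed from outside alone, and what it receives
before its first broadcast can be moved to the beginning of the execution. After that first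
broadcast the outer vertex needs no messages at all: were it to receive one, it would be done and
could be replaced by a copy that stays in its last active state.

The states that a vertex can reach without broadcasting, fed from one side, form a relation between
two adjacent states (`Protocol.Pair`): once the feeding vertex has started to broadcast, the
vertices behind it are irrelevant. From such states of the two outer vertices, five consecutive
vertices evolve by themselves (`Protocol.Five`). A state is coverable on a line iff it is the middle
of a quintuple (`Protocol.coverable_lines_iff`). That quintuples can be realized is a matter of
shifting and gluing executions (`Protocol.Pair.exists_lineReach`, `Protocol.Five.exists_lineReach`).
Conversely, an invariant along any execution (`Protocol.LineInvariant`) keeps, on each side, only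
what still matters: for an idle inner vertex, the quintuple is derivable with every outer state that
is still possible; for an active one, with some outer state; for a done one, with some outer and
some inner state (`Protocol.SideHolds`).

With `n` states there are at most `n ^ 2` pairs and `n ^ 5` quintuples, both closed under finitely
many rule schemes, so saturation takes polynomial time. For the machine, structured programs over
finitely many stacks are compiled to `TM2` machines with exact step counts (`Prog.Runs.evalsTo`); a
small language of loops, membership tests and insertions on a list of facts is compiled to these
programs (`SProg.runsIn_ofCmd`); and the rules of both relations are repeated in it as often as
there are possible facts, which forces a round without new ones (`Rule.exists_stationary`). -/

namespace BroadcastNetwork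

/-! ### Stages, executions on the infinite line, and the relations `Pair` and `Five` -/

/-- The three stages of the life of a vertex: before its first broadcast, while it broadcasts, and
when it can only receive. -/
inductive Stage where
  | idle
  | active
  | done

section Line

variable {Q M : Type} [Finite Q] [Finite M] (P : Protocol Q M)

/-- The possible effects of a broadcast of `m` by a neighbour on a vertex in state `q`. -/
def Protocol.Reacts (m : M) (q q' : Q) : Prop :=
  ⟨q, Action.receive m, q'⟩ ∈ P.trans ∨ (m ∉ P.receivable q ∧ q' = q)

theorem Protocol.exists_reacts (m : M) (q : Q) : ∃ q', P.Reacts m q q' := by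
  by_cases h : m ∈ P.receivable q
  · obtain ⟨q', h'⟩ := h
    exact ⟨q', Or.inl h'⟩
  · exact ⟨q, Or.inr ⟨h, rfl⟩⟩

/-- An assignment of stages to states that every transition respects. -/
structure Protocol.Staging (ph : Q → Stage) : Prop where
  init : ph P.init = Stage.idle
  internal : ∀ q q', ⟨q, Action.internal, q'⟩ ∈ P.trans → ph q' = ph q
  broadcast : ∀ q m q', ⟨q, Action.broadcast m, q'⟩ ∈ P.trans →
    ph q ≠ Stage.done ∧ ph q' = Stage.active
  receive : ∀ q m q', ⟨q, Action.receive m, q'⟩ ∈ P.trans →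
    ph q' = Stage.done ∨ (ph q = Stage.idle ∧ ph q' = Stage.idle)

/-- A step on the two-sided infinite line, in which `v` acts, by a broadcast if `b` is true. -/
inductive Protocol.LineStep : ℤ → Bool → (ℤ → Q) → (ℤ → Q) → Prop
  | internal (v : ℤ) (L L' : ℤ → Q) (ht : ⟨L v, Action.internal, L' v⟩ ∈ P.trans)
      (hu : ∀ u, u ≠ v → L' u = L u) : LineStep v false L L'
  | broadcast (v : ℤ) (L K : ℤ → Q) (m : M) (ht : ⟨L v, Action.broadcast m, K v⟩ ∈ P.trans)
      (hl : P.Reacts m (L (v - 1)) (K (v - 1))) (hr : P.Reacts m (L (v + 1)) (K (v + 1)))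
      (hu : ∀ u, u ≠ v → u ≠ v - 1 → u ≠ v + 1 → K u = L u) : LineStep v true L K

/-- Executions on the infinite line in which only the actors allowed by `A` act. -/
def Protocol.LineReach (A : ℤ → Bool → Prop) : (ℤ → Q) → (ℤ → Q) → Prop :=
  Relation.ReflTransGen fun L L' => ∃ v b, A v b ∧ P.LineStep v b L L'

variable {P}

theorem Protocol.LineReach.mono {A B : ℤ → Bool → Prop} (h : ∀ v b, A v b → B v b) {L L' : ℤ → Q}
    (hL : P.LineReach A L L') : P.LineReach B L L' :=
  Relation.ReflTransGen.mono (fun _ _ ⟨v, b, hA, hs⟩ => ⟨v, b, h v b hA, hs⟩) _ _ hL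

theorem Protocol.LineStep.reflect {v : ℤ} {b : Bool} {L L' : ℤ → Q} (h : P.LineStep v b L L') :
    P.LineStep (-v) b (fun x => L (-x)) (fun x => L' (-x)) := by
  cases h with
  | internal _ _ ht hu =>
    refine .internal _ _ _ (by simpa using ht) fun u h => hu _ (by omega)
  | broadcast _ _ m ht hl hr hu =>
    refine .broadcast _ _ _ m (by simpa using ht) ?_ ?_ fun u h1 h2 h3 =>
      hu _ (by omega) (by omega) (by omega)
    · have : -(-v - 1) = v + 1 := by ring
      simpa [this] using hr
    · have : -(-v + 1) = v - 1 := by ring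
      simpa [this] using hl

theorem Protocol.LineReach.reflect {L L' : ℤ → Q} (h : P.LineReach (fun _ _ => True) L L') :
    P.LineReach (fun _ _ => True) (fun x => L (-x)) (fun x => L' (-x)) :=
  Relation.ReflTransGen.lift (fun (L : ℤ → Q) (x : ℤ) => L (-x))
    (fun _ _ ⟨v, b, _, hs⟩ => ⟨-v, b, trivial, hs.reflect⟩) _ _ h

theorem Protocol.exists_lineStep_internal {L : ℤ → Q} {v : ℤ} {q : Q}
    (h : ⟨L v, Action.internal, q⟩ ∈ P.trans) :
    ∃ L', P.LineStep v false L L' ∧ L' v = q ∧ ∀ u, u ≠ v → L' u = L u :=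
  ⟨Function.update L v q, .internal _ _ _ (by simpa using h) (fun u hu => by simp [hu]), by simp,
    fun u hu => by simp [hu]⟩

theorem Protocol.exists_lineStep_broadcast {L : ℤ → Q} {v : ℤ} {m : M} {q l r : Q}
    (h : ⟨L v, Action.broadcast m, q⟩ ∈ P.trans) (hl : P.Reacts m (L (v - 1)) l)
    (hr : P.Reacts m (L (v + 1)) r) :
    ∃ L', P.LineStep v true L L' ∧ L' v = q ∧ L' (v - 1) = l ∧ L' (v + 1) = r ∧
      ∀ u, u ≠ v → u ≠ v - 1 → u ≠ v + 1 → L' u = L u := by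
  let L' : ℤ → Q := Function.update (Function.update (Function.update L v q) (v - 1) l) (v + 1) r
  have h1 : L' v = q := by
    have : v ≠ v - 1 := by omega
    simp [L', this]
  have h2 : L' (v - 1) = l := by
    have : v - 1 ≠ v + 1 := by omega
    simp [L', this]
  have h3 : L' (v + 1) = r := by simp [L']
  have h4 : ∀ u, u ≠ v → u ≠ v - 1 → u ≠ v + 1 → L' u = L u := fun u a b c => by
    simp [L', a, b, c]
  exact ⟨L', .broadcast _ _ _ m (by rwa [h1]) (by rwa [h2]) (by rwa [h3]) h4, h1, h2, h3, h4⟩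

variable (P)

/-- `P.Pair a c`: a vertex `v` in state `c` that has not broadcast so far may stand beside a
vertex in state `a`, all actors being on the side of the latter. -/
inductive Protocol.Pair : Q → Q → Prop
  | start : Pair P.init P.init
  | next (x a : Q) (h : Pair x a) : Pair a P.init
  | internal_left (a c a' : Q) (h : Pair a c) (ht : ⟨a, Action.internal, a'⟩ ∈ P.trans) : Pair a' c
  | internal_right (a c c' : Q) (h : Pair a c) (ht : ⟨c, Action.internal, c'⟩ ∈ P.trans) :
      Pair a c'
  | broadcast (a c b d : Q) (m : M) (h : Pair a c)
      (ht : ⟨a, Action.broadcast m, b⟩ ∈ P.trans) (hc : P.Reacts m c d) : Pair b d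

/-- The states of five consecutive vertices, of which the outer two start in a state that they
reach without a broadcast and without the help of the inner three. -/
inductive Protocol.Five : Q → Q → Q → Q → Q → Prop
  | start (x y w z : Q) (hw : P.Pair x w) (hz : P.Pair y z) : Five w P.init P.init P.init z
  | mirror (w u v x z : Q) (h : Five w u v x z) : Five z x v u w
  | internal_outer (w u v x z w' : Q) (h : Five w u v x z)
      (ht : ⟨w, Action.internal, w'⟩ ∈ P.trans) : Five w' u v x z
  | internal_inner (w u v x z u' : Q) (h : Five w u v x z)
      (ht : ⟨u, Action.internal, u'⟩ ∈ P.trans) : Five w u' v x z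
  | internal_center (w u v x z v' : Q) (h : Five w u v x z)
      (ht : ⟨v, Action.internal, v'⟩ ∈ P.trans) : Five w u v' x z
  | broadcast_outer (w u v x z w' u' : Q) (m : M) (h : Five w u v x z)
      (ht : ⟨w, Action.broadcast m, w'⟩ ∈ P.trans) (hu : P.Reacts m u u') : Five w' u' v x z
  | broadcast_inner (w u v x z w' u' v' : Q) (m : M) (h : Five w u v x z)
      (ht : ⟨u, Action.broadcast m, u'⟩ ∈ P.trans) (hw : P.Reacts m w w')
      (hv : P.Reacts m v v') : Five w' u' v' x z
  | broadcast_center (w u v x z a b y : Q) (m : M) (h : Five w u v x z)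
      (ht : ⟨v, Action.broadcast m, b⟩ ∈ P.trans) (hu : P.Reacts m u a)
      (hx : P.Reacts m x y) : Five w a b y z

/-- The actors of an execution that leaves the positive half of the line alone and in which `0`
does not broadcast. -/
def LeftActor (v : ℤ) (b : Bool) : Prop := v < 0 ∨ (v = 0 ∧ b = false)

/-- The labelling that is `L`, moved by `d`, up to the position `d`, and `N` beyond it. -/
def moveGlue (d : ℤ) (N L : ℤ → Q) : ℤ → Q := fun x => if x ≤ d then L (x - d) else N x

variable {P}

/-- A left actor that broadcasts is at `-1` or further left, so the three vertices touched by its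
step all lie in the moved part, and the labelling `N` beyond it is never consulted. -/
theorem Protocol.LineStep.moveGlue (d : ℤ) (N : ℤ → Q) {v : ℤ} {b : Bool} {L L' : ℤ → Q}
    (hA : LeftActor v b) (h : P.LineStep v b L L') :
    P.LineStep (v + d) b (moveGlue d N L) (moveGlue d N L') := by
  cases h with
  | internal _ _ ht hu =>
    have hv : v ≤ 0 := by rcases hA with h | h <;> omega
    refine .internal _ _ _ (by simpa [BroadcastNetwork.moveGlue, hv] using ht) fun u h => ?_
    simp only [BroadcastNetwork.moveGlue]
    split_ifs
    · exact hu _ (by omega)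
    · rfl
  | broadcast _ _ m ht hl hr hu =>
    have hv : v ≤ -1 := by
      rcases hA with h | h
      · omega
      · simp at h
    have h1 : v + d ≤ d := by omega
    have h2 : v + d - 1 ≤ d := by omega
    have h3 : v + d + 1 ≤ d := by omega
    have e2 : v + d - 1 - d = v - 1 := by ring
    have e3 : v + d + 1 - d = v + 1 := by ring
    refine .broadcast _ _ _ m ?_ ?_ ?_ fun u a b c => ?_
    · simpa only [BroadcastNetwork.moveGlue, h1, if_true, add_sub_cancel_right] using ht
    · simpa only [BroadcastNetwork.moveGlue, h2, if_true, e2] using hl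
    · simpa only [BroadcastNetwork.moveGlue, h3, if_true, e3] using hr
    · simp only [BroadcastNetwork.moveGlue]
      split_ifs
      · exact hu _ (by omega) (by omega) (by omega)
      · rfl

theorem Protocol.LineReach.moveGlue (d : ℤ) (hd : d ≤ 0) (N : ℤ → Q) {L L' : ℤ → Q}
    (h : P.LineReach LeftActor L L') :
    P.LineReach LeftActor (moveGlue d N L) (moveGlue d N L') :=
  Relation.ReflTransGen.lift (BroadcastNetwork.moveGlue d N)
    (fun _ _ ⟨v, b, hA, hs⟩ => ⟨v + d, b, by
      rcases hA with h | ⟨h, h'⟩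
      · exact Or.inl (by omega)
      · rcases hd.lt_or_eq with h1 | h1
        · exact Or.inl (by omega)
        · exact Or.inr ⟨by omega, h'⟩, hs.moveGlue d N hA⟩) _ _ h

theorem Protocol.LineReach.step {A : ℤ → Bool → Prop} {L L' L'' : ℤ → Q} (v : ℤ) (b : Bool)
    (h : P.LineReach A L L') (hA : A v b) (hs : P.LineStep v b L' L'') : P.LineReach A L L'' :=
  Relation.ReflTransGen.tail h ⟨v, b, hA, hs⟩

/-- Soundness of `Pair`. As only left actors act, the execution can later be placed to the left of
anything. -/
theorem Protocol.Pair.exists_lineReach {a c : Q} (h : P.Pair a c) :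
    ∃ L, P.LineReach LeftActor (fun _ => P.init) L ∧ L (-1) = a ∧ L 0 = c := by
  induction h with
  | start => exact ⟨_, .refl, rfl, rfl⟩
  | next x a _ ih =>
    obtain ⟨L, h, -, h0⟩ := ih
    -- Shifting by one puts the vertex in state `a` at `-1`, beside a vertex `0` that has done
    -- nothing. It has not broadcast so far, which is why `0` is still in the initial state.
    have h := h.moveGlue (-1) (by norm_num) (fun _ => P.init)
    have e : moveGlue (-1) (fun _ => P.init) (fun _ => P.init) = (fun _ => P.init) := by
      funext x; simp [moveGlue]
    rw [e] at h
    exact ⟨_, h, by simp [moveGlue, h0], by simp [moveGlue]⟩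
  | internal_left a c a' _ ht ih =>
    obtain ⟨L, h, h1, h0⟩ := ih
    obtain ⟨L', hs, e1, e⟩ := exists_lineStep_internal (L := L) (v := -1) (by rwa [h1])
    exact ⟨L', h.step _ _ (Or.inl (by norm_num)) hs, e1, by rw [e _ (by norm_num), h0]⟩
  | internal_right a c c' _ ht ih =>
    obtain ⟨L, h, h1, h0⟩ := ih
    obtain ⟨L', hs, e1, e⟩ := exists_lineStep_internal (L := L) (v := 0) (by rwa [h0])
    exact ⟨L', h.step _ _ (Or.inr ⟨rfl, rfl⟩) hs, by rw [e _ (by norm_num), h1], e1⟩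
  | broadcast a c a' c' m _ ht hc ih =>
    obtain ⟨L, h, h1, h0⟩ := ih
    -- The vertex behind the sender must react somehow; the pair does not depend on how.
    obtain ⟨l, hl⟩ := P.exists_reacts m (L (-1 - 1))
    obtain ⟨L', hs, e1, -, e2, -⟩ := exists_lineStep_broadcast (L := L) (v := -1) (by rwa [h1]) hl
      (r := c') (by simpa [h0] using hc)
    exact ⟨L', h.step _ _ (Or.inl (by norm_num)) hs, e1, by simpa using e2⟩

/-- Soundness of `Five`. The preparations of the two outer vertices take place in `(-∞, -2]` and
`[2, ∞)`, and neither outer vertex broadcasts, so they do not interfere and leave the inner three in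
the initial state. The remaining rules are steps of the line in which the reactions outside the
window are arbitrary. -/
theorem Protocol.Five.exists_lineReach {w u v x z : Q} (h : P.Five w u v x z) :
    ∃ L, P.LineReach (fun _ _ => True) (fun _ => P.init) L ∧
      L (-2) = w ∧ L (-1) = u ∧ L 0 = v ∧ L 1 = x ∧ L 2 = z := by
  induction h with
  | start x y w z hw hz =>
    obtain ⟨L1, h1, -, e1⟩ := hw.exists_lineReach
    obtain ⟨L2, h2, -, e2⟩ := hz.exists_lineReach
    have a1 := (h1.moveGlue (-2) (by norm_num) (fun _ => P.init)).mono
      (B := fun _ _ => True) (fun _ _ _ => trivial)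
    have e : moveGlue (-2) (fun _ => P.init) (fun _ => P.init) = (fun _ => P.init) := by
      funext x; simp [moveGlue]
    rw [e] at a1
    set N := moveGlue (-2) (fun _ => P.init) L1 with hN
    -- The right half is the mirror image of a left half: the second execution is glued to the
    -- mirror image of `N`, and the whole is reflected back.
    have a2 := ((h2.moveGlue (-2) (by norm_num) (fun x => N (-x))).mono
      (B := fun _ _ => True) (fun _ _ _ => trivial)).reflect
    have e' : (fun x => moveGlue (-2) (fun x => N (-x)) (fun _ => P.init) (-x)) = N := by
      funext x
      simp only [moveGlue, neg_neg, hN]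
      split_ifs with h h'
      · omega
      · rfl
      · rfl
      · rfl
    rw [e'] at a2
    refine ⟨_, a1.trans a2, ?_, ?_, ?_, ?_, ?_⟩ <;> simp [moveGlue, hN, e1, e2]
  | mirror w u v x z _ ih =>
    obtain ⟨L, h, a, b, c, d, e⟩ := ih
    exact ⟨_, h.reflect, by simpa using e, by simpa using d, by simpa using c, by simpa using b,
      by simpa using a⟩
  | internal_outer w u v x z w' _ ht ih =>
    obtain ⟨L, h, a, b, c, d, e⟩ := ih
    obtain ⟨L', hs, e1, e2⟩ := exists_lineStep_internal (L := L) (v := -2) (by rwa [a])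
    refine ⟨L', h.step _ _ trivial hs, e1, ?_, ?_, ?_, ?_⟩ <;> rw [e2 _ (by norm_num)] <;>
      assumption
  | internal_inner w u v x z w' _ ht ih =>
    obtain ⟨L, h, a, b, c, d, e⟩ := ih
    obtain ⟨L', hs, e1, e2⟩ := exists_lineStep_internal (L := L) (v := -1) (by rwa [b])
    refine ⟨L', h.step _ _ trivial hs, ?_, e1, ?_, ?_, ?_⟩ <;> rw [e2 _ (by norm_num)] <;>
      assumption
  | internal_center w u v x z w' _ ht ih =>
    obtain ⟨L, h, a, b, c, d, e⟩ := ih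
    obtain ⟨L', hs, e1, e2⟩ := exists_lineStep_internal (L := L) (v := 0) (by rwa [c])
    refine ⟨L', h.step _ _ trivial hs, ?_, ?_, e1, ?_, ?_⟩ <;> rw [e2 _ (by norm_num)] <;>
      assumption
  | broadcast_outer w u v x z w' u' m _ ht hu ih =>
    obtain ⟨L, h, a, b, c, d, e⟩ := ih
    obtain ⟨l, hl⟩ := P.exists_reacts m (L (-2 - 1))
    obtain ⟨L', hs, e1, -, e2, e3⟩ := exists_lineStep_broadcast (L := L) (v := -2) (by rwa [a]) hl
      (r := u') (by simpa [b] using hu)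
    refine ⟨L', h.step _ _ trivial hs, e1, by simpa using e2, ?_, ?_, ?_⟩ <;>
      rw [e3 _ (by norm_num) (by norm_num) (by norm_num)] <;> assumption
  | broadcast_inner w u v x z w' u' v' m _ ht hw hv ih =>
    obtain ⟨L, h, a, b, c, d, e⟩ := ih
    obtain ⟨L', hs, e1, e2, e3, e4⟩ := exists_lineStep_broadcast (L := L) (v := -1) (by rwa [b])
      (l := w') (r := v') (by simpa [a] using hw) (by simpa [c] using hv)
    refine ⟨L', h.step _ _ trivial hs, by simpa using e2, e1, by simpa using e3, ?_, ?_⟩ <;>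
      rw [e4 _ (by norm_num) (by norm_num) (by norm_num)] <;> assumption
  | broadcast_center w u v x z u' v' x' m _ ht hu hx ih =>
    obtain ⟨L, h, a, b, c, d, e⟩ := ih
    obtain ⟨L', hs, e1, e2, e3, e4⟩ := exists_lineStep_broadcast (L := L) (v := 0) (by rwa [c])
      (l := u') (r := x') (by simpa [b] using hu) (by simpa [d] using hx)
    refine ⟨L', h.step _ _ trivial hs, ?_, by simpa using e2, e1, by simpa using e3, ?_⟩ <;>
      rw [e4 _ (by norm_num) (by norm_num) (by norm_num)] <;> assumption

end Line
-- The record of last active states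
section UpdateActive

variable {Q : Type} {ph : Q → Stage}

open Classical in
/-- The last active states after a step of `v`. -/
noncomputable def updateActive (ph : Q → Stage) (v : ℤ) (L' : ℤ → Q) (Z : ℤ → Option Q) :
    ℤ → Option Q :=
  if ph (L' v) = Stage.active then Function.update Z v (some (L' v)) else Z

theorem updateActive_of_ne {v : ℤ} {L' : ℤ → Q} {Z : ℤ → Option Q} {u : ℤ} (h : u ≠ v) :
    updateActive ph v L' Z u = Z u := by
  unfold updateActive
  split_ifs <;> simp [h]

theorem updateActive_self {v : ℤ} {L' : ℤ → Q} {Z : ℤ → Option Q}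
    (h : ph (L' v) = Stage.active) : updateActive ph v L' Z v = some (L' v) := by
  simp [updateActive, h]

theorem updateActive_of_not {v : ℤ} {L' : ℤ → Q} {Z : ℤ → Option Q}
    (h : ph (L' v) ≠ Stage.active) : updateActive ph v L' Z = Z := by
  simp [updateActive, h]

theorem updateActive_reflect {v : ℤ} {L' : ℤ → Q} {Z : ℤ → Option Q} :
    (fun x => updateActive ph v L' Z (-x)) =
      updateActive ph (-v) (fun x => L' (-x)) (fun x => Z (-x)) := by
  funext x
  by_cases h : x = -v
  · subst h
    by_cases e : ph (L' v) = Stage.active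
    · rw [updateActive_self (by simpa using e)]
      simp [updateActive_self e]
    · rw [updateActive_of_not e, updateActive_of_not (by simpa using e)]
  · rw [updateActive_of_ne h, updateActive_of_ne (by omega)]

end UpdateActive

/-! ### Completeness: the invariant of an execution on the line -/

section LineComplete

variable {Q M : Type} [Finite Q] [Finite M] {P : Protocol Q M} {ph : Q → Stage}

/-- The states that a helper may be assumed to be in, given the last state in which it was
active. -/
def Protocol.Admissible (P : Protocol Q M) : Option Q → Q → Prop
  | none, a => ∃ x, P.Pair x a
  | some q, a => a = q

theorem Protocol.exists_admissible (P : Protocol Q M) : ∀ z, ∃ a, P.Admissible z a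
  | none => ⟨P.init, P.init, .start⟩
  | some q => ⟨q, rfl⟩

/-- `Φ` holds for the states of the outer and the inner vertex on one side of the center, where `x`
is the state of the inner one and `z` the last active state of the outer one. -/
def Protocol.SideHolds (P : Protocol Q M) (ph : Q → Stage) (x : Q) (z : Option Q)
    (Φ : Q → Q → Prop) : Prop :=
  match ph x with
  | Stage.idle => ∀ w, P.Admissible z w → Φ w x
  | Stage.active => ∃ w, Φ w x
  | Stage.done => ∃ w u, Φ w u

section Side

variable {x x' : Q} {z z' : Option Q} {Φ Φ' : Q → Q → Prop}

theorem Protocol.SideHolds.exists (h : P.SideHolds ph x z Φ) : ∃ w u, Φ w u := by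
  unfold Protocol.SideHolds at h
  split at h
  · obtain ⟨a, ha⟩ := P.exists_admissible z
    exact ⟨a, x, h a ha⟩
  · obtain ⟨w, h⟩ := h
    exact ⟨w, x, h⟩
  · exact h

theorem Protocol.SideHolds.mono (h : P.SideHolds ph x z Φ) (hΦ : ∀ w u, Φ w u → Φ' w u) :
    P.SideHolds ph x z Φ' := by
  unfold Protocol.SideHolds at *
  split at h <;> rename_i e
  · exact fun w hw => hΦ _ _ (h w hw)
  · exact h.imp fun w => hΦ _ _
  · obtain ⟨w, u, h⟩ := h
    exact ⟨w, u, hΦ _ _ h⟩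

theorem Protocol.SideHolds.exists_inner (h : P.SideHolds ph x z Φ) (hx : ph x ≠ Stage.done) :
    ∃ w, Φ w x := by
  unfold Protocol.SideHolds at h
  split at h
  · obtain ⟨a, ha⟩ := P.exists_admissible z
    exact ⟨a, h a ha⟩
  · exact h
  · contradiction

theorem Protocol.SideHolds.of_active {w : Q} (hx : ph x = Stage.active) (h : Φ w x) :
    P.SideHolds ph x z Φ := by
  unfold Protocol.SideHolds
  rw [hx]
  exact ⟨w, h⟩

theorem Protocol.SideHolds.of_done {w u : Q} (hx : ph x = Stage.done) (h : Φ w u) :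
    P.SideHolds ph x z Φ := by
  unfold Protocol.SideHolds
  rw [hx]
  exact ⟨w, u, h⟩

/-- This serves the broadcasts of the center. An idle inner vertex reacts in the same way whatever
the outer state is. An active one ignores the message or becomes done. The representative of a done
one may differ from it, so it gets any reaction of its own. -/
theorem Protocol.SideHolds.react {m : M} (hP : P.Staging ph) (hm : P.Reacts m x x')
    (h : P.SideHolds ph x z Φ) (hΦ : ∀ w u u', P.Reacts m u u' → Φ w u → Φ' w u') :
    P.SideHolds ph x' z Φ' := by
  cases e : ph x with
  | done =>
    obtain ⟨w, u, h⟩ := h.exists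
    obtain ⟨u', hu⟩ := P.exists_reacts m u
    refine .of_done ?_ (hΦ _ _ _ hu h)
    rcases hm with hm | ⟨-, rfl⟩
    · rcases hP.receive _ _ _ hm with h | h
      · exact h
      · simp [e] at h
    · exact e
  | active =>
    obtain ⟨w, h⟩ := h.exists_inner (by simp [e])
    rcases hm with hm | hm
    · rcases hP.receive _ _ _ hm with h' | h'
      · exact .of_done h' (hΦ _ _ _ (Or.inl hm) h)
      · simp [e] at h'
    · exact .of_active (hm.2 ▸ e) (hΦ _ _ _ (Or.inr hm) h)
  | idle =>
    have key : ∀ w, P.Admissible z w → Φ' w x' := by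
      intro w hw
      unfold Protocol.SideHolds at h
      simp only [e] at h
      exact hΦ _ _ _ hm (h w hw)
    have : ph x' = Stage.done ∨ ph x' = Stage.idle := by
      rcases hm with hm | ⟨-, rfl⟩
      · exact (hP.receive _ _ _ hm).imp id And.right
      · exact Or.inr e
    rcases this with h' | h'
    · obtain ⟨w, hw⟩ := P.exists_admissible z
      exact .of_done h' (key w hw)
    · unfold Protocol.SideHolds
      rw [h']
      exact key

theorem Protocol.SideHolds.inner_internal (hP : P.Staging ph)
    (ht : ⟨x, Action.internal, x'⟩ ∈ P.trans) (h : P.SideHolds ph x z Φ)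
    (hΦ : ∀ w, Φ w x → Φ w x') : P.SideHolds ph x' z Φ := by
  have e := hP.internal _ _ ht
  unfold Protocol.SideHolds at *
  rw [e]
  split at h
  · exact fun w hw => hΦ _ (h w hw)
  · exact h.imp fun w => hΦ _
  · exact h

/-- Sending makes the inner vertex active. From now on one outer state is enough, so its reaction is
arbitrary and the record `z'` plays no role. -/
theorem Protocol.SideHolds.inner_broadcast {m : M} (hP : P.Staging ph)
    (ht : ⟨x, Action.broadcast m, x'⟩ ∈ P.trans) (h : P.SideHolds ph x z Φ)
    (hΦ : ∀ w w', P.Reacts m w w' → Φ w x → Φ' w' x') : P.SideHolds ph x' z' Φ' := by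
  obtain ⟨w, h⟩ := h.exists_inner (hP.broadcast _ _ _ ht).1
  obtain ⟨w', hw⟩ := P.exists_reacts m w
  exact .of_active (hP.broadcast _ _ _ ht).2 (hΦ _ _ hw h)

theorem Protocol.SideHolds.outer {y y' : Q} (hy : ph x = Stage.idle → P.Admissible z y)
    (h : P.SideHolds ph x z Φ) (hΦ : Φ y x → Φ y' x) : P.SideHolds ph x (some y') Φ := by
  unfold Protocol.SideHolds at *
  split at h <;> rename_i e
  · rintro w rfl
    exact hΦ (h y (hy e))
  · exact h
  · exact h

/-- Only for an idle inner vertex is the broadcast repeated in the derivation. For an active or done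
one it is left out: either the message is ignored, or the inner vertex is done afterwards and its
represented state need not agree with the real one. -/
theorem Protocol.SideHolds.outer_broadcast {m : M} {y y' : Q} (hP : P.Staging ph)
    (hy : ph x = Stage.idle → P.Admissible z y) (hm : P.Reacts m x x')
    (h : P.SideHolds ph x z Φ) (hΦ : Φ y x → Φ y' x') : P.SideHolds ph x' (some y') Φ := by
  cases e : ph x with
  | done =>
    obtain ⟨w, u, h⟩ := h.exists
    refine .of_done ?_ h
    rcases hm with hm | ⟨-, rfl⟩
    · rcases hP.receive _ _ _ hm with h | h
      · exact h
      · simp [e] at h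
    · exact e
  | active =>
    obtain ⟨w, h⟩ := h.exists_inner (by simp [e])
    rcases hm with hm | ⟨-, rfl⟩
    · rcases hP.receive _ _ _ hm with h' | h'
      · exact .of_done h' h
      · simp [e] at h'
    · exact .of_active e h
  | idle =>
    have key : Φ y' x' := by
      unfold Protocol.SideHolds at h
      simp only [e] at h
      exact hΦ (h y (hy e))
    have : ph x' = Stage.done ∨ ph x' = Stage.idle := by
      rcases hm with hm | ⟨-, rfl⟩
      · exact (hP.receive _ _ _ hm).imp id And.right
      · exact Or.inr e
    rcases this with h' | h'
    · exact .of_done h' key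
    · unfold Protocol.SideHolds
      rw [h']
      rintro w rfl
      exact key

end Side

/-- `Z` keeps the last active states: it is undefined as long as a vertex is idle, and agrees with
`L` while it is active. -/
structure LastActive (ph : Q → Stage) (L : ℤ → Q) (Z : ℤ → Option Q) : Prop where
  idle : ∀ i, ph (L i) = Stage.idle → Z i = none
  active : ∀ i, ph (L i) = Stage.active → Z i = some (L i)

/-- A vertex that, like its right neighbour, was never active so far depends only on what is to its
left. -/
def Protocol.LeftFed (P : Protocol Q M) (L : ℤ → Q) (Z : ℤ → Option Q) : Prop :=
  ∀ i, Z i = none → Z (i + 1) = none → ∀ a, P.Admissible (Z (i - 1)) a → P.Pair a (L i)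

theorem Protocol.LeftFed.pair {L : ℤ → Q} {Z : ℤ → Option Q} (h : P.LeftFed L Z) {i : ℤ}
    (h1 : Z i = none) (h2 : Z (i + 1) = none) : ∃ a, P.Pair a (L i) := by
  obtain ⟨a, ha⟩ := P.exists_admissible (Z (i - 1))
  exact ⟨a, h i h1 h2 a ha⟩

/-- A reception ends in `done` or stays within `idle`. So nobody becomes active by reacting, and
whoever is active after a reaction has ignored the message. -/
theorem Protocol.Reacts.stage {m : M} {q q' : Q} (hP : P.Staging ph) (h : P.Reacts m q q') :
    (ph q' = Stage.idle → ph q = Stage.idle) ∧ (ph q' = Stage.active → q' = q) := by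
  rcases h with h | ⟨-, rfl⟩
  · rcases hP.receive _ _ _ h with h | h <;> simp [h]
  · simp

theorem LastActive.step (hP : P.Staging ph) {v : ℤ} {b : Bool} {L L' : ℤ → Q} {Z : ℤ → Option Q}
    (hZ : LastActive ph L Z) (hs : P.LineStep v b L L') :
    LastActive ph L' (updateActive ph v L' Z) := by
  have key : ∀ u, u ≠ v → (ph (L' u) = Stage.idle → ph (L u) = Stage.idle) ∧
      (ph (L' u) = Stage.active → L' u = L u) := by
    intro u hu
    cases hs with
    | internal _ _ ht h => simp [h u hu]
    | broadcast _ _ m ht hl hr h =>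
      by_cases h1 : u = v - 1
      · subst h1; exact hl.stage hP
      · by_cases h2 : u = v + 1
        · subst h2; exact hr.stage hP
        · simp [h u hu h1 h2]
  constructor
  · intro i hi
    by_cases h : i = v
    · subst h
      cases hs with
      | internal _ _ ht h =>
        rw [updateActive_of_not (by simp [hi])]
        exact hZ.idle _ (hP.internal _ _ ht ▸ hi)
      | broadcast _ _ m ht hl hr h => simp [(hP.broadcast _ _ _ ht).2] at hi
    · rw [updateActive_of_ne h]
      exact hZ.idle _ ((key i h).1 hi)
  · intro i hi
    by_cases h : i = v
    · subst h
      exact updateActive_self hi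
    · rw [updateActive_of_ne h, (key i h).2 hi]
      exact hZ.active _ ((key i h).2 hi ▸ hi)

/-- A broadcast of `i` or `i + 1` would make its record defined, so `i` can change only by an
internal step or by a broadcast of `i - 1`. An active step of `i - 1` is copied to the pair. If `i -
1` receives, its record and hence the claim stay as they are, even if it becomes done. -/
theorem Protocol.LeftFed.step (hP : P.Staging ph) {v : ℤ} {b : Bool} {L L' : ℤ → Q}
    {Z : ℤ → Option Q} (hZ : LastActive ph L Z) (hF : P.LeftFed L Z) (hs : P.LineStep v b L L') :
    P.LeftFed L' (updateActive ph v L' Z) := by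
  intro i h1 h2 a ha
  cases hs with
  | internal _ _ ht h =>
    by_cases hact : ph (L' v) = Stage.active
    · have n1 : i ≠ v := by
        rintro rfl
        simp [updateActive_self hact] at h1
      have n2 : i + 1 ≠ v := by
        rintro rfl
        simp [updateActive_self hact] at h2
      rw [updateActive_of_ne n1] at h1
      rw [updateActive_of_ne n2] at h2
      rw [h _ n1]
      by_cases e : i - 1 = v
      · rw [e, updateActive_self hact] at ha
        cases ha
        refine .internal_left _ _ _ (hF i h1 h2 (L v) ?_) ht
        rw [e, hZ.active v (by rw [← hP.internal _ _ ht]; exact hact)]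
        rfl
      · rw [updateActive_of_ne e] at ha
        exact hF i h1 h2 a ha
    · rw [updateActive_of_not hact] at h1 h2 ha
      have hp := hF i h1 h2 a ha
      by_cases e : i = v
      · subst e
        exact .internal_right _ _ _ hp ht
      · rwa [h _ e]
  | broadcast _ _ m ht hl hr h =>
    have hact := (hP.broadcast _ _ _ ht).2
    have n1 : i ≠ v := by
      rintro rfl
      simp [updateActive_self hact] at h1
    have n2 : i + 1 ≠ v := by
      rintro rfl
      simp [updateActive_self hact] at h2
    rw [updateActive_of_ne n1] at h1
    rw [updateActive_of_ne n2] at h2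
    by_cases e : i - 1 = v
    · have e' : i = v + 1 := by omega
      rw [e, updateActive_self hact] at ha
      cases ha
      -- An idle sender has never been active, and neither has its right neighbour `i`, so the
      -- invariant at `v` itself yields a pair with second component `L v`. An active sender is
      -- recorded in `Z`.
      have hadm : P.Admissible (Z (i - 1)) (L v) := by
        rw [e]
        cases hs : ph (L v) with
        | idle =>
          have := hZ.idle _ hs
          rw [this]
          exact hF.pair this (e' ▸ h1)
        | active => rw [hZ.active _ hs]; rfl
        | done => exact absurd hs (hP.broadcast _ _ _ ht).1
      have hp := hF i h1 h2 _ hadm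
      subst e'
      exact .broadcast _ _ _ _ _ hp ht hr
    · rw [updateActive_of_ne e] at ha
      rw [h i n1 (by omega) (by omega)]
      exact hF i h1 h2 a ha

/-- The invariant of an execution on the line from which the coverability of the state of `0`
follows. -/
structure Protocol.LineInvariant (P : Protocol Q M) (ph : Q → Stage) (L : ℤ → Q)
    (Z : ℤ → Option Q) : Prop where
  lastActive : LastActive ph L Z
  left : P.LeftFed L Z
  right : P.LeftFed (fun x => L (-x)) (fun x => Z (-x))
  five : P.SideHolds ph (L (-1)) (Z (-2)) fun w u =>
    P.SideHolds ph (L 1) (Z 2) fun z x => P.Five w u (L 0) x z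

theorem Protocol.LineInvariant.init (hP : P.Staging ph) :
    P.LineInvariant ph (fun _ => P.init) (fun _ => none) where
  lastActive := ⟨fun _ _ => rfl, fun _ h => by simp [hP.init] at h⟩
  left := fun _ _ _ a ⟨x, h⟩ => .next x a h
  right := fun _ _ _ a ⟨x, h⟩ => .next x a h
  five := by
    simp only [Protocol.SideHolds, hP.init]
    rintro w ⟨x, hw⟩ z ⟨y, hz⟩
    exact .start _ _ _ _ hw hz

section

variable {L L' : ℤ → Q} {Z : ℤ → Option Q}

/-- While the inner vertex is idle, an idle outer vertex has been fed from outside only, and an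
active one is recorded exactly. Hence its actual state is among those for which the invariant
provides a quintuple. -/
theorem Protocol.LineInvariant.admissible_left (hI : P.LineInvariant ph L Z)
    (h2 : ph (L (-2)) ≠ Stage.done) (h1 : ph (L (-1)) = Stage.idle) :
    P.Admissible (Z (-2)) (L (-2)) := by
  cases e : ph (L (-2)) with
  | idle =>
    have := hI.lastActive.idle _ e
    rw [this]
    exact hI.left.pair this (hI.lastActive.idle _ h1)
  | active => rw [hI.lastActive.active _ e]; rfl
  | done => contradiction

theorem Protocol.LineInvariant.admissible_right (hI : P.LineInvariant ph L Z)
    (h2 : ph (L 2) ≠ Stage.done) (h1 : ph (L 1) = Stage.idle) : P.Admissible (Z 2) (L 2) := by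
  cases e : ph (L 2) with
  | idle =>
    have := hI.lastActive.idle _ e
    rw [this]
    exact hI.right.pair (i := -2) (by simpa using this)
      (by simpa using hI.lastActive.idle 1 h1)
  | active => rw [hI.lastActive.active _ e]; rfl
  | done => contradiction

theorem Protocol.LineInvariant.five_internal (hP : P.Staging ph) (hI : P.LineInvariant ph L Z)
    {v : ℤ} (ht : ⟨L v, Action.internal, L' v⟩ ∈ P.trans) (hu : ∀ u, u ≠ v → L' u = L u) :
    P.SideHolds ph (L' (-1)) (updateActive ph v L' Z (-2)) fun w u =>
      P.SideHolds ph (L' 1) (updateActive ph v L' Z 2) fun z x => P.Five w u (L' 0) x z := by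
  have hph := hP.internal _ _ ht
  have h5 := hI.five
  by_cases c1 : v = -2
  · subst c1
    rw [hu (-1) (by norm_num), hu 0 (by norm_num), hu 1 (by norm_num),
      updateActive_of_ne (u := 2) (by norm_num)]
    -- Only active internal steps count. Beside an idle inner vertex, an outer vertex that was never
    -- active is represented by all states of pairs at once, and a done one by its last active
    -- state, if it has one.
    by_cases hact : ph (L' (-2)) = Stage.active
    · rw [updateActive_self hact]
      refine h5.outer (hI.admissible_left (by rw [← hph, hact]; simp)) fun h => h.mono ?_
      exact fun z x h => .internal_outer _ _ _ _ _ _ h ht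
    · rwa [updateActive_of_not hact]
  by_cases c2 : v = 2
  · subst c2
    rw [hu (-1) (by norm_num), hu 0 (by norm_num), hu 1 (by norm_num),
      updateActive_of_ne (u := -2) (by norm_num)]
    by_cases hact : ph (L' 2) = Stage.active
    · rw [updateActive_self hact]
      refine h5.mono fun w u h => h.outer (hI.admissible_right (by rw [← hph, hact]; simp)) ?_
      exact fun h => .mirror _ _ _ _ _ (.internal_outer _ _ _ _ _ _ (.mirror _ _ _ _ _ h) ht)
    · rwa [updateActive_of_not hact]
  rw [updateActive_of_ne (Ne.symm c1), updateActive_of_ne (Ne.symm c2)]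
  by_cases c3 : v = -1
  · subst c3
    rw [hu 0 (by norm_num), hu 1 (by norm_num)]
    exact h5.inner_internal hP ht fun w h => h.mono fun z x h => .internal_inner _ _ _ _ _ _ h ht
  by_cases c4 : v = 1
  · subst c4
    rw [hu 0 (by norm_num), hu (-1) (by norm_num)]
    exact h5.mono fun w u h => h.inner_internal hP ht fun z h =>
      .mirror _ _ _ _ _ (.internal_inner _ _ _ _ _ _ (.mirror _ _ _ _ _ h) ht)
  rw [hu _ (Ne.symm c3), hu _ (Ne.symm c4)]
  by_cases c5 : v = 0
  · subst c5
    exact h5.mono fun w u h => h.mono fun z x h => .internal_center _ _ _ _ _ _ h ht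
  rwa [hu _ (Ne.symm c5)]

/-- The cases follow the distance of the sender from the center. The right-hand side reuses the
rules of the left-hand side between two applications of `mirror`. -/
theorem Protocol.LineInvariant.five_broadcast (hP : P.Staging ph) (hI : P.LineInvariant ph L Z)
    {v : ℤ} {m : M} (ht : ⟨L v, Action.broadcast m, L' v⟩ ∈ P.trans)
    (hl : P.Reacts m (L (v - 1)) (L' (v - 1))) (hr : P.Reacts m (L (v + 1)) (L' (v + 1)))
    (hu : ∀ u, u ≠ v → u ≠ v - 1 → u ≠ v + 1 → L' u = L u) :
    P.SideHolds ph (L' (-1)) (updateActive ph v L' Z (-2)) fun w u =>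
      P.SideHolds ph (L' 1) (updateActive ph v L' Z 2) fun z x => P.Five w u (L' 0) x z := by
  have hph := hP.broadcast _ _ _ ht
  have h5 := hI.five
  by_cases c1 : v = -2
  · subst c1
    rw [hu 0 (by norm_num) (by norm_num) (by norm_num),
      hu 1 (by norm_num) (by norm_num) (by norm_num),
      updateActive_of_ne (u := 2) (by norm_num), updateActive_self hph.2]
    norm_num at hr
    exact h5.outer_broadcast hP (hI.admissible_left hph.1) hr fun h =>
      h.mono fun z x h => .broadcast_outer _ _ _ _ _ _ _ _ h ht hr
  by_cases c2 : v = 2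
  · subst c2
    rw [hu 0 (by norm_num) (by norm_num) (by norm_num),
      hu (-1) (by norm_num) (by norm_num) (by norm_num),
      updateActive_of_ne (u := -2) (by norm_num), updateActive_self hph.2]
    norm_num at hl
    exact h5.mono fun w u h => h.outer_broadcast hP (hI.admissible_right hph.1) hl fun h =>
      .mirror _ _ _ _ _ (.broadcast_outer _ _ _ _ _ _ _ _ (.mirror _ _ _ _ _ h) ht hl)
  rw [updateActive_of_ne (Ne.symm c1), updateActive_of_ne (Ne.symm c2)]
  by_cases c3 : v = -1
  · subst c3
    rw [hu 1 (by norm_num) (by norm_num) (by norm_num)]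
    norm_num at hr
    exact h5.inner_broadcast hP ht fun w w' hw h => h.mono fun z x h =>
      .broadcast_inner _ _ _ _ _ _ _ _ _ h ht hw hr
  by_cases c4 : v = 1
  · subst c4
    rw [hu (-1) (by norm_num) (by norm_num) (by norm_num)]
    norm_num at hl
    exact h5.mono fun w u h => h.inner_broadcast hP ht fun z z' hz h =>
      .mirror _ _ _ _ _ (.broadcast_inner _ _ _ _ _ _ _ _ _ (.mirror _ _ _ _ _ h) ht hz hl)
  by_cases c5 : v = 0
  · subst c5
    norm_num at hl hr
    exact h5.react hP hl fun w u u' huu h => h.react hP hr fun z x x' hxx h =>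
      .broadcast_center _ _ _ _ _ _ _ _ _ h ht huu hxx
  rw [hu 0 (by omega) (by omega) (by omega)]
  -- From distance `3` on, a broadcast reaches an outer vertex at most, and the reactions of outer
  -- vertices to it are not recorded.
  by_cases c6 : v = -3 ∨ v = 3 ∨ v < -3 ∨ 3 < v
  · rwa [hu 1 (by omega) (by omega) (by omega), hu (-1) (by omega) (by omega) (by omega)]
  · omega

theorem Protocol.LineInvariant.step (hP : P.Staging ph) (hI : P.LineInvariant ph L Z) {v : ℤ}
    {b : Bool} (hs : P.LineStep v b L L') : P.LineInvariant ph L' (updateActive ph v L' Z) where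
  lastActive := hI.lastActive.step hP hs
  left := hI.left.step hP hI.lastActive hs
  right := by
    rw [updateActive_reflect]
    exact hI.right.step hP ⟨fun i => hI.lastActive.idle _, fun i => hI.lastActive.active _⟩
      hs.reflect
  five := by
    cases hs with
    | internal _ _ ht h => exact hI.five_internal hP ht h
    | broadcast _ _ m ht hl hr h => exact hI.five_broadcast hP ht hl hr h

end

theorem Protocol.LineReach.exists_five (hP : P.Staging ph) {L : ℤ → Q}
    (h : P.LineReach (fun _ _ => True) (fun _ => P.init) L) :
    ∃ w u x z, P.Five w u (L 0) x z := by
  have : ∃ Z, P.LineInvariant ph L Z := by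
    induction h with
    | refl => exact ⟨_, .init hP⟩
    | tail _ hs ih =>
      obtain ⟨Z, hI⟩ := ih
      obtain ⟨v, b, -, hs⟩ := hs
      exact ⟨_, hI.step hP hs⟩
  obtain ⟨Z, hI⟩ := this
  obtain ⟨w, u, h⟩ := hI.five.exists
  obtain ⟨z, x, h⟩ := h.exists
  exact ⟨w, u, x, z, h⟩

/-! ### Transfer between finite lines and the infinite line -/

theorem Protocol.LineReach.translate (d : ℤ) {L L' : ℤ → Q}
    (h : P.LineReach (fun _ _ => True) L L') :
    P.LineReach (fun _ _ => True) (fun x => L (x + d)) (fun x => L' (x + d)) := by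
  refine Relation.ReflTransGen.lift (fun (L : ℤ → Q) (x : ℤ) => L (x + d))
    (fun L L' ⟨v, b, _, hs⟩ => ⟨v - d, b, trivial, ?_⟩) _ _ h
  have e1 : v - d - 1 + d = v - 1 := by ring
  have e2 : v - d + 1 + d = v + 1 := by ring
  cases hs with
  | internal _ _ ht h => exact .internal _ _ _ (by simpa using ht) fun u hu => h _ (by omega)
  | broadcast _ _ m ht hl hr h =>
    exact .broadcast _ _ _ m (by simpa using ht) (by simpa only [e1] using hl)
      (by simpa only [e2] using hr) fun u a b c => h _ (by omega) (by omega) (by omega)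

section Embedding

variable {V : Type} {G : SimpleGraph V} {f : V → ℤ}

/-- Integers outside the image of `f` may have any label: they react but do not act, so the vertices
of `G` never notice them. -/
theorem Protocol.Step.exists_lineStep (hf : Function.Injective f)
    (hG : ∀ u v, G.Adj u v ↔ f u + 1 = f v ∨ f v + 1 = f u) {L L' : V → Q} (h : P.Step G L L')
    {Λ : ℤ → Q} (hΛ : ∀ u, Λ (f u) = L u) :
    ∃ v b Λ', P.LineStep v b Λ Λ' ∧ ∀ u, Λ' (f u) = L' u := by
  obtain ⟨v, ⟨q, α, q'⟩, ht, hq, hq', h⟩ := h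
  simp only at hq hq' h
  subst hq hq'
  cases α with
  | internal =>
    obtain ⟨Λ', hs, h1, h2⟩ := exists_lineStep_internal (L := Λ) (v := f v) (by rw [hΛ]; exact ht)
    refine ⟨_, _, Λ', hs, fun u => ?_⟩
    by_cases hu : u = v
    · rw [hu, h1]
    · rw [h2 _ (hf.ne hu), hΛ, h u hu]
  | receive m => exact h.elim
  | broadcast m =>
    have react : ∀ x, (x = f v - 1 ∨ x = f v + 1) →
        ∃ q, P.Reacts m (Λ x) q ∧ ∀ u, f u = x → q = L' u := by
      intro x hx
      by_cases hu : ∃ u, f u = x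
      · obtain ⟨u, rfl⟩ := hu
        refine ⟨L' u, ?_, fun u' h => by rw [hf h]⟩
        rw [hΛ]
        exact h.1 u ((hG _ _).2 (by omega))
      · obtain ⟨q, hq⟩ := P.exists_reacts m (Λ x)
        exact ⟨q, hq, fun u h => absurd ⟨u, h⟩ hu⟩
    obtain ⟨l, hl, hl'⟩ := react _ (Or.inl rfl)
    obtain ⟨r, hr, hr'⟩ := react _ (Or.inr rfl)
    obtain ⟨Λ', hs, h1, h2, h3, h4⟩ := exists_lineStep_broadcast (L := Λ) (v := f v)
      (by rw [hΛ]; exact ht) hl hr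
    refine ⟨_, _, Λ', hs, fun u => ?_⟩
    by_cases c1 : u = v
    · rw [c1, h1]
    by_cases c2 : f u = f v - 1
    · rw [c2, h2, hl' u c2]
    by_cases c3 : f u = f v + 1
    · rw [c3, h3, hr' u c3]
    rw [h4 _ (hf.ne c1) c2 c3, hΛ, h.2 u c1]
    rw [hG]
    omega

theorem Protocol.Reaches.exists_lineReach (hf : Function.Injective f)
    (hG : ∀ u v, G.Adj u v ↔ f u + 1 = f v ∨ f v + 1 = f u) {L' : V → Q}
    (h : P.Reaches G (fun _ => P.init) L') :
    ∃ Λ', P.LineReach (fun _ _ => True) (fun _ => P.init) Λ' ∧ ∀ u, Λ' (f u) = L' u := by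
  induction h with
  | refl => exact ⟨_, .refl, fun _ => rfl⟩
  | tail _ hs ih =>
    obtain ⟨Λ, h, hΛ⟩ := ih
    obtain ⟨v, b, Λ', hs, h'⟩ := hs.exists_lineStep hf hG hΛ
    exact ⟨Λ', h.step v b trivial hs, h'⟩

theorem Protocol.LineStep.step (hf : Function.Injective f)
    (hG : ∀ u v, G.Adj u v ↔ f u + 1 = f v ∨ f v + 1 = f u) {v : V} {b : Bool} {L L' : ℤ → Q}
    (h : P.LineStep (f v) b L L') : P.Step G (fun u => L (f u)) (fun u => L' (f u)) := by
  cases h with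
  | internal _ _ ht h => exact ⟨v, _, ht, rfl, rfl, fun u hu => h _ (hf.ne hu)⟩
  | broadcast _ _ m ht hl hr h =>
    refine ⟨v, _, ht, rfl, rfl, fun u hu => ?_, fun u hu hn => ?_⟩
    · change P.Reacts m (L (f u)) (L' (f u))
      rcases (hG _ _).1 hu with e | e
      · rw [← e]; exact hr
      · rw [← e, add_sub_cancel_right] at hl; exact hl
    · rw [hG] at hn
      exact h _ (hf.ne hu) (by omega) (by omega)

end Embedding

/-- An execution has finitely many actors. This bound decides how long a path has to be to carry it.
-/
theorem Protocol.LineReach.bounded {L L' : ℤ → Q} (h : P.LineReach (fun _ _ => True) L L') :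
    ∃ N : ℕ, ∀ N' : ℕ, N ≤ N' → P.LineReach (fun v _ => v.natAbs ≤ N') L L' := by
  induction h with
  | refl => exact ⟨0, fun _ _ => .refl⟩
  | tail _ hs ih =>
    obtain ⟨N, h⟩ := ih
    obtain ⟨v, b, -, hs⟩ := hs
    exact ⟨max N v.natAbs, fun N' hN => (h N' (le_of_max_le_left hN)).step v b
      (le_of_max_le_right hN) hs⟩

/-- From left to right, the path is embedded into `ℤ` and translated so that the covered vertex is
the center. From right to left, an execution that realizes the quintuple is cut off outside an
interval that contains all actors. -/
theorem Protocol.coverable_lines_iff (hP : P.Staging ph) (qf : Q) :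
    P.Coverable Lines qf ↔ ∃ w u x z, P.Five w u qf x z := by
  constructor
  · rintro ⟨V, _, G, ⟨n, ⟨e⟩⟩, L', hL, v, rfl⟩
    have hf : Function.Injective fun u => ((e u : Fin n) : ℤ) := fun a b h =>
      e.injective (Fin.ext (by simpa using h))
    obtain ⟨Λ, h, hΛ⟩ := hL.exists_lineReach (f := fun u => ((e u : Fin n) : ℤ)) hf
      (fun u v => by
        rw [← e.map_adj_iff, SimpleGraph.pathGraph_adj]
        norm_cast)
    have := (h.translate ((e v : Fin n) : ℤ)).exists_five hP
    simpa [hΛ] using this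
  · rintro ⟨w, u, x, z, h⟩
    obtain ⟨L, h, -, -, hc, -⟩ := h.exists_lineReach
    obtain ⟨N, h⟩ := h.bounded
    have h := h N le_rfl
    -- The path covers `[-N, N]`, with its middle vertex at the center; all actors have absolute
    -- value at most `N`.
    let f : Fin (2 * N + 1) → ℤ := fun i => (i : ℤ) - N
    have hf : Function.Injective f := fun a b h => Fin.ext (by simp only [f] at h; omega)
    have hG : ∀ u v, (SimpleGraph.pathGraph (2 * N + 1)).Adj u v ↔
        f u + 1 = f v ∨ f v + 1 = f u := by
      intro u v
      rw [SimpleGraph.pathGraph_adj]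
      simp only [f]
      omega
    refine ⟨Fin (2 * N + 1), inferInstance, _, ⟨_, ⟨SimpleGraph.Iso.refl⟩⟩, fun i => L (f i), ?_,
      ⟨N, by omega⟩, by simp [f, hc]⟩
    refine Relation.ReflTransGen.lift (fun (L : ℤ → Q) i => L (f i))
      (fun L L' ⟨v, b, hv, hs⟩ => ?_) _ _ h
    have hv' : f ⟨(v + N).toNat, by omega⟩ = v := by simp only [f]; omega
    rw [← hv'] at hs
    exact hs.step hf hG

/-! ### From phases to stages -/

/-- A `k`-phase-bounded protocol with `k ∈ {1, 2}` has a staging. -/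
theorem Protocol.IsPhaseBounded.exists_staging {k : ℕ} (h1 : 1 ≤ k) (h2 : k ≤ 2)
    (h : P.IsPhaseBounded k) : ∃ ph, P.Staging ph := by
  classical
  obtain ⟨part, h0, -, hd, hi, ht⟩ := h
  -- The last reception phase is done, all proper broadcast phases are active, and the initial part
  -- and the earlier reception phases are idle.
  let ph : Q → Stage := fun q => if q ∈ part k .r then .done else
    if ∃ i, 1 ≤ i ∧ i ≤ k ∧ q ∈ part i .b then .active else .idle
  have hdone : ∀ {q}, q ∈ part k .r → ph q = .done := fun h => by simp [ph, h]
  have hactive : ∀ {q i}, 1 ≤ i → i ≤ k → q ∈ part i .b → ph q = .active := by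
    intro q i a b h
    have : q ∉ part k .r := fun h' => by
      have := hd q i b k le_rfl _ _ h h'
      simp at this
      omega
    simp only [ph, this, if_false]
    rw [if_pos ⟨i, a, b, h⟩]
  have hidle : ∀ {q i}, i < k → q ∈ part i .r → ph q = .idle := by
    intro q i a h
    have n1 : q ∉ part k .r := fun h' => by
      have := (hd q i a.le k le_rfl _ _ h h').1
      omega
    have n2 : ¬ ∃ i, 1 ≤ i ∧ i ≤ k ∧ q ∈ part i .b := by
      rintro ⟨j, a', b', h'⟩
      have := hd q i a.le j b' _ _ h h'
      simp at this
      omega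
    simp [ph, n1, n2]
  refine ⟨ph, hidle (i := 0) (by omega) (h0 ▸ hi), ?_, ?_, ?_⟩
  · intro q q' h
    rcases ht _ h with h | h | h | h | h | h
    · obtain ⟨-, i, hik, β, ha, hb⟩ := h
      simp only at ha hb
      cases β with
      | b =>
        rcases Nat.eq_zero_or_pos i with rfl | hpos
        · rw [h0] at ha hb
          rw [hidle (by omega) ha, hidle (by omega) hb]
        · rw [hactive hpos hik ha, hactive hpos hik hb]
      | r =>
        rcases hik.lt_or_eq with h | rfl
        · rw [hidle h ha, hidle h hb]
        · rw [hdone ha, hdone hb]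
    all_goals simp at h
  · intro q m q' h
    rcases ht _ h with h | h | h | h | h | h
    · simp at h
    · obtain ⟨-, i, hi1, hik, ha, hb⟩ := h
      rw [hactive hi1 hik ha, hactive hi1 hik hb]
      simp
    · simp at h
    · simp at h
    · obtain ⟨-, i, hik, ha, hb⟩ := h
      rw [hidle hik ha, hactive (by omega) (by omega) hb]
      simp
    · simp at h
  · intro q m q' h
    rcases ht _ h with h | h | h | h | h | h
    · simp at h
    · simp at h
    · obtain ⟨-, i, hi1, hik, ha, hb⟩ := h
      rcases hik.lt_or_eq with h | rfl
      · exact Or.inr ⟨hidle h ha, hidle h hb⟩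
      · exact Or.inl (hdone hb)
    · obtain ⟨-, i, hik, ha, hb⟩ := h
      simp only at ha hb
      by_cases e : i + 1 = k
      · exact Or.inl (hdone (e ▸ hb))
      -- Here `k ≤ 2` is essential: a reception that does not lead into the last reception phase
      -- starts in `Q₀`, so it does not return from a proper broadcast phase to a phase from which
      -- broadcasts are possible.
      · obtain rfl : i = 0 := by omega
        rw [h0] at ha
        exact Or.inr ⟨hidle hik ha, hidle (by omega) hb⟩
    · simp at h
    · exact Or.inl (hdone h.2.2)

end LineComplete

/-! ### Structured programs and their compilation to `TM2` machines -/

section Machine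

variable {K A R : Type}

/-- Structured programs over stacks `K` with letters `A` and a register in `R`. -/
inductive Prog (K A R : Type) where
  | push (k : K) (f : R → A)
  | pop (k : K) (f : R → Option A → R)
  | load (f : R → R)
  | seq (p q : Prog K A R)
  | ite (c : R → Bool) (p q : Prog K A R)
  | loop (c : R → Bool) (p : Prog K A R)

/-- The program points of a program. -/
def Prog.Label : Prog K A R → Type
  | .push _ _ => Unit
  | .pop _ _ => Unit
  | .load _ => Unit
  | .seq p q => p.Label ⊕ q.Label
  | .ite _ p q => Option (p.Label ⊕ q.Label)
  | .loop _ p => Option p.Label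

theorem Prog.finite_label : ∀ p : Prog K A R, Finite p.Label
  | .push _ _ => inferInstanceAs (Finite Unit)
  | .pop _ _ => inferInstanceAs (Finite Unit)
  | .load _ => inferInstanceAs (Finite Unit)
  | .seq p q =>
    have := p.finite_label
    have := q.finite_label
    inferInstanceAs (Finite (p.Label ⊕ q.Label))
  | .ite _ p q =>
    have := p.finite_label
    have := q.finite_label
    inferInstanceAs (Finite (Option (p.Label ⊕ q.Label)))
  | .loop _ p =>
    have := p.finite_label
    inferInstanceAs (Finite (Option p.Label))

/-- The program point where a program starts. -/
def Prog.entry : (p : Prog K A R) → p.Label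
  | .push _ _ => ()
  | .pop _ _ => ()
  | .load _ => ()
  | .seq p _ => .inl p.entry
  | .ite _ _ _ => none
  | .loop _ _ => none

/-- The alphabets of the stacks of a machine: the stacks of a program, and an output stack. -/
def tapeAlphabet (K A : Type) : Option K → Type
  | none => Bool
  | some _ => A

/-- The code of a program that is a part of a machine with labels `Λ`: `emb` places its program
points, and it jumps to `exit` when it is done. -/
def Prog.code {Λ : Type} : (p : Prog K A R) → (emb : p.Label → Λ) → (exit : Λ) → p.Label →
    Turing.TM2.Stmt (tapeAlphabet K A) Λ R
  | .push k f, _, exit, _ => .push (some k) f (.goto fun _ => exit)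
  | .pop k f, _, exit, _ => .pop (some k) f (.goto fun _ => exit)
  | .load f, _, exit, _ => .load f (.goto fun _ => exit)
  | .seq p q, emb, exit, l =>
    match l with
    | .inl l => p.code (fun l => emb (.inl l)) (emb (.inr q.entry)) l
    | .inr l => q.code (fun l => emb (.inr l)) exit l
  | .ite c p q, emb, exit, l =>
    match l with
    | none => .branch c (.goto fun _ => emb (some (.inl p.entry)))
        (.goto fun _ => emb (some (.inr q.entry)))
    | some (.inl l) => p.code (fun l => emb (some (.inl l))) exit l
    | some (.inr l) => q.code (fun l => emb (some (.inr l))) exit l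
  | .loop c p, emb, exit, l =>
    match l with
    | none => .branch c (.goto fun _ => emb (some p.entry)) (.goto fun _ => exit)
    | some l => p.code (fun l => emb (some l)) (emb none) l

/-- The stacks of a machine: `S`, and the output `o`. -/
def tapes (S : K → List A) (o : List Bool) : ∀ k : Option K, List (tapeAlphabet K A k)
  | none => o
  | some k => S k

variable [DecidableEq K]

theorem update_tapes (S : K → List A) (o : List Bool) (k : K) (l : List A) :
    Function.update (tapes S o) (some k) l = tapes (Function.update S k l) o := by
  funext x
  cases x with
  | none => rfl
  | some x =>
    by_cases h : x = k
    · subst h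
      exact (Function.update_self (β := fun k => List (tapeAlphabet K A k)) ..).trans
        (Function.update_self (f := S) x l).symm
    · have h' : Function.update S k l x = S x := Function.update_of_ne h l S
      exact (Function.update_of_ne (β := fun k => List (tapeAlphabet K A k))
        (fun e => h (Option.some.inj e)) ..).trans h'.symm

/-- `Prog.Runs p r S r' S' t`: the program `p` leads from the register `r` and the stacks `S` to
`r'` and `S'` in time `t`. -/
inductive Prog.Runs : Prog K A R → R → (K → List A) → R → (K → List A) → ℕ → Prop
  | push (k f r S) : Runs (.push k f) r S r (Function.update S k (f r :: S k)) 1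
  | pop (k f r S) : Runs (.pop k f) r S (f r (S k).head?) (Function.update S k (S k).tail) 1
  | load (f r S) : Runs (.load f) r S (f r) S 1
  | seq {p q r S r' S' r'' S'' t t'} (hp : Runs p r S r' S' t) (hq : Runs q r' S' r'' S'' t') :
      Runs (.seq p q) r S r'' S'' (t + t')
  | ite_true {c p q r S r' S' t} (hc : c r = true) (hp : Runs p r S r' S' t) :
      Runs (.ite c p q) r S r' S' (1 + t)
  | ite_false {c p q r S r' S' t} (hc : c r = false) (hq : Runs q r S r' S' t) :
      Runs (.ite c p q) r S r' S' (1 + t)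
  | loop_false {c p r S} (hc : c r = false) : Runs (.loop c p) r S r S 1
  | loop_true {c p r S r' S' r'' S'' t t'} (hc : c r = true) (hp : Runs p r S r' S' t)
      (hl : Runs (.loop c p) r' S' r'' S'' t') : Runs (.loop c p) r S r'' S'' (1 + t + t')

theorem evalsTo_trans {σ : Type} {f : σ → Option σ} {a b : σ} {c : Option σ} {m n : ℕ}
    (h1 : (flip bind f)^[m] (some a) = some b) (h2 : (flip bind f)^[n] (some b) = c) :
    (flip bind f)^[m + n] (some a) = c := by
  rw [add_comm, Function.iterate_add_apply, h1, h2]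

/-- Correctness of the compilation, with equality of running times. The embedding of the labels and
the exit label are universally quantified so that the induction applies to a program in any context.
-/
theorem Prog.Runs.evalsTo {Λ : Type} {m : Λ → Turing.TM2.Stmt (tapeAlphabet K A) Λ R}
    {p : Prog K A R} {r r' : R} {S S' : K → List A} {t : ℕ} (h : p.Runs r S r' S' t)
    (o : List Bool) : ∀ (emb : p.Label → Λ) (exit : Λ), (∀ l, m (emb l) = p.code emb exit l) →
    (flip bind (Turing.TM2.step m))^[t] (some ⟨some (emb p.entry), r, tapes S o⟩) =
      some ⟨some exit, r', tapes S' o⟩ := by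
  induction h with
  | push k f r S =>
    intro emb exit hm
    have := hm ()
    simp only [Prog.code] at this
    simp [flip, Prog.entry, Turing.TM2.step, this, ← update_tapes]
    rfl
  | pop k f r S =>
    intro emb exit hm
    have := hm ()
    simp only [Prog.code] at this
    simp [flip, Prog.entry, Turing.TM2.step, this, ← update_tapes]
    rfl
  | load f r S =>
    intro emb exit hm
    have := hm ()
    simp only [Prog.code] at this
    simp [flip, Prog.entry, Turing.TM2.step, this]
  | seq hp hq ihp ihq =>
    intro emb exit hm
    exact evalsTo_trans (ihp (fun l => emb (.inl l)) _ fun l => hm (.inl l))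
      (ihq (fun l => emb (.inr l)) exit fun l => hm (.inr l))
  | ite_true hc hp ih =>
    intro emb exit hm
    refine evalsTo_trans ?_ (ih (fun l => emb (some (.inl l))) exit fun l => hm (some (.inl l)))
    have := hm none
    simp only [Prog.code] at this
    simp [flip, Prog.entry, Turing.TM2.step, this, hc]
  | ite_false hc hp ih =>
    intro emb exit hm
    refine evalsTo_trans ?_ (ih (fun l => emb (some (.inr l))) exit fun l => hm (some (.inr l)))
    have := hm none
    simp only [Prog.code] at this
    simp [flip, Prog.entry, Turing.TM2.step, this, hc]
  | loop_false hc =>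
    intro emb exit hm
    have := hm none
    simp only [Prog.code] at this
    simp [flip, Prog.entry, Turing.TM2.step, this, hc]
  | loop_true hc hp hl ihp ihl =>
    intro emb exit hm
    refine evalsTo_trans (evalsTo_trans ?_ (ihp (fun l => emb (some l)) (emb none)
      fun l => hm (some l))) (ihl emb exit hm)
    have := hm none
    simp only [Prog.code] at this
    simp [flip, Prog.entry, Turing.TM2.step, this, hc]

/-- The machine that runs `p` and then outputs what `res` finds in the register. -/
noncomputable def Prog.machine [Fintype K] [Fintype A] [Fintype R] (p : Prog K A R) (k₀ : K)
    (r₀ : R) (res : R → Bool) : Turing.FinTM2 :=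
  letI := p.finite_label
  letI : Fintype (Option p.Label) := Fintype.ofFinite _
  letI : Fintype (tapeAlphabet K A (some k₀)) := inferInstanceAs (Fintype A)
  { K := Option K
    k₀ := some k₀
    k₁ := none
    Γ := tapeAlphabet K A
    Λ := Option p.Label
    main := some p.entry
    σ := R
    initialState := r₀
    m := fun l =>
      match l with
      | some l => p.code some none l
      | none => .push (k := none) res (.load (fun _ => r₀) .halt) }

/-- A predicate that is decided by a program in polynomial time is in P. -/
theorem Prog.inPolyTime [Fintype K] [Fintype A] [Fintype R] (p : Prog K A R) (k₀ : K) (r₀ : R)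
    (res : R → Bool) {α : Type} (enc : α → List A) (pred : α → Prop) (time : Polynomial ℕ)
    (h : ∀ a, ∃ r t, t ≤ time.eval (enc a).length ∧ (res r = true ↔ pred a) ∧
      p.Runs r₀ (Function.update (fun _ => []) k₀ (enc a)) r (fun _ => []) t) :
    InPolyTime enc pred := by
  classical
  refine ⟨{ tm := p.machine k₀ r₀ res, inputAlphabet := Equiv.refl A,
            outputAlphabet := Equiv.refl Bool, time := time + 1, outputsFun := fun a => ?_ }⟩
  have h := h a
  refine Classical.choice ?_
  obtain ⟨r, t, ht, hr, hp⟩ := h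
  -- The additional step belongs to the final label: it pushes the answer, resets the register and
  -- halts. The halting configuration of `TM2` has nothing but the output on its stacks, hence the
  -- demand that the program empty its own.
  refine ⟨⟨⟨t + 1, ?_⟩, by simpa using ht⟩⟩
  have key := hp.evalsTo (m := (p.machine k₀ r₀ res).m) [] some none (fun _ => rfl)
  have hinit : Turing.initList (p.machine k₀ r₀ res) (List.map (Equiv.refl A).invFun (enc a)) =
      ⟨some (some p.entry), r₀, tapes (Function.update (fun _ => []) k₀ (enc a)) []⟩ := by
    unfold Turing.initList
    congr 1
    funext k
    cases k with
    | none => rfl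
    | some k =>
      by_cases e : k = k₀
      · subst e
        refine (dif_pos rfl).trans ((List.map_id (enc a)).trans ?_)
        exact (Function.update_self (f := fun _ => []) ..).symm
      · exact (dif_neg (fun h => e (Option.some.inj h))).trans (Function.update_of_ne (f := fun _ => []) e ..).symm
  have hhalt : Turing.haltList (p.machine k₀ r₀ res) (List.map (Equiv.refl Bool).invFun
      (Computability.encodeBool (decide (pred a)))) = ⟨none, r₀, tapes (fun _ => []) [res r]⟩ := by
    unfold Turing.haltList
    congr 1
    funext k
    have hd : decide (pred a) = res r := by
      rw [Bool.eq_iff_iff, hr, decide_eq_true_iff]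
    cases k with
    | none =>
      rw [hd]
      rfl
    | some k => rfl
  change (flip bind (Turing.TM2.step (p.machine k₀ r₀ res).m))^[t + 1] _ = _
  rw [hinit, Option.map_some, hhalt]
  refine evalsTo_trans key ?_
  change some (_ : Turing.TM2.Cfg (tapeAlphabet K A) (Option p.Label) R) = _
  refine congrArg some ?_
  change Turing.TM2.Cfg.mk none r₀ _ = _
  congr 1
  funext k
  cases k with
  | none => rfl
  | some k => rfl
end Machine

/-! ### Runs within a time bound -/

section Macros

variable {K A R : Type} [DecidableEq K]

/-- `p` leads from `r` and `S` to `r'` and `S'` within time `T`. -/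
def Prog.RunsIn (p : Prog K A R) (r : R) (S : K → List A) (r' : R) (S' : K → List A) (T : ℕ) :
    Prop :=
  ∃ t ≤ T, p.Runs r S r' S' t

variable {p q : Prog K A R} {r r' r'' : R} {S S' S'' : K → List A} {T T' T'' : ℕ}

theorem Prog.RunsIn.seq (hp : p.RunsIn r S r' S' T) (hq : q.RunsIn r' S' r'' S'' T') :
    (Prog.seq p q).RunsIn r S r'' S'' (T + T') := by
  obtain ⟨t, ht, hp⟩ := hp
  obtain ⟨t', ht', hq⟩ := hq
  exact ⟨_, add_le_add ht ht', hp.seq hq⟩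

theorem Prog.RunsIn.mono (hp : p.RunsIn r S r' S' T) (h : T ≤ T') : p.RunsIn r S r' S' T' := by
  obtain ⟨t, ht, hp⟩ := hp
  exact ⟨t, ht.trans h, hp⟩

theorem Prog.RunsIn.cast (hp : p.RunsIn r S r' S' T) (hS : ∀ k, S' k = S'' k) (h : T ≤ T') :
    p.RunsIn r S r' S'' T' :=
  funext hS ▸ hp.mono h

theorem Prog.RunsIn.ite_true {c : R → Bool} (hc : c r = true) (hp : p.RunsIn r S r' S' T) :
    (Prog.ite c p q).RunsIn r S r' S' (1 + T) := by
  obtain ⟨t, ht, hp⟩ := hp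
  exact ⟨_, Nat.add_le_add_left ht 1, .ite_true hc hp⟩

theorem Prog.RunsIn.ite_false {c : R → Bool} (hc : c r = false) (hq : q.RunsIn r S r' S' T) :
    (Prog.ite c p q).RunsIn r S r' S' (1 + T) := by
  obtain ⟨t, ht, hq⟩ := hq
  exact ⟨_, Nat.add_le_add_left ht 1, .ite_false hc hq⟩

theorem Prog.RunsIn.load (f : R → R) : (Prog.load f).RunsIn r S (f r) S 1 :=
  ⟨1, le_rfl, .load f r S⟩

theorem Prog.RunsIn.skip : (Prog.load id : Prog K A R).RunsIn r S r S 1 :=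
  .load id

theorem Prog.RunsIn.push (k : K) (f : R → A) :
    (Prog.push k f).RunsIn r S r (Function.update S k (f r :: S k)) 1 :=
  ⟨1, le_rfl, .push k f r S⟩

theorem Prog.RunsIn.pop (k : K) (f : R → Option A → R) :
    (Prog.pop k f).RunsIn r S (f r (S k).head?) (Function.update S k (S k).tail) 1 :=
  ⟨1, le_rfl, .pop k f r S⟩

end Macros

/-! ### The stacks of the machine and basic routines -/

/-- The register of the machine: two letters, two flags, and a small counter. -/
structure Reg where
  cur : Option Symb
  cur' : Option Symb
  ok : Bool
  found : Bool
  count : Fin 4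
  deriving Fintype

/-- The stacks of the machine. -/
inductive Stack where
  | inp
  | dom (b : Bool)
  | iter (x : Fin 14)
  | cur (x : Fin 14)
  | facts
  | facts'
  | query
  | query'
  | tmp
  deriving DecidableEq, Fintype

/-- Programs over the stacks of the machine. -/
abbrev SProg := Prog Stack Symb Reg

/-- The contents of the stacks of the machine. -/
abbrev Store := Stack → List Symb

namespace SProg

/-- Push the current letter. -/
def put (k : Stack) : SProg := .push k fun r => r.cur.getD .sep

/-- Pop a letter and make it the current letter. -/
def next (k : Stack) : SProg := .pop k fun r a => { r with cur := a }

/-- Pop the stack `k` until the test `c` fails for its top, which is popped as well, or the stack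
is empty, and run `p` for the letters. -/
def popWhile (c : Symb → Bool) (k : Stack) (p : SProg) : SProg :=
  .seq (next k) (.loop (fun r => r.cur.any c) (.seq p (next k)))

variable {c : Symb → Bool} {k : Stack} {p : SProg} {r r' r'' : Reg} {S S' S'' : Store} {T T' : ℕ}

theorem runsIn_put {a : Symb} (h : r.cur = some a) :
    (put k).RunsIn r S r (Function.update S k (a :: S k)) 1 := by
  have := Prog.RunsIn.push (r := r) (S := S) k (fun r : Reg => r.cur.getD .sep)
  simp only [h, Option.getD_some] at this
  exact this

theorem runsIn_popWhile_nil (h : S k = []) :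
    (popWhile c k p).RunsIn r S { r with cur := none } S 2 := by
  have h1 := Prog.RunsIn.pop (r := r) (S := S) k (fun (r : Reg) a => { r with cur := a })
  have e : Function.update S k (S k).tail = S := by simp [h]
  rw [e, h] at h1
  exact h1.seq ⟨1, le_rfl, .loop_false rfl⟩

theorem runsIn_popWhile_stop {a : Symb} {l : List Symb} (h : S k = a :: l) (hc : c a = false) :
    (popWhile c k p).RunsIn r S { r with cur := some a } (Function.update S k l) 2 := by
  have h1 := Prog.RunsIn.pop (r := r) (S := S) k (fun (r : Reg) a => { r with cur := a })
  rw [h] at h1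
  exact h1.seq ⟨1, le_rfl, .loop_false (by simpa using hc)⟩

theorem runsIn_popWhile_cons {a : Symb} {l : List Symb} (h : S k = a :: l) (hc : c a = true)
    (hp : p.RunsIn { r with cur := some a } (Function.update S k l) r' S' T)
    (hl : (popWhile c k p).RunsIn r' S' r'' S'' T') :
    (popWhile c k p).RunsIn r S r'' S'' (2 + T + T') := by
  obtain ⟨t, ht, hp⟩ := hp
  obtain ⟨t', ht', hl⟩ := hl
  have h1 := Prog.Runs.pop k (fun (r : Reg) a => { r with cur := a }) r S
  rw [h] at h1
  unfold popWhile at hl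
  -- The run for the remaining letters begins with a pop, which is the pop at the end of the loop
  -- body here; so it is split, and its parts are regrouped.
  cases hl with
  | seq h2 h3 =>
    exact ⟨_, by omega, h1.seq (.loop_true (by simpa using hc) (hp.seq h2) h3)⟩

/-- Push the current letter to all of the given stacks. -/
def putAll (ks : List Stack) : SProg := ks.foldr (fun k p => .seq (put k) p) (.load id)

/-- Empty a stack, and push its letters to all of the given stacks. -/
def pour (k : Stack) (ks : List Stack) : SProg := popWhile (fun _ => true) k (putAll ks)

theorem runsIn_putAll {a : Symb} (h : r.cur = some a) (ks : List Stack) (hk : ks.Nodup)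
    (S : Store) :
    (putAll ks).RunsIn r S r (fun k => if k ∈ ks then a :: S k else S k) (ks.length + 1) := by
  induction ks generalizing S with
  | nil => exact Prog.RunsIn.skip.cast (by simp) (by simp)
  | cons k ks ih =>
    have := (runsIn_put (k := k) (S := S) h).seq (ih hk.of_cons _)
    refine this.cast (fun x => ?_) (by simp; omega)
    have hn : k ∉ ks := (List.nodup_cons.1 hk).1
    by_cases hx : x = k
    · subst hx; simp [hn]
    · simp [hx]

theorem runsIn_pour (k : Stack) (ks : List Stack) (hks : ks.Nodup) (hk : k ∉ ks) (r : Reg)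
    (S : Store) :
    (pour k ks).RunsIn r S { r with cur := none }
      (fun x => if x = k then [] else if x ∈ ks then (S k).reverse ++ S x else S x)
      ((S k).length * (ks.length + 3) + 2) := by
  generalize h : S k = l
  induction l generalizing r S with
  | nil =>
    have := runsIn_popWhile_nil (c := fun _ => true) (p := putAll ks) (r := r) h
    refine this.cast (fun x => ?_) (by simp)
    split_ifs with h1 h2
    · rw [h1, h]
    · simp
    · rfl
  | cons a l ih =>
    have h1 := runsIn_putAll (r := { r with cur := some a }) rfl ks hks (Function.update S k l)
    have h2 := ih { r with cur := some a } (fun x => if x ∈ ks then a :: Function.update S k l x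
      else Function.update S k l x) (by simp [hk])
    have h3 := runsIn_popWhile_cons (c := fun _ => true) h rfl h1 h2
    refine h3.cast (fun x => ?_) (by simp only [List.length_cons]; ring_nf; omega)
    split_ifs with h1 h2
    · rfl
    · simp [h1]
    · simp [h1]

/-- Read the input to the next separator, and push what is read to the stack `k`. -/
def readTo (k : Stack) : SProg := popWhile (fun a => a != .sep) .inp (put k)

theorem runsIn_readTo (k : Stack) (hk : k ≠ .inp) (w : List Symb) (hw : Symb.sep ∉ w)
    (l : List Symb) (r : Reg) (S : Store) (h : S .inp = w ++ Symb.sep :: l) :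
    ∃ r', (readTo k).RunsIn r S r'
      (Function.update (Function.update S .inp l) k (w.reverse ++ S k)) (w.length * 3 + 2) := by
  induction w generalizing r S with
  | nil =>
    have := runsIn_popWhile_stop (c := fun a => a != .sep) (p := put k) (r := r) h rfl
    refine ⟨_, this.cast (fun x => ?_) (by simp)⟩
    by_cases hx : x = k
    · subst hx; simp [hk]
    · simp [hx]
  | cons a w ih =>
    simp only [List.mem_cons, not_or] at hw
    have h1 := runsIn_put (k := k) (r := { r with cur := some a })
      (S := Function.update S .inp (w ++ Symb.sep :: l)) rfl
    obtain ⟨r', h2⟩ := ih hw.2 { r with cur := some a } (Function.update (Function.update S .inp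
      (w ++ Symb.sep :: l)) k (a :: Function.update S .inp (w ++ Symb.sep :: l) k))
      (by rw [Function.update_of_ne hk.symm]; simp)
    have h3 := runsIn_popWhile_cons (c := fun a => a != .sep) h (by simpa using Ne.symm hw.1) h1 h2
    refine ⟨r', h3.cast (fun x => ?_) (by simp only [List.length_cons]; omega)⟩
    by_cases hx : x = k
    · subst hx; simp [hk]
    · by_cases hi : x = .inp
      · subst hi; simp [hx]
      · simp [hx, hi]

/-- The last part of the input is ended by the empty stack instead of a separator. -/
theorem runsIn_readTo_end (k : Stack) (hk : k ≠ .inp) (w : List Symb) (hw : Symb.sep ∉ w)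
    (r : Reg) (S : Store) (h : S .inp = w) :
    ∃ r', (readTo k).RunsIn r S r'
      (Function.update (Function.update S .inp []) k (w.reverse ++ S k)) (w.length * 3 + 2) := by
  induction w generalizing r S with
  | nil =>
    have := runsIn_popWhile_nil (c := fun a => a != .sep) (p := put k) (r := r) h
    refine ⟨_, this.cast (fun x => ?_) (by simp)⟩
    by_cases hx : x = k
    · subst hx; simp
    · by_cases hi : x = .inp
      · subst hi; simp [hx, h]
      · simp [hx, hi]
  | cons a w ih =>
    simp only [List.mem_cons, not_or] at hw
    have h1 := runsIn_put (k := k) (r := { r with cur := some a })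
      (S := Function.update S .inp w) rfl
    obtain ⟨r', h2⟩ := ih hw.2 { r with cur := some a } (Function.update (Function.update S .inp
      w) k (a :: Function.update S .inp w k)) (by rw [Function.update_of_ne hk.symm]; simp)
    have h3 := runsIn_popWhile_cons (c := fun a => a != .sep) h (by simpa using Ne.symm hw.1) h1 h2
    refine ⟨r', h3.cast (fun x => ?_) (by simp only [List.length_cons]; omega)⟩
    by_cases hx : x = k
    · subst hx; simp [hk]
    · by_cases hi : x = .inp
      · subst hi; simp [hx]
      · simp [hx, hi]

/-! ### Search for a word among the facts -/

/-- The body of the search for the query among the facts. -/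
def searchBody : SProg :=
  .seq (put .facts') <| .seq (.pop .query fun r a => { r with cur' := a }) <|
  .seq (.ite (fun r => r.cur'.isSome) (.push .query' fun r => r.cur'.getD .sep) (.load id)) <|
  .seq (.load fun r => { r with ok := r.ok && r.cur == r.cur' }) <|
  .ite (fun r => r.cur == some .sep)
    (.seq (.load fun r => { r with ok := true, found := r.found || r.ok }) (pour .query' [.query]))
    (.load id)

/-- The agreement of a word with the beginning of another one. -/
def agrees : List Symb → List Symb → Bool
  | [], _ => true
  | a :: v, w => (w.head? == some a) && agrees v w.tail

/-- A separator ends both words and does not occur inside, so agreement with a prefix is equality.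
-/
theorem agrees_iff (v w : List Symb) (hv : Symb.sep ∉ v) (hw : Symb.sep ∉ w) :
    agrees (v ++ [.sep]) (w ++ [.sep]) = true ↔ v = w := by
  induction v generalizing w with
  | nil =>
    cases w with
    | nil => simp [agrees]
    | cons b w =>
      simp only [List.mem_cons, not_or] at hw
      simp [agrees, Ne.symm hw.1]
  | cons a v ih =>
    simp only [List.mem_cons, not_or] at hv
    cases w with
    | nil => simp [agrees, hv.1]
    | cons b w =>
      simp only [List.mem_cons, not_or] at hw
      simp [agrees, ih w hv.2 hw.2, eq_comm (a := b)]

end SProg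

/-- A list of words, each followed by a separator. -/
def joinFacts (db : List (List Symb)) : List Symb := db.flatMap fun w => w ++ [.sep]

namespace SProg

/-- The loop that compares all the facts with the query. -/
def searchLoop : SProg := popWhile (fun _ => true) .facts searchBody

/-- Search the query among the facts, and forget it. -/
def search : SProg :=
  .seq (.load fun r => { r with ok := true, found := false }) <|
  .seq searchLoop <| .seq (pour .facts' [.facts]) (pour .query [])

/-- The stacks `S`, with the given contents of those that take part in a search. -/
def scanStore (S : Store) (f g q u : List Symb) : Store
  | .facts => f
  | .facts' => g
  | .query => q
  | .query' => u
  | k => S k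

variable {S : Store} {f g q u : List Symb} {c : Option Symb} {c' : Option Symb} {ok fd : Bool}
  {n : Fin 4}

/-- The final test is left to the hypothesis because its outcome depends on whether a fact ends with
this letter. -/
theorem runsIn_searchBody (a : Symb) {r' : Reg} {S' : Store} {T : ℕ}
    (h : (Prog.ite (fun r : Reg => r.cur == some .sep)
      (.seq (.load fun r => { r with ok := true, found := r.found || r.ok })
        (pour .query' [.query])) (.load id)).RunsIn
      ⟨some a, q.head?, ok && some a == q.head?, fd, n⟩
      (scanStore S f (a :: g) q.tail (q.head?.toList ++ u)) r' S' T) :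
    searchBody.RunsIn ⟨some a, c', ok, fd, n⟩ (scanStore S f g q u) r' S' (5 + T) := by
  have h1 : (put .facts').RunsIn ⟨some a, c', ok, fd, n⟩ (scanStore S f g q u)
      ⟨some a, c', ok, fd, n⟩ (scanStore S f (a :: g) q u) 1 :=
    (runsIn_put rfl).cast (fun k => by cases k <;> simp [scanStore]) le_rfl
  have h2 : Prog.RunsIn (.pop .query fun (r : Reg) a => { r with cur' := a })
      ⟨some a, c', ok, fd, n⟩ (scanStore S f (a :: g) q u)
      ⟨some a, q.head?, ok, fd, n⟩ (scanStore S f (a :: g) q.tail u) 1 :=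
    (Prog.RunsIn.pop _ _).cast (fun k => by cases k <;> simp [scanStore]) le_rfl
  have h3 : (Prog.ite (fun r : Reg => r.cur'.isSome) (.push .query' fun r => r.cur'.getD .sep)
      (.load id)).RunsIn ⟨some a, q.head?, ok, fd, n⟩ (scanStore S f (a :: g) q.tail u)
      ⟨some a, q.head?, ok, fd, n⟩ (scanStore S f (a :: g) q.tail (q.head?.toList ++ u)) 2 := by
    cases q with
    | nil => exact Prog.RunsIn.ite_false (by rfl) Prog.RunsIn.skip
    | cons b q =>
      refine Prog.RunsIn.cast (Prog.RunsIn.ite_true ?_ (Prog.RunsIn.push _ _)) (fun k => ?_) le_rfl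
      · rfl
      · cases k <;> simp [scanStore]
  have h4 := Prog.RunsIn.load (S := scanStore S f (a :: g) q.tail (q.head?.toList ++ u))
    (r := ⟨some a, q.head?, ok, fd, n⟩)
    (fun r : Reg => { r with ok := r.ok && r.cur == r.cur' })
  exact (h1.seq (h2.seq (h3.seq (h4.seq h)))).mono (by omega)

/-- During a comparison the letters of the query wander from `query` to `query'`, so their total
number stays at most `W`; at the separator they are poured back. The induction runs over the letters
of one fact, while the loop runs over all facts; therefore the rest of the loop enters as a
hypothesis. -/
theorem runsIn_searchLoop_fact (e : List Symb) (he : Symb.sep ∉ e) (l : List Symb) (W : ℕ)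
    (c c' : Option Symb) (ok : Bool) (g q u : List Symb) (hW : q.length + u.length ≤ W) :
    ∃ d d', ∀ (r' : Reg) (S' : Store) (T : ℕ),
      searchLoop.RunsIn ⟨d, d', true, fd || (ok && agrees (e ++ [.sep]) q), n⟩
        (scanStore S l (Symb.sep :: (e.reverse ++ g)) (u.reverse ++ q) []) r' S' T →
      searchLoop.RunsIn ⟨c, c', ok, fd, n⟩ (scanStore S (e ++ Symb.sep :: l) g q u) r' S'
        (e.length * 9 + (4 * W + 20) + T) := by
  induction e generalizing c c' ok g q u with
  | nil =>
    refine ⟨none, q.head?, fun r' S' T h => ?_⟩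
    have hp := (Prog.RunsIn.load (S := scanStore S l (Symb.sep :: g) q.tail (q.head?.toList ++ u))
      (r := ⟨some .sep, q.head?, ok && some .sep == q.head?, fd, n⟩)
      (fun r : Reg => { r with ok := true, found := r.found || r.ok })).seq
      (runsIn_pour .query' [.query] (by simp) (by simp) _ _)
    have hb := runsIn_searchBody (c' := c') _ (Prog.RunsIn.ite_true (by rfl) hp)
    have hq : (q.head?.toList ++ u).length ≤ W := by
      cases q with
      | nil => simp at hW ⊢; omega
      | cons a q => simp at hW ⊢; omega
    refine (runsIn_popWhile_cons (a := .sep) (l := l) rfl rfl (?_ : searchBody.RunsIn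
      ⟨some .sep, c', ok, fd, n⟩ _ _ _ (5 + (1 + (1 + (W * 4 + 2)))))
        h).mono (by simp only [List.length_nil]; omega)
    have e : Function.update (scanStore S ([] ++ Symb.sep :: l) g q u) .facts l =
        scanStore S l g q u := by
      funext k; cases k <;> simp [scanStore]
    rw [e]
    have e2 : agrees ([] ++ [Symb.sep]) q = (some Symb.sep == q.head?) := by
      simp [agrees, Bool.beq_comm]
    rw [e2]
    refine hb.cast (fun k => ?_) (by simp only [scanStore, List.length_singleton]; omega)
    cases k <;> simp [scanStore]
    cases q <;> simp
  | cons a e ih =>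
    simp only [List.mem_cons, not_or] at he
    have hb := runsIn_searchBody (c' := c') (S := S) (f := e ++ Symb.sep :: l) (g := g) (q := q)
      (u := u) (ok := ok) (fd := fd) (n := n) a (Prog.RunsIn.ite_false
        (by simpa using Ne.symm he.1) Prog.RunsIn.skip)
    obtain ⟨d, d', h2⟩ := ih he.2 (some a) q.head? (ok && some a == q.head?) (a :: g) q.tail
      (q.head?.toList ++ u) (by
        cases q with
        | nil => simp at hW ⊢; omega
        | cons a q => simp at hW ⊢; omega)
    refine ⟨d, d', fun r' S' T h => ?_⟩
    have e1 : (ok && agrees (a :: e ++ [Symb.sep]) q) =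
        (ok && some a == q.head? && agrees (e ++ [Symb.sep]) q.tail) := by
      simp [agrees, Bool.beq_comm, Bool.and_assoc]
    have e2 : (a :: e).reverse ++ g = e.reverse ++ (a :: g) := by simp
    have e3 : (q.head?.toList ++ u).reverse ++ q.tail = u.reverse ++ q := by
      cases q <;> simp
    rw [e3] at h2
    rw [e1, e2] at h
    replace h2 := h2 _ _ _ h
    refine (runsIn_popWhile_cons (a := a) (l := e ++ Symb.sep :: l) rfl rfl
      (?_ : searchBody.RunsIn ⟨some a, c', ok, fd, n⟩ _ _ _ _) h2).mono
        (T := 2 + (5 + (1 + 1)) + (e.length * 9 + (4 * W + 20) + T))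
        (by simp only [List.length_cons]; omega)
    have e : Function.update (scanStore S (a :: e ++ Symb.sep :: l) g q u) .facts
        (e ++ Symb.sep :: l) = scanStore S (e ++ Symb.sep :: l) g q u := by
      funext k; cases k <;> simp [scanStore]
    rw [e]
    exact hb

theorem runsIn_searchLoop (w : List Symb) (hw : Symb.sep ∉ w) (db : List (List Symb))
    (hdb : ∀ e ∈ db, Symb.sep ∉ e) (c c' : Option Symb) (fd : Bool) (n : Fin 4) (g : List Symb) :
    ∃ r' : Reg, r'.found = (fd || decide (w ∈ db)) ∧
      searchLoop.RunsIn ⟨c, c', true, fd, n⟩ (scanStore S (joinFacts db) g (w ++ [.sep]) []) r'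
        (scanStore S [] ((joinFacts db).reverse ++ g) (w ++ [.sep]) [])
        ((joinFacts db).length * (4 * w.length + 33) + 2) := by
  induction db generalizing c c' fd g with
  | nil =>
    refine ⟨⟨none, c', true, fd, n⟩, by simp, ?_⟩
    exact (runsIn_popWhile_nil rfl).cast (fun k => rfl) (by simp)
  | cons e db ih =>
    have hdb' := fun e h => hdb e (List.mem_cons_of_mem _ h)
    have he : Symb.sep ∉ e := hdb e (by simp)
    have e1 : (fd || (true && agrees (e ++ [.sep]) (w ++ [.sep])) || decide (w ∈ db)) =
        (fd || decide (w ∈ e :: db)) := by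
      have := agrees_iff e w he hw
      rw [Bool.eq_iff_iff]
      simp only [Bool.true_and, Bool.or_eq_true, this, decide_eq_true_eq, List.mem_cons]
      rw [eq_comm (a := e), or_assoc]
    have e2 : joinFacts (e :: db) = e ++ Symb.sep :: joinFacts db := by simp [joinFacts]
    obtain ⟨d, d', h1⟩ := runsIn_searchLoop_fact (S := S) (fd := fd) (n := n) e he (joinFacts db)
      (w.length + 1) c c' true g (w ++ [.sep]) [] (by simp)
    obtain ⟨r', hr, h2⟩ := ih hdb' d d' (fd || (true && agrees (e ++ [.sep]) (w ++ [.sep])))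
      (Symb.sep :: (e.reverse ++ g))
    refine ⟨r', hr.trans e1, ?_⟩
    rw [e2]
    refine (h1 _ _ _ h2).cast (fun k => ?_) ?_
    · cases k <;> simp [scanStore]
    · simp only [List.length_append, List.length_cons]
      nlinarith [Nat.zero_le (e.length * w.length)]

theorem runsIn_search (w : List Symb) (hw : Symb.sep ∉ w) (db : List (List Symb))
    (hdb : ∀ e ∈ db, Symb.sep ∉ e) (r : Reg) (S : Store) (h1 : S .facts = joinFacts db)
    (h2 : S .facts' = []) (h3 : S .query = w ++ [.sep]) (h4 : S .query' = []) :
    ∃ r' : Reg, r'.found = decide (w ∈ db) ∧ search.RunsIn r S r' (Function.update S .query [])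
      (((joinFacts db).length + 1) * (4 * w.length + 40)) := by
  have e : scanStore S (joinFacts db) [] (w ++ [.sep]) [] = S := by
    funext k; cases k <;> simp [scanStore, h1, h2, h3, h4]
  obtain ⟨r', hr, h⟩ := runsIn_searchLoop (S := S) w hw db hdb r.cur r.cur' false r.count []
  rw [e] at h
  -- The comparison leaves the facts reversed in `facts'`: the first pour restores them, the second
  -- erases the query.
  have h5 := (runsIn_pour .facts' [.facts] (by simp) (by simp) r' _).seq
    (runsIn_pour .query [] (by simp) (by simp) _ (fun x =>
      if x = .facts' then [] else if x ∈ [Stack.facts] then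
        (scanStore S [] ((joinFacts db).reverse ++ []) (w ++ [.sep]) [] .facts').reverse ++
          scanStore S [] ((joinFacts db).reverse ++ []) (w ++ [.sep]) [] x
        else scanStore S [] ((joinFacts db).reverse ++ []) (w ++ [.sep]) [] x))
  have h6 := (Prog.RunsIn.load (r := r) (S := S)
    (fun r : Reg => { r with ok := true, found := false })).seq (h.seq h5)
  refine ⟨_, ?_, h6.cast (fun k => ?_) ?_⟩
  · simpa using hr
  · cases k <;> simp [scanStore, h1, h2, h4]
  · simp [scanStore]
    nlinarith [Nat.zero_le ((joinFacts db).length * w.length)]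

end SProg

theorem sep_notMem_encodeName (i : ℕ) : Symb.sep ∉ encodeName i := by
  simp [encodeName]

/-! ### A language of commands on lists of facts -/

/-- The pieces of which patterns of facts consist. -/
inductive Piece where
  | sym (a : Symb)
  | var (x : Fin 14)

/-- The word of a pattern for the given values of the variables. -/
def Piece.word (ρ : Fin 14 → ℕ) : Piece → List Symb
  | .sym a => [a]
  | .var x => encodeName (ρ x)

/-- A piece that is not a separator and whose variable, if it is one, belongs to `scope`. -/
def Piece.ok (scope : List (Fin 14)) : Piece → Bool
  | .sym a => a != .sep
  | .var x => decide (x ∈ scope)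

/-- The word of a pattern for the given values of the variables. -/
def patternWord (ρ : Fin 14 → ℕ) (p : List Piece) : List Symb := p.flatMap (Piece.word ρ)

/-- Commands that work on a list of facts. -/
inductive Cmd where
  | forIn (b : Bool) (x : Fin 14) (c : Cmd)
  | guard (b : Bool) (p : List Piece) (c : Cmd)
  | insert (p : List Piece)
  | seq (c c' : Cmd)

namespace Cmd

/-- The facts after a command, where the variables range over `d true` and `d false` numbers. -/
def run (d : Bool → ℕ) : Cmd → (Fin 14 → ℕ) → List (List Symb) → List (List Symb)
  | forIn b x c, ρ, db =>
    (List.range (d b)).foldl (fun db i => c.run d (Function.update ρ x i) db) db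
  | guard b p c, ρ, db => if decide (patternWord ρ p ∈ db) = b then c.run d ρ db else db
  | insert p, ρ, db => patternWord ρ p :: db
  | seq c c', ρ, db => c'.run d ρ (c.run d ρ db)

/-- The variables are bound once on every path, and no fact contains a separator. -/
def ok : Cmd → List (Fin 14) → Bool
  | forIn _ x c, scope => !decide (x ∈ scope) && c.ok (x :: scope)
  | guard _ p c, scope => p.all (Piece.ok scope) && c.ok scope
  | insert p, scope => p.all (Piece.ok scope)
  | seq c c', scope => c.ok scope && c'.ok scope

/-- A bound for the growth of the facts, where names have at most `D` letters. -/
def growth (D : ℕ) : Cmd → ℕ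
  | forIn _ _ c => D * c.growth D
  | guard _ _ c => c.growth D
  | insert p => p.length * (D + 1) + 1
  | seq c c' => c.growth D + c'.growth D

/-- A bound for the running time, where the facts have at most `N` letters. -/
def time (D N : ℕ) : Cmd → ℕ
  | forIn _ _ c => D * (c.time D N + 3 * D + 30) + 9 * D + 10
  | guard _ p c => p.length * (9 * D + 5) + 1 +
      (N + 1) * (4 * (p.length * (D + 1)) + 40) + 1 + (c.time D N + 1)
  | insert p => p.length * (9 * D + 5) + 1
  | seq c c' => c.time D N + c'.time D N

end Cmd

namespace SProg

/-- Push the word of a pattern, whose variables are in the stacks `cur`, reversed, and a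
separator. -/
def emit (k : Stack) : List Piece → SProg
  | [] => .push k fun _ => .sep
  | .sym a :: p => .seq (emit k p) (.push k fun _ => a)
  | .var x :: p => .seq (emit k p) (.seq (pour (.cur x) [k, .tmp]) (pour .tmp [.cur x]))

/-- The separator and the last pieces are pushed first, so that the word can be read from the top.
The name in `cur x` is stored reversed, and pouring it to `k` turns it round; the copy made in `tmp`
restores `cur x`. So `k` has to differ from these stacks. -/
theorem runsIn_emit (k : Stack) (hk : k ≠ .tmp) (hk' : ∀ x, k ≠ .cur x) (p : List Piece)
    (scope : List (Fin 14)) (hp : p.all (Piece.ok scope) = true) (ρ : Fin 14 → ℕ) (D : ℕ)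
    (hD : ∀ x ∈ scope, (encodeName (ρ x)).length ≤ D) (r : Reg) (S : Store)
    (hS : ∀ x ∈ scope, S (.cur x) = (encodeName (ρ x)).reverse) (ht : S .tmp = []) :
    ∃ r', (emit k p).RunsIn r S r' (Function.update S k (patternWord ρ p ++ Symb.sep :: S k))
      (p.length * (9 * D + 5) + 1) := by
  induction p generalizing r with
  | nil => exact ⟨r, (Prog.RunsIn.push _ _).cast (fun k => rfl) (by simp)⟩
  | cons a p ih =>
    simp only [List.all_cons, Bool.and_eq_true] at hp
    obtain ⟨r', h⟩ := ih hp.2 r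
    cases a with
    | sym a =>
      refine ⟨r', (h.seq (Prog.RunsIn.push k fun _ => a)).cast (fun x => ?_) ?_⟩
      · simp [patternWord, Piece.word]
      · simp only [List.length_cons]
        nlinarith
    | var x =>
      have hx : x ∈ scope := by simpa [Piece.ok] using hp.1
      have h2 := h.seq ((runsIn_pour (.cur x) [k, .tmp] (by simp [hk]) (by simp [(hk' x).symm])
        r' _).seq (runsIn_pour .tmp [.cur x] (by simp) (by simp) _ _))
      refine ⟨_, h2.cast (fun y => ?_) ?_⟩
      · have n1 := hk' x
        by_cases hy : y = k
        · subst hy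
          simp [hk, n1, Ne.symm n1, hS x hx, patternWord, Piece.word]
        · by_cases hy2 : y = .tmp
          · subst hy2; simp [hy, ht]
          · by_cases hy3 : y = .cur x
            · subst hy3
              simp [n1.symm, Ne.symm hk, ht, hS x hx]
            · simp [hy, hy2, hy3]
      · have := hD x hx
        simp [Function.update_of_ne (hk' x).symm, ht, hS x hx,
          Ne.symm hk]
        nlinarith

/-- The program of a command. -/
def ofCmd : Cmd → SProg
  | .forIn b x c => .seq (.seq (pour (.dom b) [.tmp]) (pour .tmp [.dom b, .iter x]))
      (popWhile (fun _ => true) (.iter x) (.seq (put (.cur x))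
        (.ite (fun r => r.cur == some .fin) (.seq (ofCmd c) (pour (.cur x) [])) (.load id))))
  | .guard b p c => .seq (emit .query p)
      (.seq search (.ite (fun r => r.found == b) (ofCmd c) (.load id)))
  | .insert p => emit .facts p
  | .seq c c' => .seq (ofCmd c) (ofCmd c')

end SProg

theorem length_patternWord {p : List Piece} {scope : List (Fin 14)}
    (hp : p.all (Piece.ok scope) = true) {ρ : Fin 14 → ℕ} {D : ℕ}
    (hD : ∀ x ∈ scope, (encodeName (ρ x)).length ≤ D) :
    (patternWord ρ p).length ≤ p.length * (D + 1) := by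
  induction p with
  | nil => simp [patternWord]
  | cons a p ih =>
    simp only [List.all_cons, Bool.and_eq_true] at hp
    have h1 := ih hp.2
    have h2 : (a.word ρ).length ≤ D + 1 := by
      cases a with
      | sym a => simp [Piece.word]
      | var x => exact (hD x (by simpa [Piece.ok] using hp.1)).trans (Nat.le_succ D)
    simp only [patternWord, List.flatMap_cons, List.length_append, List.length_cons] at h1 ⊢
    nlinarith

theorem sep_notMem_patternWord {p : List Piece} {scope : List (Fin 14)}
    (hp : p.all (Piece.ok scope) = true) (ρ : Fin 14 → ℕ) : Symb.sep ∉ patternWord ρ p := by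
  intro h
  obtain ⟨a, ha, h⟩ := List.mem_flatMap.1 h
  have := List.all_eq_true.1 hp a ha
  cases a with
  | sym a =>
    simp [Piece.word] at h
    simp [Piece.ok, ← h] at this
  | var x => exact sep_notMem_encodeName _ h

namespace Cmd

theorem run_induction {d : Bool → ℕ} (Φ : List (List Symb) → Prop)
    (hΦ : ∀ p scope ρ db, p.all (Piece.ok scope) = true → Φ db → Φ (patternWord ρ p :: db)) :
    ∀ (c : Cmd) (scope : List (Fin 14)) (ρ : Fin 14 → ℕ) (db : List (List Symb)),
      c.ok scope = true → Φ db → Φ (c.run d ρ db) := by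
  intro c
  induction c with
  | forIn b x c ih =>
    intro scope ρ db hc h
    simp only [ok, Bool.and_eq_true] at hc
    simp only [run]
    generalize List.range (d b) = l
    induction l generalizing db with
    | nil => exact h
    | cons i l ihl => exact ihl _ (ih _ _ _ hc.2 h)
  | guard b p c ih =>
    intro scope ρ db hc h
    simp only [ok, Bool.and_eq_true] at hc
    simp only [run]
    split_ifs
    · exact ih _ _ _ hc.2 h
    · exact h
  | insert p => exact fun scope ρ db hc h => hΦ p scope ρ db hc h
  | seq c c' ih ih' =>
    intro scope ρ db hc h
    simp only [ok, Bool.and_eq_true] at hc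
    exact ih' _ _ _ hc.2 (ih _ _ _ hc.1 h)

theorem _root_.BroadcastNetwork.suffix_foldl {α β : Type} {f : List α → β → List α}
    (hf : ∀ db i, db <:+ f db i) (l : List β) (db : List α) : db <:+ l.foldl f db := by
  induction l generalizing db with
  | nil => exact List.suffix_rfl
  | cons i l ih => exact (hf _ _).trans (ih _)

/-- Facts are only ever added in front. Hence a bound for the length of the final list also bounds
all intermediate lists. -/
theorem suffix_run (d : Bool → ℕ) (c : Cmd) (ρ : Fin 14 → ℕ) (db : List (List Symb)) :
    db <:+ c.run d ρ db := by
  induction c generalizing ρ db with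
  | forIn b x c ih =>
    exact suffix_foldl (fun _ _ => ih _ _) _ _
  | guard b p c ih =>
    simp only [run]
    split_ifs
    · exact ih _ _
    · exact List.suffix_rfl
  | insert p => exact List.suffix_cons _ _
  | seq c c' ih ih' => exact (ih _ _).trans (ih' _ _)

theorem _root_.BroadcastNetwork.length_joinFacts_le {db db' : List (List Symb)} (h : db <:+ db') :
    (joinFacts db).length ≤ (joinFacts db').length := by
  obtain ⟨l, rfl⟩ := h
  simp [joinFacts]

end Cmd

theorem length_le_length_flatMap_encodeName (l : List ℕ) :
    l.length ≤ (l.flatMap encodeName).length := by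
  induction l with
  | nil => simp
  | cons i l ih => simp [encodeName] at ih ⊢; omega

theorem length_encodeName_le {l : List ℕ} {i : ℕ} (h : i ∈ l) :
    (encodeName i).length ≤ (l.flatMap encodeName).length := by
  obtain ⟨s, t, rfl⟩ := List.append_of_mem h
  simp only [List.flatMap_append, List.flatMap_cons, List.length_append]
  omega

/-- The sizes of the domains are such that the lists of their elements have at most `D`
letters. -/
def Small (d : Bool → ℕ) (D : ℕ) : Prop :=
  ∀ b, ((List.range (d b)).flatMap encodeName).length ≤ D

namespace Cmd

/-- Every name has at least one letter, so a loop makes at most `D` rounds; the growth is thus a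
polynomial in `D` whose degree comes from the nesting of loops. -/
theorem length_run {d : Bool → ℕ} {D : ℕ} (hd : Small d D) :
    ∀ (c : Cmd) (scope : List (Fin 14)) (ρ : Fin 14 → ℕ) (db : List (List Symb)),
      c.ok scope = true → (∀ x ∈ scope, (encodeName (ρ x)).length ≤ D) →
      (joinFacts (c.run d ρ db)).length ≤ (joinFacts db).length + c.growth D := by
  intro c
  induction c with
  | forIn b x c ih =>
    intro scope ρ db hc hρ
    simp only [ok, Bool.and_eq_true] at hc
    simp only [run, growth]
    have hl : (List.range (d b)).length ≤ D :=
      (length_le_length_flatMap_encodeName _).trans (hd b)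
    have hl' : ∀ i ∈ List.range (d b), (encodeName i).length ≤ D :=
      fun i hi => (length_encodeName_le hi).trans (hd b)
    generalize List.range (d b) = l at hl hl'
    suffices h : (joinFacts (l.foldl (fun db i => c.run d (Function.update ρ x i) db) db)).length ≤
        (joinFacts db).length + l.length * c.growth D from
      h.trans (Nat.add_le_add_left (Nat.mul_le_mul_right _ hl) _)
    clear hl
    induction l generalizing db with
    | nil => simp
    | cons i l ihl =>
      have h1 := ihl (c.run d (Function.update ρ x i) db)
        (fun i hi => hl' i (List.mem_cons_of_mem _ hi))
      have h2 := ih _ (Function.update ρ x i) db hc.2 (fun y hy => by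
        by_cases e : y = x
        · subst e; simpa using hl' i (by simp)
        · simpa [e] using hρ y (by simpa [e] using hy))
      simp only [List.foldl_cons, List.length_cons]
      nlinarith
  | guard b p c ih =>
    intro scope ρ db hc h
    simp only [ok, Bool.and_eq_true] at hc
    simp only [run, growth]
    split_ifs
    · exact ih _ _ _ hc.2 h
    · exact Nat.le_add_right _ _
  | insert p =>
    intro scope ρ db hc h
    have := length_patternWord hc h
    simp only [run, growth, joinFacts, List.flatMap_cons, List.length_append, List.length_singleton]
    omega
  | seq c c' ih ih' =>
    intro scope ρ db hc h
    simp only [ok, Bool.and_eq_true] at hc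
    have h1 := ih _ _ db hc.1 h
    have h2 := ih' _ _ (c.run d ρ db) hc.2 h
    simp only [run, growth]
    omega

/-- The stacks are as they should be before a command: the variables in `scope` have the values
`ρ`, and the facts are `db`. -/
structure Ready (d : Bool → ℕ) (D : ℕ) (scope : List (Fin 14)) (ρ : Fin 14 → ℕ)
    (db : List (List Symb)) (S : Store) : Prop where
  dom : ∀ b, S (.dom b) = (List.range (d b)).flatMap encodeName
  cur : ∀ x ∈ scope, S (.cur x) = (encodeName (ρ x)).reverse
  small : ∀ x ∈ scope, (encodeName (ρ x)).length ≤ D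
  cur_free : ∀ x, x ∉ scope → S (.cur x) = []
  iter_free : ∀ x, x ∉ scope → S (.iter x) = []
  facts : S .facts = joinFacts db
  noSep : ∀ w ∈ db, Symb.sep ∉ w
  facts' : S .facts' = []
  query : S .query = []
  query' : S .query' = []
  tmp : S .tmp = []

theorem Ready.update_facts {d : Bool → ℕ} {D : ℕ} {scope : List (Fin 14)} {ρ : Fin 14 → ℕ}
    {db db' : List (List Symb)} {S : Store} (h : Ready d D scope ρ db S)
    (hdb : ∀ w ∈ db', Symb.sep ∉ w) :
    Ready d D scope ρ db' (Function.update S .facts (joinFacts db')) where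
  dom b := by simpa using h.dom b
  cur x hx := by simpa using h.cur x hx
  small := h.small
  cur_free x hx := by simpa using h.cur_free x hx
  iter_free x hx := by simpa using h.iter_free x hx
  facts := by simp
  noSep := hdb
  facts' := by simpa using h.facts'
  query := by simpa using h.query
  query' := by simpa using h.query'
  tmp := by simpa using h.tmp

theorem noSep_run {d : Bool → ℕ} {c : Cmd} {scope : List (Fin 14)} (hc : c.ok scope = true)
    (ρ : Fin 14 → ℕ) {db : List (List Symb)} (h : ∀ w ∈ db, Symb.sep ∉ w) :
    ∀ w ∈ c.run d ρ db, Symb.sep ∉ w :=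
  run_induction (fun db => ∀ w ∈ db, Symb.sep ∉ w)
    (fun p scope ρ db hp h w hw => by
      rcases List.mem_cons.1 hw with rfl | hw
      · exact sep_notMem_patternWord hp ρ
      · exact h w hw) c scope ρ db hc h

end Cmd

/-! ### Correctness and running time of compiled commands -/

namespace SProg

/-- The body of the loop of `forIn` over the letters of the names. -/
def namesBody (x : Fin 14) (p : SProg) : SProg :=
  .seq (put (.cur x)) (.ite (fun r => r.cur == some .fin) (.seq p (pour (.cur x) [])) (.load id))

variable {x : Fin 14} {p : SProg} {S' : Store} {T : ℕ}

/-- Before the end marker of a name, the loop only moves letters to `cur x`. What follows the bits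
is a hypothesis, which is used once the end marker is on top. -/
theorem runsIn_names_bits (l : List Bool) (w : List Symb) (r : Reg) (S : Store)
    (hS : S (.iter x) = l.map Symb.bit ++ w)
    (h : ∀ r, ∃ r', (popWhile (fun _ => true) (.iter x) (namesBody x p)).RunsIn r
      (Function.update (Function.update S (.iter x) w) (.cur x)
        ((l.map Symb.bit).reverse ++ S (.cur x))) r' S' T) :
    ∃ r', (popWhile (fun _ => true) (.iter x) (namesBody x p)).RunsIn r S r' S'
      (l.length * 5 + T) := by
  induction l generalizing r S with
  | nil =>
    obtain ⟨r', h⟩ := h r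
    refine ⟨r', ?_⟩
    have e : Function.update (Function.update S (.iter x) w) (.cur x)
        ((([] : List Bool).map Symb.bit).reverse ++ S (.cur x)) = S := by
      funext k
      by_cases h1 : k = .cur x
      · subst h1; simp
      · by_cases h2 : k = .iter x
        · subst h2; simp [hS]
        · simp [h1, h2]
    rw [e] at h
    simpa using h
  | cons a l ih =>
    have hS' : S (.iter x) = Symb.bit a :: (l.map Symb.bit ++ w) := by simpa using hS
    have h1 := (runsIn_put (k := .cur x) (r := { r with cur := some (.bit a) })
      (S := Function.update S (.iter x) (l.map Symb.bit ++ w)) rfl).seq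
      (Prog.RunsIn.ite_false (c := fun r : Reg => r.cur == some .fin)
        (p := .seq p (pour (.cur x) [])) (by rfl) Prog.RunsIn.skip)
    obtain ⟨r', h2⟩ := ih { r with cur := some (.bit a) } (Function.update (Function.update S
      (.iter x) (l.map Symb.bit ++ w)) (.cur x) (.bit a :: Function.update S (.iter x)
      (l.map Symb.bit ++ w) (.cur x))) (by simp) (fun r => by
        obtain ⟨r', h⟩ := h r
        refine ⟨r', ?_⟩
        convert h using 1
        funext k
        by_cases h1 : k = .cur x
        · subst h1; simp
        · by_cases h2 : k = .iter x
          · subst h2; simp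
          · simp [h1, h2])
    exact ⟨r', (runsIn_popWhile_cons (c := fun _ => true) hS' rfl h1 h2).mono
      (by simp only [List.length_cons]; omega)⟩

/-- The program loops over letters, the command over names; the end marker `.fin` triggers the body
once per name. The bound `N` for the final list makes `Tc` uniform in the rounds. -/
theorem runsIn_names {d : Bool → ℕ} {D N Tc : ℕ} {scope : List (Fin 14)} (hx : x ∉ scope) {c : Cmd}
    (hok : c.ok (x :: scope) = true)
    (hc : ∀ (ρ : Fin 14 → ℕ) (db : List (List Symb)) (r : Reg) (S : Store),
      Cmd.Ready d D (x :: scope) ρ db S → (joinFacts (c.run d ρ db)).length ≤ N →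
      ∃ r', p.RunsIn r S r' (Function.update S .facts (joinFacts (c.run d ρ db))) Tc)
    (ρ : Fin 14 → ℕ) (l : List ℕ) (hl : ∀ i ∈ l, (encodeName i).length ≤ D)
    (db : List (List Symb)) (r : Reg) (S : Store) (hS : Cmd.Ready d D scope ρ db S)
    (hN : (joinFacts (l.foldl (fun db i => c.run d (Function.update ρ x i) db) db)).length ≤ N) :
    ∃ r', (popWhile (fun _ => true) (.iter x) (namesBody x p)).RunsIn r
      (Function.update S (.iter x) (l.flatMap encodeName)) r'
      (Function.update S .facts
        (joinFacts (l.foldl (fun db i => c.run d (Function.update ρ x i) db) db)))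
      ((l.flatMap encodeName).length * 5 + l.length * (Tc + 3 * D + 20) + 2) := by
  induction l generalizing db r S with
  | nil =>
    refine ⟨_, (runsIn_popWhile_nil (by simp)).cast (fun k => ?_) (by simp)⟩
    by_cases h1 : k = .iter x
    · subst h1; simp [hS.iter_free x hx]
    · by_cases h2 : k = .facts
      · subst h2; simp [hS.facts]
      · simp [h1, h2]
  | cons i l ih =>
    set db₁ := c.run d (Function.update ρ x i) db with hdb₁
    have hfold : (i :: l).foldl (fun db i => c.run d (Function.update ρ x i) db) db =
      l.foldl (fun db i => c.run d (Function.update ρ x i) db) db₁ := rfl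
    rw [hfold] at hN ⊢
    have hN₁ : (joinFacts db₁).length ≤ N :=
      (length_joinFacts_le (suffix_foldl (fun _ _ => Cmd.suffix_run d c _ _) l db₁)).trans hN
    have hS₁ : Cmd.Ready d D scope ρ db₁ (Function.update S .facts (joinFacts db₁)) :=
      hS.update_facts (Cmd.noSep_run hok _ hS.noSep)
    have hi := hl i (by simp)
    obtain ⟨bits, hbits⟩ : ∃ bits : List Bool, encodeName i = bits.map Symb.bit ++ [.fin] :=
      ⟨_, rfl⟩
    have hlen : bits.length + 1 = (encodeName i).length := by simp [hbits]
    refine Exists.imp (fun r' h => Prog.RunsIn.mono h ?_) (runsIn_names_bits (x := x) (p := p)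
      (S' := Function.update S .facts
        (joinFacts (l.foldl (fun db i => c.run d (Function.update ρ x i) db) db₁)))
      (T := 2 + (1 + (1 + (Tc + (D * 3 + 2)))) +
        ((l.flatMap encodeName).length * 5 + l.length * (Tc + 3 * D + 20) + 2))
      bits (.fin :: l.flatMap encodeName) r
      (Function.update S (.iter x) ((i :: l).flatMap encodeName)) (by simp [hbits]) (fun r => ?_))
    · simp only [List.flatMap_cons, List.length_append, List.length_cons, ← hlen]
      ring_nf
      omega
    set S₂ := Function.update (Function.update (Function.update S (.iter x)
        ((i :: l).flatMap encodeName)) (.iter x) (.fin :: l.flatMap encodeName)) (.cur x)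
      ((bits.map Symb.bit).reverse ++ Function.update S (.iter x)
        ((i :: l).flatMap encodeName) (.cur x)) with hS₂
    have h1 := runsIn_put (k := .cur x) (r := { r with cur := some .fin })
      (S := Function.update S₂ (.iter x) (l.flatMap encodeName)) rfl
    set S₃ := Function.update (Function.update S₂ (.iter x) (l.flatMap encodeName)) (.cur x)
      (.fin :: Function.update S₂ (.iter x) (l.flatMap encodeName) (.cur x)) with hS₃
    have e₃ : S₃ = Function.update (Function.update S (.iter x) (l.flatMap encodeName)) (.cur x)
        (encodeName i).reverse := by
      funext k
      by_cases h1 : k = .cur x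
      · subst h1; simp [hS₃, hS₂, hbits, hS.cur_free x hx]
      · by_cases h2 : k = .iter x
        · subst h2; simp [hS₃, hS₂]
        · simp [h1, h2, hS₃, hS₂]
    -- Now `cur x` holds the complete name. The remaining names are still in `iter x`, which may be
    -- occupied because `x` has entered the scope.
    have hR : Cmd.Ready d D (x :: scope) (Function.update ρ x i) db S₃ := by
      rw [e₃]
      constructor
      · intro b; simpa using hS.dom b
      · intro y hy
        by_cases e : y = x
        · subst e; simp
        · simpa [e] using hS.cur y (by simpa [e] using hy)
      · intro y hy
        by_cases e : y = x
        · subst e; simpa using hi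
        · simpa [e] using hS.small y (by simpa [e] using hy)
      · intro y hy
        simp only [List.mem_cons, not_or] at hy
        simpa [hy.1] using hS.cur_free y hy.2
      · intro y hy
        simp only [List.mem_cons, not_or] at hy
        simpa [hy.1] using hS.iter_free y hy.2
      · simpa using hS.facts
      · exact hS.noSep
      · simpa using hS.facts'
      · simpa using hS.query
      · simpa using hS.query'
      · simpa using hS.tmp
    obtain ⟨r₁, h2⟩ := hc _ db { r with cur := some .fin } S₃ hR hN₁
    have h3 := h1.seq (Prog.RunsIn.ite_true (c := fun r : Reg => r.cur == some .fin)
        (q := .load id) (by rfl) (h2.seq (runsIn_pour (.cur x) [] (by simp) (by simp) r₁ _)))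
    obtain ⟨r₂, h4⟩ := ih (fun i hi => hl i (by simp [hi])) db₁ { r₁ with cur := none } _ hS₁ hN
    refine ⟨r₂, (runsIn_popWhile_cons (a := .fin) (l := l.flatMap encodeName)
      (T := 1 + (1 + (Tc + (D * 3 + 2)))) (c := fun _ => true) ?_ rfl ((h3.cast (fun k => ?_) ?_))
      (h4.cast (fun k => ?_) le_rfl))⟩
    · simp [hS₂]
    · rw [e₃]
      by_cases h1 : k = .cur x
      · subst h1; simp [hS.cur_free x hx]
      · by_cases h2 : k = .facts
        · subst h2; simp [hdb₁]
        · simp [Function.update_apply, h1, h2]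
    · simp only [ne_eq, reduceCtorEq, not_false_eq_true, Function.update_of_ne, e₃,
        Function.update_self, List.length_reverse, List.length_nil]
      omega
    · simp

theorem runsIn_ofCmd {d : Bool → ℕ} {D : ℕ} (hd : Small d D) (N : ℕ) (c : Cmd) :
    ∀ (scope : List (Fin 14)) (_ : c.ok scope = true) (ρ : Fin 14 → ℕ) (db : List (List Symb))
      (r : Reg) (S : Store), Cmd.Ready d D scope ρ db S →
      (joinFacts (c.run d ρ db)).length ≤ N →
      ∃ r', (ofCmd c).RunsIn r S r' (Function.update S .facts (joinFacts (c.run d ρ db)))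
        (c.time D N) := by
  induction c with
  | forIn b x c ih =>
    intro scope hok ρ db r S hS hN
    simp only [Cmd.ok, Bool.and_eq_true, Bool.not_eq_true', decide_eq_false_iff_not] at hok
    -- Pouring empties its source and reverses. Two pours through `tmp` restore the domain and leave
    -- a copy in `iter x`, both in the original order.
    have h0 := (runsIn_pour (.dom b) [.tmp] (by simp) (by simp) r S).seq
      (runsIn_pour .tmp [.dom b, .iter x] (by simp) (by simp) _ _)
    obtain ⟨r', h1⟩ := runsIn_names (x := x) hok.1 hok.2 (ih _ hok.2) ρ (List.range (d b))
      (fun i hi => (length_encodeName_le hi).trans (hd b)) db { r with cur := none } S hS hN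
    refine ⟨r', ((h0.cast (fun k => ?_) le_rfl).seq h1).mono ?_⟩
    · by_cases h1 : k = .iter x
      · subst h1; simp [hS.iter_free x hok.1, hS.dom, hS.tmp]
      · by_cases h2 : k = .dom b
        · subst h2; simp [hS.tmp]
        · by_cases h3 : k = .tmp
          · subst h3; simp [hS.tmp]
          · simp [h1, h2, h3]
    · have hD := hd b
      have hl : (List.range (d b)).length ≤ D :=
        (length_le_length_flatMap_encodeName _).trans (hd b)
      simp [hS.dom, hS.tmp, Cmd.time] at hl hD ⊢
      nlinarith [Nat.mul_le_mul_right (c.time D N + 3 * D + 20) hl]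
  | guard b p c ih =>
    intro scope hok ρ db r S hS hN
    simp only [Cmd.ok, Bool.and_eq_true] at hok
    obtain ⟨r₁, h1⟩ := runsIn_emit .query (by simp) (by simp) p scope hok.1 ρ D hS.small r S hS.cur
      hS.tmp
    obtain ⟨r₂, hr, h2⟩ := runsIn_search (patternWord ρ p) (sep_notMem_patternWord hok.1 ρ) db
      hS.noSep r₁ (Function.update S .query (patternWord ρ p ++ Symb.sep :: S .query))
      (by simpa using hS.facts) (by simpa using hS.facts') (by simp [hS.query])
      (by simpa using hS.query')
    have e : Function.update (Function.update S .query (patternWord ρ p ++ Symb.sep :: S .query))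
        .query [] = S := by
      simp [← hS.query]
    rw [e] at h2
    have hdbN : (joinFacts db).length ≤ N :=
      (length_joinFacts_le (Cmd.suffix_run d (.guard b p c) ρ db)).trans hN
    have h2 := h2.mono (T' := (N + 1) * (4 * (p.length * (D + 1)) + 40))
      (Nat.mul_le_mul (by omega) (by have := length_patternWord hok.1 hS.small; omega))
    by_cases hb : decide (patternWord ρ p ∈ db) = b
    · have e2 : Cmd.run d (.guard b p c) ρ db = c.run d ρ db := by
        simp only [Cmd.run]
        rw [if_pos hb]
      rw [e2] at hN ⊢
      obtain ⟨r₃, h3⟩ := ih scope hok.2 ρ db r₂ S hS hN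
      refine ⟨r₃, (h1.seq (h2.seq (Prog.RunsIn.ite_true ?_ h3))).mono ?_⟩
      · simp [hr, hb]
      · simp only [Cmd.time]; omega
    · have e2 : Cmd.run d (.guard b p c) ρ db = db := by
        simp only [Cmd.run]
        rw [if_neg hb]
      rw [e2, ← hS.facts, Function.update_eq_self]
      refine ⟨r₂, (h1.seq (h2.seq (Prog.RunsIn.ite_false ?_ Prog.RunsIn.skip))).mono ?_⟩
      · simpa [hr] using hb
      · simp only [Cmd.time]; omega
  | insert p =>
    intro scope hok ρ db r S hS hN
    obtain ⟨r', h⟩ := runsIn_emit .facts (by simp) (by simp) p scope hok ρ D hS.small r S hS.cur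
      hS.tmp
    refine ⟨r', h.cast (fun k => ?_) le_rfl⟩
    simp [hS.facts, Cmd.run, joinFacts]
  | seq c c' ih ih' =>
    intro scope hok ρ db r S hS hN
    simp only [Cmd.ok, Bool.and_eq_true] at hok
    have hN₁ := (length_joinFacts_le (Cmd.suffix_run d c' ρ (c.run d ρ db))).trans hN
    obtain ⟨r₁, h1⟩ := ih scope hok.1 ρ db r S hS hN₁
    obtain ⟨r₂, h2⟩ := ih' scope hok.2 ρ (c.run d ρ db) r₁ _
      (hS.update_facts (Cmd.noSep_run hok.1 ρ hS.noSep)) hN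
    exact ⟨r₂, (h1.seq h2).cast (fun k => by simp [Cmd.run]) le_rfl⟩

end SProg

/-! ### Polynomial bounds -/

/-- Functions that are given by a polynomial. -/
def IsPoly (f : ℕ → ℕ) : Prop := ∃ p : Polynomial ℕ, ∀ n, f n = p.eval n

namespace IsPoly

variable {f g : ℕ → ℕ}

theorem const (a : ℕ) : IsPoly fun _ => a := ⟨Polynomial.C a, fun n => by simp⟩

theorem id : IsPoly fun n => n := ⟨Polynomial.X, fun n => by simp⟩

theorem add (hf : IsPoly f) (hg : IsPoly g) : IsPoly fun n => f n + g n := by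
  obtain ⟨p, hp⟩ := hf
  obtain ⟨q, hq⟩ := hg
  exact ⟨p + q, fun n => by simp [hp, hq]⟩

theorem mul (hf : IsPoly f) (hg : IsPoly g) : IsPoly fun n => f n * g n := by
  obtain ⟨p, hp⟩ := hf
  obtain ⟨q, hq⟩ := hg
  exact ⟨p * q, fun n => by simp [hp, hq]⟩

end IsPoly

theorem Cmd.isPoly_growth (c : Cmd) : IsPoly fun D => c.growth D := by
  induction c with
  | forIn b x c ih => exact IsPoly.id.mul ih
  | guard b p c ih => exact ih
  | insert p => exact ((IsPoly.const _).mul (IsPoly.id.add (.const _))).add (.const _)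
  | seq c c' ih ih' => exact ih.add ih'

theorem Cmd.isPoly_time (c : Cmd) {f : ℕ → ℕ} (hf : IsPoly f) :
    IsPoly fun D => c.time D (f D) := by
  induction c with
  | forIn b x c ih =>
    exact ((IsPoly.id.mul ((ih.add ((IsPoly.const 3).mul .id)).add (.const 30))).add
      ((IsPoly.const 9).mul .id)).add (.const 10)
  | guard b p c ih =>
    exact ((((IsPoly.const p.length).mul (((IsPoly.const 9).mul .id).add (.const 5))).add
      (.const 1)).add ((hf.add (.const 1)).mul (((IsPoly.const 4).mul ((IsPoly.const p.length).mul
        (IsPoly.id.add (.const 1)))).add (.const 40)))).add (.const 1) |>.add (ih.add (.const 1))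
  | insert p =>
    exact ((IsPoly.const p.length).mul (((IsPoly.const 9).mul .id).add (.const 5))).add (.const 1)
  | seq c c' ih ih₂ => exact ih.add ih₂

/-! ### Reading the input -/

/-- The numbers of states and of messages. -/
def CoverInput.sizes (I : CoverInput) : Bool → ℕ
  | true => I.numStates
  | false => I.numMessages

/-- The facts that an input consists of. -/
def CoverInput.facts (I : CoverInput) : List (List Symb) :=
  (.tau :: .quest :: encodeName I.target) :: (I.transitions.map encodeTransition ++
    [.tau :: .tau :: encodeName I.init])

/-- The fact by which a command answers. -/
def answerPattern : List Piece := [.sym .bang, .sym .tau]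

namespace SProg

/-- The number of names that still have to be read before a transition is complete, after the
letter `a`. -/
def countNames (n : Fin 4) : Symb → Fin 4
  | .bang => n + 1
  | .quest => n + 1
  | .fin => n - 1
  | _ => n

/-- Insert a separator after each transition. -/
def separate : Fin 4 → List Symb → List Symb
  | _, [] => []
  | n, a :: w => if countNames n a = 0 then a :: .sep :: separate 2 w
      else a :: separate (countNames n a) w

theorem separate_bits (n : Fin 4) (hn : n ≠ 0) (l : List Bool) (w : List Symb) :
    separate n (l.map Symb.bit ++ w) = l.map Symb.bit ++ separate n w := by
  induction l with
  | nil => rfl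
  | cons a l ih =>
    have h : separate n (Symb.bit a :: (l.map Symb.bit ++ w)) =
        Symb.bit a :: separate n (l.map Symb.bit ++ w) := if_neg hn
    rw [List.map_cons, List.cons_append, h, ih, List.cons_append]

theorem separate_name_two (i : ℕ) (w : List Symb) :
    separate 2 (encodeName i ++ w) = encodeName i ++ separate 1 w := by
  unfold encodeName
  rw [List.append_assoc, separate_bits 2 (by decide), List.append_assoc]
  rfl

theorem separate_name_one (i : ℕ) (w : List Symb) :
    separate 1 (encodeName i ++ w) = encodeName i ++ Symb.sep :: separate 2 w := by
  unfold encodeName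
  rw [List.append_assoc, separate_bits 1 (by decide), List.append_assoc]
  rfl

/-- The list of transitions has no delimiters, but each transition tells its length: it has two
names, and a third one if `!!` or `?` occurs. Counting the names still expected finds its end. -/
theorem separate_transitions {n s : ℕ} (l : List (Transition (Fin n) (Fin s))) :
    separate 2 (l.flatMap encodeTransition) = joinFacts (l.map encodeTransition) := by
  induction l with
  | nil => rfl
  | cons t l ih =>
    obtain ⟨q, α, q'⟩ := t
    simp only [joinFacts, List.map_cons, List.flatMap_cons] at ih ⊢
    rw [← ih]
    simp only [encodeTransition, List.append_assoc]
    rw [separate_name_two]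
    cases α with
    | broadcast m =>
      have : ∀ w, separate 1 (Symb.bang :: w) = .bang :: separate 2 w := fun w => rfl
      simp only [encodeAction, List.cons_append]
      rw [this, separate_name_two, separate_name_one]
      simp
    | receive m =>
      have : ∀ w, separate 1 (Symb.quest :: w) = .quest :: separate 2 w := fun w => rfl
      simp only [encodeAction, List.cons_append]
      rw [this, separate_name_two, separate_name_one]
      simp
    | internal =>
      have : ∀ w, separate 1 (Symb.tau :: w) = .tau :: separate 1 w := fun w => rfl
      simp only [encodeAction, List.cons_append, List.nil_append]
      rw [this, separate_name_one]

theorem length_separate (n : Fin 4) (w : List Symb) : (separate n w).length ≤ 2 * w.length := by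
  induction w generalizing n with
  | nil => simp [separate]
  | cons a w ih =>
    have h1 := ih 2
    have h2 := ih (countNames n a)
    simp only [separate]
    split_ifs <;> simp only [List.length_cons] <;> omega

/-- The stacks while the input is read. -/
def parseStore (i A B F t : List Symb) : Store
  | .inp => i
  | .dom true => A
  | .dom false => B
  | .facts => F
  | .tmp => t
  | _ => []

/-- The body of the loop that copies the transitions, with separators, to the stack `tmp`. -/
def transitionsBody : SProg :=
  .seq (put .tmp) <| .seq (.load fun r => { r with count := countNames r.count (r.cur.getD .sep) })
    (.ite (fun r => r.count == 0)
      (.seq (.push .tmp fun _ => .sep) (.load fun r => { r with count := 2 })) (.load id))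

variable {i A B F t l : List Symb}

theorem runsIn_transitions (w : List Symb) (hw : Symb.sep ∉ w) (n : Fin 4) (r : Reg)
    (hr : r.count = n) (t : List Symb) :
    ∃ r', (popWhile (fun a => a != .sep) .inp transitionsBody).RunsIn r
      (parseStore (w ++ Symb.sep :: l) A B F t) r'
      (parseStore l A B F ((separate n w).reverse ++ t)) (w.length * 7 + 2) := by
  induction w generalizing n r t with
  | nil =>
    refine ⟨_, (runsIn_popWhile_stop (c := fun a => a != .sep) (a := .sep) (l := l) rfl rfl).cast
      (fun k => ?_) (by simp)⟩
    rcases k with _ | (_ | _) | _ | _ | _ | _ | _ | _ | _ <;> simp [parseStore, separate]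
  | cons a w ih =>
    simp only [List.mem_cons, not_or] at hw
    have h1 : (put .tmp).RunsIn { r with cur := some a } (parseStore (w ++ Symb.sep :: l) A B F t)
        { r with cur := some a } (parseStore (w ++ Symb.sep :: l) A B F (a :: t)) 1 :=
      (runsIn_put rfl).cast (fun k => by
        rcases k with _ | (_ | _) | _ | _ | _ | _ | _ | _ | _ <;> simp [parseStore]) le_rfl
    have h2 := Prog.RunsIn.load (r := { r with cur := some a })
      (S := parseStore (w ++ Symb.sep :: l) A B F (a :: t))
      (fun r : Reg => { r with count := countNames r.count (r.cur.getD .sep) })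
    subst hr
    simp only [Option.getD_some] at h2
    have e : Function.update (parseStore (a :: w ++ Symb.sep :: l) A B F t) .inp
        (w ++ Symb.sep :: l) = parseStore (w ++ Symb.sep :: l) A B F t := by
      funext k
      rcases k with _ | (_ | _) | _ | _ | _ | _ | _ | _ | _ <;> simp [parseStore]
    have hc : (a != Symb.sep) = true := by simpa using Ne.symm hw.1
    by_cases hn : countNames r.count a = 0
    · have h3 : (Prog.push .tmp fun _ => Symb.sep).RunsIn
          { r with cur := some a, count := countNames r.count a }
          (parseStore (w ++ Symb.sep :: l) A B F (a :: t))
          { r with cur := some a, count := countNames r.count a }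
          (parseStore (w ++ Symb.sep :: l) A B F (.sep :: a :: t)) 1 :=
        (Prog.RunsIn.push _ _).cast (fun k => by
          rcases k with _ | (_ | _) | _ | _ | _ | _ | _ | _ | _ <;> simp [parseStore]) le_rfl
      have h4 := Prog.RunsIn.ite_true (q := .load id) (c := fun r : Reg => r.count == 0)
        (by simpa using hn) (h3.seq (Prog.RunsIn.load fun r : Reg => { r with count := 2 }))
      obtain ⟨r', h5⟩ := ih hw.2 2 { r with cur := some a, count := 2 } rfl (.sep :: a :: t)
      have h6 := h1.seq (h2.seq h4)
      rw [← e] at h6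
      refine ⟨r', (runsIn_popWhile_cons (c := fun a => a != .sep) rfl hc h6 h5).cast
        (fun k => ?_) (by simp only [List.length_cons]; omega)⟩
      simp [separate, hn]
    · have h4 := Prog.RunsIn.ite_false (p := .seq (.push .tmp fun _ => Symb.sep)
          (.load fun r : Reg => { r with count := 2 })) (c := fun r : Reg => r.count == 0)
        (r := { r with cur := some a, count := countNames r.count a })
        (S := parseStore (w ++ Symb.sep :: l) A B F (a :: t)) (by simpa using hn) Prog.RunsIn.skip
      obtain ⟨r', h5⟩ := ih hw.2 (countNames r.count a)
        { r with cur := some a, count := countNames r.count a } rfl (a :: t)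
      have h6 := h1.seq (h2.seq h4)
      rw [← e] at h6
      refine ⟨r', (runsIn_popWhile_cons (c := fun a => a != .sep) rfl hc h6 h5).cast
        (fun k => ?_) (by simp only [List.length_cons]; omega)⟩
      simp [separate, hn]

theorem runsIn_parse_read (w : List Symb) (hw : Symb.sep ∉ w) (r : Reg) :
    ∃ r', (readTo .tmp).RunsIn r (parseStore (w ++ Symb.sep :: l) A B F []) r'
      (parseStore l A B F w.reverse) (w.length * 3 + 2) := by
  obtain ⟨r', h⟩ := runsIn_readTo .tmp (by simp) w hw l r (parseStore (w ++ Symb.sep :: l) A B F [])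
    rfl
  refine ⟨r', h.cast (fun k => ?_) le_rfl⟩
  rcases k with _ | (_ | _) | _ | _ | _ | _ | _ | _ | _ <;> simp [parseStore]

theorem runsIn_parse_read_end (w : List Symb) (hw : Symb.sep ∉ w) (r : Reg) :
    ∃ r', (readTo .tmp).RunsIn r (parseStore w A B F []) r'
      (parseStore [] A B F w.reverse) (w.length * 3 + 2) := by
  obtain ⟨r', h⟩ := runsIn_readTo_end .tmp (by simp) w hw r (parseStore w A B F []) rfl
  refine ⟨r', h.cast (fun k => ?_) le_rfl⟩
  rcases k with _ | (_ | _) | _ | _ | _ | _ | _ | _ | _ <;> simp [parseStore]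

/-- Read a part of the input, and push its reverse to the stack `k`. -/
def readDom (b : Bool) : SProg := .seq (readTo .tmp) (pour .tmp [.dom b])

/-- Push what is in `tmp`, reversed and as a fact with the given first letters. -/
def tagFact (a b : Symb) : SProg :=
  .seq (.push .facts fun _ => .sep) <| .seq (pour .tmp [.facts]) <|
    .seq (.push .facts fun _ => b) (.push .facts fun _ => a)

theorem runsIn_readDom_true (w : List Symb) (hw : Symb.sep ∉ w) (r : Reg) :
    ∃ r', (readDom true).RunsIn r (parseStore (w ++ Symb.sep :: l) [] B F []) r'
      (parseStore l w B F []) (w.length * 7 + 4) := by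
  obtain ⟨r', h⟩ := runsIn_parse_read (l := l) (A := []) (B := B) (F := F) w hw r
  refine ⟨_, (h.seq (runsIn_pour .tmp [.dom true] (by simp) (by simp) r' _)).cast (fun k => ?_) ?_⟩
  · rcases k with _ | (_ | _) | _ | _ | _ | _ | _ | _ | _ <;> simp [parseStore]
  · simp [parseStore]; omega

theorem runsIn_readDom_false (w : List Symb) (hw : Symb.sep ∉ w) (r : Reg) :
    ∃ r', (readDom false).RunsIn r (parseStore (w ++ Symb.sep :: l) A [] F []) r'
      (parseStore l A w F []) (w.length * 7 + 4) := by
  obtain ⟨r', h⟩ := runsIn_parse_read (l := l) (A := A) (B := []) (F := F) w hw r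
  refine ⟨_, (h.seq (runsIn_pour .tmp [.dom false] (by simp) (by simp) r' _)).cast (fun k => ?_) ?_⟩
  · rcases k with _ | (_ | _) | _ | _ | _ | _ | _ | _ | _ <;> simp [parseStore]
  · simp [parseStore]; omega

theorem runsIn_tagFact (a b : Symb) (w : List Symb) (r : Reg) :
    ∃ r', (tagFact a b).RunsIn r (parseStore i A B F w.reverse) r'
      (parseStore i A B (a :: b :: w ++ Symb.sep :: F) []) (w.length * 4 + 5) := by
  refine ⟨_, ((Prog.RunsIn.push _ _).seq ((runsIn_pour .tmp [.facts] (by simp) (by simp) r _).seq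
    ((Prog.RunsIn.push _ _).seq (Prog.RunsIn.push _ _)))).cast (fun k => ?_) ?_⟩
  · rcases k with _ | (_ | _) | _ | _ | _ | _ | _ | _ | _ <;> simp [parseStore]
  · simp [parseStore]; omega

/-- Read the input. -/
def readInput : SProg :=
  .seq (readDom true) <| .seq (readDom false) <| .seq (.seq (readTo .tmp) (tagFact .tau .tau)) <|
  .seq (.seq (.load fun r => { r with count := 2 })
    (.seq (popWhile (fun a => a != .sep) .inp transitionsBody) (pour .tmp [.facts])))
  (.seq (readTo .tmp) (tagFact .tau .quest))

end SProg

theorem sep_notMem_flatMap {α : Type} {f : α → List Symb} (hf : ∀ a, Symb.sep ∉ f a) (l : List α) :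
    Symb.sep ∉ l.flatMap f := by
  simpa [List.mem_flatMap] using fun a _ => hf a

theorem sep_notMem_encodeTransition {n s : ℕ} (t : Transition (Fin n) (Fin s)) :
    Symb.sep ∉ encodeTransition t := by
  obtain ⟨q, α, q'⟩ := t
  cases α <;> simp [encodeTransition, encodeAction, sep_notMem_encodeName]

theorem CoverInput.length_joinFacts_facts (I : CoverInput) :
    (joinFacts I.facts).length ≤ 2 * I.encode.length + 6 := by
  have h := SProg.length_separate 2 (I.transitions.flatMap encodeTransition)
  rw [SProg.separate_transitions] at h
  simp only [CoverInput.facts, joinFacts, CoverInput.encode, List.flatMap_cons, List.flatMap_append,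
    List.length_append, List.length_cons, List.flatMap_nil, List.length_nil] at h ⊢
  omega

/-- Both domains are written out in the input, so their total length, and not only that of their
binary sizes, is at most the input length. -/
theorem CoverInput.small_sizes (I : CoverInput) : Small I.sizes I.encode.length := by
  intro b
  cases b <;> simp only [CoverInput.sizes, CoverInput.encode, List.length_append] <;> omega

namespace SProg

theorem runsIn_readInput (I : CoverInput) (r : Reg) :
    ∃ r', readInput.RunsIn r (Function.update (fun _ => []) .inp I.encode) r'
      (parseStore [] ((List.range I.numStates).flatMap encodeName)
        ((List.range I.numMessages).flatMap encodeName) (joinFacts I.facts) [])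
      (15 * I.encode.length + 30) := by
  set A := (List.range I.numStates).flatMap encodeName with hA
  set B := (List.range I.numMessages).flatMap encodeName with hB
  have nA : Symb.sep ∉ A := sep_notMem_flatMap sep_notMem_encodeName _
  have nB : Symb.sep ∉ B := sep_notMem_flatMap sep_notMem_encodeName _
  have nC := sep_notMem_encodeName I.init
  have nE := sep_notMem_encodeName I.target
  have nT : Symb.sep ∉ I.transitions.flatMap encodeTransition :=
    sep_notMem_flatMap sep_notMem_encodeTransition _
  have e : I.encode = A ++ Symb.sep :: (B ++ Symb.sep :: (encodeName I.init ++ Symb.sep ::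
      (I.transitions.flatMap encodeTransition ++ Symb.sep :: encodeName I.target))) := by
    simp [CoverInput.encode, hA, hB]
  have e0 : (Function.update (fun _ => []) .inp I.encode : Store) =
      parseStore I.encode [] [] [] [] := by
    funext k
    rcases k with _ | (_ | _) | _ | _ | _ | _ | _ | _ | _ <;> simp [parseStore]
  have hlen := congrArg List.length e
  simp only [List.length_append, List.length_cons] at hlen
  rw [e0, e]
  obtain ⟨r1, h1⟩ := runsIn_readDom_true (l := B ++ Symb.sep :: (encodeName I.init ++ Symb.sep ::
      (I.transitions.flatMap encodeTransition ++ Symb.sep :: encodeName I.target))) (B := [])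
      (F := []) A nA r
  obtain ⟨r2, h2⟩ := runsIn_readDom_false (l := encodeName I.init ++ Symb.sep ::
      (I.transitions.flatMap encodeTransition ++ Symb.sep :: encodeName I.target)) (A := A)
      (F := []) B nB r1
  obtain ⟨r3, h3⟩ := runsIn_parse_read (l := I.transitions.flatMap encodeTransition ++
    Symb.sep :: encodeName I.target) (A := A) (B := B) (F := []) _ nC r2
  obtain ⟨r4, h4⟩ := runsIn_tagFact (i := I.transitions.flatMap encodeTransition ++
    Symb.sep :: encodeName I.target) (A := A) (B := B) (F := []) .tau .tau (encodeName I.init) r3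
  have h5 := Prog.RunsIn.load (r := r4) (S := parseStore (I.transitions.flatMap encodeTransition ++
    Symb.sep :: encodeName I.target) A B (.tau :: .tau :: encodeName I.init ++ [.sep]) [])
    (fun r : Reg => { r with count := 2 })
  obtain ⟨r6, h6⟩ := runsIn_transitions (l := encodeName I.target) (A := A) (B := B)
    (F := .tau :: .tau :: encodeName I.init ++ [.sep]) _ nT 2 { r4 with count := 2 } rfl []
  have h7 : (pour .tmp [.facts]).RunsIn r6 (parseStore (encodeName I.target) A B
        (.tau :: .tau :: encodeName I.init ++ [.sep])
        ((separate 2 (I.transitions.flatMap encodeTransition)).reverse ++ []))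
      { r6 with cur := none }
      (parseStore (encodeName I.target) A B (separate 2 (I.transitions.flatMap encodeTransition) ++
        (.tau :: .tau :: encodeName I.init ++ [.sep])) [])
      ((separate 2 (I.transitions.flatMap encodeTransition)).length * 4 + 2) :=
    (runsIn_pour .tmp [.facts] (by simp) (by simp) r6 _).cast (fun k => by
        rcases k with _ | (_ | _) | _ | _ | _ | _ | _ | _ | _ <;> simp [parseStore])
      (by simp [parseStore])
  obtain ⟨r8, h8⟩ := runsIn_parse_read_end (A := A) (B := B) (F := separate 2
    (I.transitions.flatMap encodeTransition) ++ (.tau :: .tau :: encodeName I.init ++ [.sep])) _ nE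
    { r6 with cur := none }
  obtain ⟨r9, h9⟩ := runsIn_tagFact (i := []) (A := A) (B := B) (F := separate 2
    (I.transitions.flatMap encodeTransition) ++ (.tau :: .tau :: encodeName I.init ++ [.sep]))
    .tau .quest (encodeName I.target) r8
  refine ⟨r9, (h1.seq (h2.seq ((h3.seq h4).seq ((h5.seq (h6.seq h7)).seq (h8.seq h9))))).cast
    (fun k => ?_) ?_⟩
  · rw [separate_transitions]
    simp [CoverInput.facts, joinFacts]
  · have := length_separate 2 (I.transitions.flatMap encodeTransition)
    simp only [List.length_append, List.length_cons]
    omega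

/-- The program that reads an input, runs a command, and searches the answer. -/
def decider (c : Cmd) : SProg :=
  .seq readInput <| .seq (ofCmd c) <| .seq (emit .query answerPattern) <| .seq search <|
    .seq (pour .facts []) <| .seq (pour (.dom true) []) (pour (.dom false) [])

theorem runsIn_decider (c : Cmd) (hc : c.ok [] = true) (I : CoverInput) (ρ : Fin 14 → ℕ) (r : Reg) :
    ∃ r', (r'.found = true ↔ patternWord ρ answerPattern ∈ c.run I.sizes ρ I.facts) ∧
      (decider c).RunsIn r (Function.update (fun _ => []) .inp I.encode) r' (fun _ => [])
        (15 * I.encode.length + 30 + (c.time I.encode.length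
          (2 * I.encode.length + 6 + c.growth I.encode.length) +
          100 * (2 * I.encode.length + 6 + c.growth I.encode.length + 1))) := by
  set N := 2 * I.encode.length + 6 + c.growth I.encode.length with hN
  obtain ⟨r1, h1⟩ := runsIn_readInput I r
  set S1 := parseStore [] ((List.range I.numStates).flatMap encodeName)
        ((List.range I.numMessages).flatMap encodeName) (joinFacts I.facts) [] with hS1
  have hR : Cmd.Ready I.sizes I.encode.length [] ρ I.facts S1 := by
    constructor
    case dom => intro b; cases b <;> rfl
    case noSep =>
      intro w hw
      simp only [CoverInput.facts, List.mem_cons, List.mem_append, List.mem_map,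
        List.not_mem_nil, or_false] at hw
      rcases hw with rfl | ⟨t, -, rfl⟩ | rfl
      · simp [sep_notMem_encodeName]
      · exact sep_notMem_encodeTransition t
      · simp [sep_notMem_encodeName]
    all_goals simp [hS1, parseStore]
  have hlen : (joinFacts (c.run I.sizes ρ I.facts)).length ≤ N := by
    have h1 := Cmd.length_run I.small_sizes c [] ρ I.facts hc (by simp)
    have h2 := I.length_joinFacts_facts
    omega
  obtain ⟨r2, h2⟩ := runsIn_ofCmd I.small_sizes N c [] hc ρ I.facts r1 S1 hR hlen
  set db := c.run I.sizes ρ I.facts with hdb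
  have hR2 := hR.update_facts (db' := db) (Cmd.noSep_run hc ρ hR.noSep)
  set S2 := Function.update S1 .facts (joinFacts db) with hS2
  -- The answer pattern has no variables, so the scope is empty and `0` bounds the lengths of all
  -- names in it.
  obtain ⟨r3, h3⟩ := runsIn_emit .query (by simp) (by simp) answerPattern [] (by rfl) ρ 0
    (by simp) r2 S2 (by simp) hR2.tmp
  obtain ⟨r4, hr4, h4⟩ := runsIn_search (patternWord ρ answerPattern)
    (sep_notMem_patternWord (scope := []) rfl ρ) db hR2.noSep r3
    (Function.update S2 .query (patternWord ρ answerPattern ++ Symb.sep :: S2 .query))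
    (by simpa using hR2.facts) (by simpa using hR2.facts') (by simp [hR2.query])
    (by simpa using hR2.query')
  have e : Function.update (Function.update S2 .query (patternWord ρ answerPattern ++ Symb.sep ::
      S2 .query)) .query [] = S2 := by
    simp [← hR2.query]
  rw [e] at h4
  -- All stacks have to be empty at the end; the flag `found` survives the pours.
  have h5 := (runsIn_pour .facts [] (by simp) (by simp) r4 S2).seq
    ((runsIn_pour (.dom true) [] (by simp) (by simp) _ _).seq
      (runsIn_pour (.dom false) [] (by simp) (by simp) _ _))
  refine ⟨_, ?_, (h1.seq (h2.seq (h3.seq (h4.seq h5)))).cast (fun k => ?_) ?_⟩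
  · simp [hr4]
  · rcases k with _ | (_ | _) | _ | _ | _ | _ | _ | _ | _ <;> simp [hS2, hS1, parseStore]
  · have h6 := I.small_sizes true
    have h7 := I.small_sizes false
    simp only [CoverInput.sizes, List.length_flatMap] at h6 h7
    have h8 : (patternWord ρ answerPattern).length = 2 := rfl
    have h9 : answerPattern.length = 2 := rfl
    simp [hS2, hS1, parseStore, h8, h9]
    omega

end SProg

/-- A predicate that a command decides is in P. -/
theorem inPolyTime_of_cmd (c : Cmd) (hc : c.ok [] = true) {α : Type} (inp : α → CoverInput)
    (ρ : Fin 14 → ℕ) (pred : α → Prop) (h : ∀ a,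
      patternWord ρ answerPattern ∈ c.run (inp a).sizes ρ (inp a).facts ↔ pred a) :
    InPolyTime (fun a => (inp a).encode) pred := by
  have hN : IsPoly fun D => 2 * D + 6 + c.growth D :=
    (((IsPoly.const 2).mul .id).add (.const 6)).add c.isPoly_growth
  obtain ⟨p, hp⟩ := (((IsPoly.const 15).mul .id).add (.const 30)).add
    ((c.isPoly_time hN).add ((IsPoly.const 100).mul (hN.add (.const 1))))
  refine (SProg.decider c).inPolyTime .inp ⟨none, none, false, false, 0⟩ Reg.found _ pred p
    fun a => ?_
  obtain ⟨r, hr, t, ht, hrun⟩ := SProg.runsIn_decider c hc (inp a) ρ ⟨none, none, false, false, 0⟩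
  exact ⟨r, t, by rw [← hp]; exact ht, hr.trans (h a), hrun⟩

theorem patternWord_congr {ρ τ : Fin 14 → ℕ} {scope : List (Fin 14)} {p : List Piece}
    (hp : p.all (Piece.ok scope) = true) (h : ∀ x ∈ scope, ρ x = τ x) :
    patternWord ρ p = patternWord τ p := by
  induction p with
  | nil => rfl
  | cons a p ih =>
    simp only [List.all_cons, Bool.and_eq_true] at hp
    simp only [patternWord, List.flatMap_cons] at ih ⊢
    rw [ih hp.2]
    cases a with
    | sym a => rfl
    | var x => simp [Piece.word, h x (by simpa [Piece.ok] using hp.1)]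

/-! ### Invariants of commands, rules, and saturation -/

namespace Cmd

variable {d : Bool → ℕ} {Φ : List Symb → Prop} {db₀ : List (List Symb)}

/-- The command keeps the facts valid, if there are at least the facts `db₀`. -/
def Preserves (d : Bool → ℕ) (Φ : List Symb → Prop) (db₀ : List (List Symb)) (c : Cmd)
    (ρ : Fin 14 → ℕ) : Prop :=
  ∀ db, db₀ ⊆ db → (∀ w ∈ db, Φ w) → ∀ w ∈ c.run d ρ db, Φ w

/-- The command inserts `w`, if there are at least the facts `db₀` and only valid ones. -/
def Yields (d : Bool → ℕ) (Φ : List Symb → Prop) (db₀ : List (List Symb)) (c : Cmd)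
    (ρ : Fin 14 → ℕ) (w : List Symb) : Prop :=
  ∀ db, db₀ ⊆ db → (∀ w ∈ db, Φ w) → w ∈ c.run d ρ db

theorem subset_run (d : Bool → ℕ) (c : Cmd) (ρ : Fin 14 → ℕ) (db : List (List Symb)) :
    db ⊆ c.run d ρ db := (suffix_run d c ρ db).subset

theorem Preserves.seq {c c' : Cmd} {ρ : Fin 14 → ℕ} (h : c.Preserves d Φ db₀ ρ)
    (h' : c'.Preserves d Φ db₀ ρ) : (c.seq c').Preserves d Φ db₀ ρ :=
  fun db hdb hΦ => h' _ (List.Subset.trans hdb (subset_run d c ρ db)) (h db hdb hΦ)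

theorem Preserves.forIn {c : Cmd} {ρ : Fin 14 → ℕ} {b : Bool} {x : Fin 14}
    (h : ∀ i < d b, c.Preserves d Φ db₀ (Function.update ρ x i)) :
    (c.forIn b x).Preserves d Φ db₀ ρ := by
  intro db hdb hΦ
  have : ∀ l : List ℕ, (∀ i ∈ l, i < d b) → ∀ db, db₀ ⊆ db → (∀ w ∈ db, Φ w) →
      ∀ w ∈ l.foldl (fun db i => c.run d (Function.update ρ x i) db) db, Φ w := by
    intro l
    induction l with
    | nil => intro _ db _ hΦ; exact hΦ
    | cons i l ih =>
      intro hl db hdb hΦ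
      exact ih (fun j hj => hl j (List.mem_cons_of_mem _ hj)) _ (List.Subset.trans hdb (subset_run d c _ db))
        (h i (hl i List.mem_cons_self) db hdb hΦ)
  exact this _ (fun i hi => List.mem_range.1 hi) db hdb hΦ

theorem Yields.seq_left {c c' : Cmd} {ρ : Fin 14 → ℕ} {w : List Symb}
    (h : c.Yields d Φ db₀ ρ w) : (c.seq c').Yields d Φ db₀ ρ w :=
  fun db hdb hΦ => subset_run d c' ρ _ (h db hdb hΦ)

theorem Yields.seq_right {c c' : Cmd} {ρ : Fin 14 → ℕ} {w : List Symb}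
    (hc : c.Preserves d Φ db₀ ρ) (h : c'.Yields d Φ db₀ ρ w) : (c.seq c').Yields d Φ db₀ ρ w :=
  fun db hdb hΦ => h _ (List.Subset.trans hdb (subset_run d c ρ db)) (hc db hdb hΦ)

/-- The rounds before the right one keep the list valid, as the body requires; the rounds after it
delete nothing. -/
theorem Yields.forIn {c : Cmd} {ρ : Fin 14 → ℕ} {b : Bool} {x : Fin 14} {w : List Symb}
    (hc : ∀ i < d b, c.Preserves d Φ db₀ (Function.update ρ x i)) {i : ℕ} (hi : i < d b)
    (h : c.Yields d Φ db₀ (Function.update ρ x i) w) : (c.forIn b x).Yields d Φ db₀ ρ w := by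
  intro db hdb hΦ
  have : ∀ l : List ℕ, (∀ i ∈ l, i < d b) → i ∈ l → ∀ db, db₀ ⊆ db → (∀ w ∈ db, Φ w) →
      w ∈ l.foldl (fun db i => c.run d (Function.update ρ x i) db) db := by
    intro l
    induction l with
    | nil => intro _ h; simp at h
    | cons j l ih =>
      intro hl hil db hdb hΦ
      rcases List.mem_cons.1 hil with rfl | hil
      · exact (suffix_foldl (fun db j => suffix_run d c _ db) l _).subset (h db hdb hΦ)
      · exact ih (fun k hk => hl k (List.mem_cons_of_mem _ hk)) hil _
          (List.Subset.trans hdb (subset_run d c _ db)) (hc j (hl j List.mem_cons_self) db hdb hΦ)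
  exact this _ (fun i hi => List.mem_range.1 hi) (List.mem_range.2 hi) db hdb hΦ

/-- Nested loops. -/
def forAll (b : Bool) (xs : List (Fin 14)) (c : Cmd) : Cmd := xs.foldr (Cmd.forIn b) c

theorem Preserves.forAll {c : Cmd} {b : Bool} (xs : List (Fin 14)) {ρ : Fin 14 → ℕ}
    (h : ∀ ρ', (∀ x ∈ xs, ρ' x < d b) → (∀ x ∉ xs, ρ' x = ρ x) → c.Preserves d Φ db₀ ρ') :
    (c.forAll b xs).Preserves d Φ db₀ ρ := by
  induction xs generalizing ρ with
  | nil => exact h ρ (by simp) (by simp)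
  | cons x xs ih =>
    refine Preserves.forIn fun i hi => ih fun ρ' h1 h2 => h ρ' (fun y hy => ?_) (fun y hy => ?_)
    · by_cases hy' : y ∈ xs
      · exact h1 y hy'
      · obtain rfl : y = x := by simpa [hy'] using hy
        rw [h2 y hy']
        simpa using hi
    · simp only [List.mem_cons, not_or] at hy
      rw [h2 y hy.2, Function.update_of_ne hy.1]

theorem Yields.forAll {c : Cmd} {b : Bool} (xs : List (Fin 14)) {ρ : Fin 14 → ℕ} {w : List Symb}
    (hc : ∀ ρ', (∀ x ∈ xs, ρ' x < d b) → (∀ x ∉ xs, ρ' x = ρ x) → c.Preserves d Φ db₀ ρ')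
    (τ : Fin 14 → ℕ) (hτ : ∀ x ∈ xs, τ x < d b)
    (h : ∀ ρ', (∀ x ∈ xs, ρ' x = τ x) → (∀ x ∉ xs, ρ' x = ρ x) → c.Yields d Φ db₀ ρ' w) :
    (c.forAll b xs).Yields d Φ db₀ ρ w := by
  induction xs generalizing ρ with
  | nil => exact h ρ (by simp) (by simp)
  | cons x xs ih =>
    have key : ∀ i < d b, ∀ ρ' : Fin 14 → ℕ, (∀ y ∈ xs, ρ' y < d b) →
        (∀ y ∉ xs, ρ' y = Function.update ρ x i y) → c.Preserves d Φ db₀ ρ' := by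
      refine fun i hi ρ' h1 h2 => hc ρ' (fun y hy => ?_) (fun y hy => ?_)
      · by_cases hy' : y ∈ xs
        · exact h1 y hy'
        · obtain rfl : y = x := by simpa [hy'] using hy
          rw [h2 y hy']
          simpa using hi
      · simp only [List.mem_cons, not_or] at hy
        rw [h2 y hy.2, Function.update_of_ne hy.1]
    refine Yields.forIn (fun i hi => Preserves.forAll xs (key i hi)) (hτ x List.mem_cons_self)
      (ih (key _ (hτ x List.mem_cons_self)) (fun y hy => hτ y (List.mem_cons_of_mem _ hy))
        fun ρ' h1 h2 => h ρ' (fun y hy => ?_) (fun y hy => ?_))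
    · by_cases hy' : y ∈ xs
      · exact h1 y hy'
      · obtain rfl : y = x := by simpa [hy'] using hy
        rw [h2 y hy']
        simp
    · simp only [List.mem_cons, not_or] at hy
      rw [h2 y hy.2, Function.update_of_ne hy.1]

/-- Nested loops serve as a counter: they run the body `d true ^ xs.length` times, with valuations
that do not matter if the body does not mention `xs`. -/
theorem exists_run_forAll (c : Cmd) (d : Bool → ℕ) (xs : List (Fin 14)) (ρ : Fin 14 → ℕ) :
    ∃ l : List (Fin 14 → ℕ), l.length = d true ^ xs.length ∧
      ∀ db, (c.forAll true xs).run d ρ db = l.foldl (fun db ρ => c.run d ρ db) db := by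
  induction xs generalizing ρ with
  | nil => exact ⟨[ρ], rfl, fun db => rfl⟩
  | cons x xs ih =>
    choose f hf hf' using ih
    refine ⟨(List.range (d true)).flatMap fun i => f (Function.update ρ x i), ?_, fun db => ?_⟩
    · simp [List.length_flatMap, hf, pow_succ, mul_comm]
    · rw [List.foldl_flatMap]
      simp only [← hf']
      rfl

end Cmd

/-- A rule: for all values of the variables for which the facts `neg` are missing and the facts
`body` are there, it inserts the fact `head`. -/
structure Rule where
  states : List (Fin 14)
  messages : List (Fin 14) := []
  neg : List (List Piece) := []
  body : List (List Piece)
  head : List Piece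

namespace Rule

variable (r : Rule) (d : Bool → ℕ) (Φ : List Symb → Prop) (db₀ : List (List Symb))

/-- The command that tests the conditions of a rule and inserts its head. -/
def test : Cmd :=
  r.neg.foldr (Cmd.guard false) (r.body.foldr (Cmd.guard true) (.insert r.head))

/-- The command that executes a rule. -/
def cmd : Cmd := .forAll true r.states (.forAll false r.messages r.test)

/-- The values are in the range of the variables of the rule. -/
def InRange (ρ : Fin 14 → ℕ) : Prop :=
  (∀ x ∈ r.states, ρ x < d true) ∧ ∀ x ∈ r.messages, ρ x < d false

/-- All variables of the patterns are bound, and no variable is bound twice. -/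
def closed : Bool :=
  (r.neg ++ r.body ++ [r.head]).all (fun p => p.all (Piece.ok (r.states ++ r.messages))) &&
    r.states.all fun x => !decide (x ∈ r.messages)

/-- The rule derives valid facts only. -/
def Sound : Prop := ∀ ρ, r.InRange d ρ → (∀ p ∈ r.neg, patternWord ρ p ∉ db₀) →
  (∀ p ∈ r.body, Φ (patternWord ρ p)) → Φ (patternWord ρ r.head)

variable {r d Φ db₀}

theorem run_test (ρ : Fin 14 → ℕ) (db : List (List Symb)) [Decidable ((∀ p ∈ r.neg,
      patternWord ρ p ∉ db) ∧ ∀ p ∈ r.body, patternWord ρ p ∈ db)] : r.test.run d ρ db =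
    if (∀ p ∈ r.neg, patternWord ρ p ∉ db) ∧ ∀ p ∈ r.body, patternWord ρ p ∈ db then
      patternWord ρ r.head :: db else db := by
  have guards : ∀ (b : Bool) (l : List (List Piece)) (c : Cmd),
      (∀ p ∈ l, decide (patternWord ρ p ∈ db) = b) →
      (l.foldr (Cmd.guard b) c).run d ρ db = c.run d ρ db := by
    intro b l c h
    induction l with
    | nil => rfl
    | cons p l ih =>
      rw [List.foldr_cons, Cmd.run, if_pos (h p List.mem_cons_self),
        ih fun p hp => h p (List.mem_cons_of_mem _ hp)]
  have guards' : ∀ (b : Bool) (l : List (List Piece)) (c : Cmd) (p : List Piece), p ∈ l →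
      decide (patternWord ρ p ∈ db) ≠ b → (l.foldr (Cmd.guard b) c).run d ρ db = db := by
    intro b l c p hp h
    induction l with
    | nil => simp at hp
    | cons p' l ih =>
      rw [List.foldr_cons, Cmd.run]
      rcases List.mem_cons.1 hp with rfl | hp
      · rw [if_neg h]
      · rw [ih hp, ite_self]
  split_ifs with h
  · rw [test, guards _ _ _ (by simpa using h.1), guards _ _ _ (by simpa using h.2)]
    rfl
  · by_cases h1 : ∀ p ∈ r.neg, patternWord ρ p ∉ db
    · have h2 : ∃ p ∈ r.body, patternWord ρ p ∉ db := by
        by_contra! h3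
        exact h ⟨h1, h3⟩
      obtain ⟨p, hp, hp'⟩ := h2
      rw [test, guards _ _ _ (by simpa using h1), guards' _ _ _ p hp (by simpa using hp')]
    · push Not at h1
      obtain ⟨p, hp, hp'⟩ := h1
      rw [test, guards' _ _ _ p hp (by simpa using hp')]

/-- A negative test that succeeds on the current list also succeeds on its part `db₀`, and soundness
refers to the latter. -/
theorem preserves_test (h : r.Sound d Φ db₀) {ρ : Fin 14 → ℕ} (hρ : r.InRange d ρ) :
    r.test.Preserves d Φ db₀ ρ := by
  classical
  intro db hdb hΦ w hw
  rw [run_test] at hw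
  split_ifs at hw with h'
  · rcases List.mem_cons.1 hw with rfl | hw
    · exact h ρ hρ (fun p hp hm => h'.1 p hp (hdb hm)) fun p hp => hΦ _ (h'.2 p hp)
    · exact hΦ w hw
  · exact hΦ w hw

theorem inRange_of {ρ₁ ρ₂ : Fin 14 → ℕ} (hc : r.closed = true)
    (h1 : ∀ x ∈ r.states, ρ₁ x < d true) (h2 : ∀ x ∈ r.messages, ρ₂ x < d false)
    (h3 : ∀ x ∉ r.messages, ρ₂ x = ρ₁ x) : r.InRange d ρ₂ := by
  refine ⟨fun x hx => ?_, h2⟩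
  have hc' := (Bool.and_eq_true _ _ ▸ hc : _ ∧ _)
  have hd : ∀ x ∈ r.states, x ∉ r.messages := by simpa using hc'.2
  rw [h3 x (hd x hx)]
  exact h1 x hx

theorem preserves (hc : r.closed = true) (h : r.Sound d Φ db₀) (ρ : Fin 14 → ℕ) :
    r.cmd.Preserves d Φ db₀ ρ :=
  .forAll _ fun _ h1 _ => .forAll _ fun _ h2 h3 => preserves_test h (inRange_of hc h1 h2 h3)

/-- The loops reach the valuation `τ`. At that moment the positive tests succeed because `db₀` is
still there, and the negative ones because the list contains valid facts only. -/
theorem yields (hc : r.closed = true) (h : r.Sound d Φ db₀) (ρ τ : Fin 14 → ℕ)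
    (hτ : r.InRange d τ) (hn : ∀ p ∈ r.neg, ¬ Φ (patternWord τ p))
    (hb : ∀ p ∈ r.body, patternWord τ p ∈ db₀) :
    r.cmd.Yields d Φ db₀ ρ (patternWord τ r.head) := by
  classical
  refine .forAll _ (fun _ h1 _ => .forAll _ fun _ h2 h3 =>
    preserves_test h (inRange_of hc h1 h2 h3)) τ hτ.1 fun ρ₁ h1 _ => ?_
  refine .forAll _ (fun _ h2 h3 => preserves_test h (inRange_of hc
    (fun x hx => by rw [h1 x hx]; exact hτ.1 x hx) h2 h3)) τ hτ.2 fun ρ₂ h2 h3 => ?_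
  intro db hdb hΦ
  have hc' := (Bool.and_eq_true _ _ ▸ hc : _ ∧ _)
  have hd : ∀ x ∈ r.states, x ∉ r.messages := by simpa using hc'.2
  have hag : ∀ x ∈ r.states ++ r.messages, ρ₂ x = τ x := by
    intro x hx
    rcases List.mem_append.1 hx with hx | hx
    · rw [h3 x (hd x hx), h1 x hx]
    · exact h2 x hx
  have e : ∀ p ∈ r.neg ++ r.body ++ [r.head], patternWord ρ₂ p = patternWord τ p :=
    fun p hp => patternWord_congr (List.all_eq_true.1 hc'.1 p hp) hag
  rw [run_test, if_pos, e _ (by simp)]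
  · exact List.mem_cons_self
  · refine ⟨fun p hp hm => hn p hp ?_, fun p hp => ?_⟩
    · rw [e p (by simp [hp])] at hm
      exact hΦ _ hm
    · rw [e p (by simp [hp])]
      exact hdb (hb p hp)

/-- The command that executes the rules of a list. -/
def cmds : Rule → List Rule → Cmd
  | r, [] => r.cmd
  | r, r' :: rs => .seq r.cmd (cmds r' rs)

theorem preserves_cmds (rs : List Rule) (hc : ∀ r' ∈ r :: rs, r'.closed = true)
    (h : ∀ r' ∈ r :: rs, r'.Sound d Φ db₀) (ρ : Fin 14 → ℕ) :
    (cmds r rs).Preserves d Φ db₀ ρ := by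
  induction rs generalizing r with
  | nil => exact preserves (hc r List.mem_cons_self) (h r List.mem_cons_self) ρ
  | cons r' rs ih =>
    exact (preserves (hc r List.mem_cons_self) (h r List.mem_cons_self) ρ).seq
      (ih (fun _ hr => hc _ (List.mem_cons_of_mem _ hr))
        fun _ hr => h _ (List.mem_cons_of_mem _ hr))

theorem yields_cmds (rs : List Rule) (hc : ∀ r' ∈ r :: rs, r'.closed = true)
    (h : ∀ r' ∈ r :: rs, r'.Sound d Φ db₀) (ρ : Fin 14 → ℕ) {r' : Rule} (hr' : r' ∈ r :: rs)
    (τ : Fin 14 → ℕ) (hτ : r'.InRange d τ) (hn : ∀ p ∈ r'.neg, ¬ Φ (patternWord τ p))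
    (hb : ∀ p ∈ r'.body, patternWord τ p ∈ db₀) :
    (cmds r rs).Yields d Φ db₀ ρ (patternWord τ r'.head) := by
  induction rs generalizing r with
  | nil =>
    obtain rfl : r' = r := by simpa using hr'
    exact yields (hc _ hr') (h _ hr') ρ τ hτ hn hb
  | cons r₁ rs ih =>
    rcases List.mem_cons.1 hr' with rfl | hr'
    · exact (yields (hc _ List.mem_cons_self) (h _ List.mem_cons_self) ρ τ hτ hn hb).seq_left
    · exact (ih (fun _ hr => hc _ (List.mem_cons_of_mem _ hr))
        (fun _ hr => h _ (List.mem_cons_of_mem _ hr)) hr').seq_right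
        (preserves (hc r List.mem_cons_self) (h r List.mem_cons_self) ρ)

/-- Each round either adds an element of `U` or is stationary on `U`, and there are as many rounds
as missing elements. The list at a stationary round, and not the final one, is the closed set; this
suffices because it is contained in the final list. -/
theorem exists_stationary {β : Type} (f : List (List Symb) → β → List (List Symb))
    (hf : ∀ db b, db ⊆ f db b) (Inv : List (List Symb) → Prop)
    (hInv : ∀ db b, Inv db → Inv (f db b)) (U : Finset (List Symb)) (l : List β)
    (db : List (List Symb)) (hdb : Inv db) (hl : (U.filter (· ∉ db)).card ≤ l.length) :
    (∀ w ∈ U, w ∈ l.foldl f db) ∨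
      ∃ db' b, db ⊆ db' ∧ db' ⊆ l.foldl f db ∧ Inv db' ∧ ∀ w ∈ U, w ∈ f db' b → w ∈ db' := by
  have hsub : ∀ (l : List β) (db : List (List Symb)), db ⊆ l.foldl f db := by
    intro l
    induction l with
    | nil => exact fun db => List.Subset.refl _
    | cons b l ih => exact fun db => List.Subset.trans (hf db b) (ih _)
  induction l generalizing db with
  | nil =>
    refine Or.inl fun w hw => ?_
    by_contra hn
    have : w ∈ U.filter (· ∉ db) := Finset.mem_filter.2 ⟨hw, hn⟩
    rw [Finset.card_eq_zero.1 (Nat.le_zero.1 hl)] at this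
    simp at this
  | cons b l ih =>
    by_cases hs : ∀ w ∈ U, w ∈ f db b → w ∈ db
    · exact Or.inr ⟨db, b, List.Subset.refl _, hsub (b :: l) db, hdb, hs⟩
    · push Not at hs
      obtain ⟨w, hw, h1, h2⟩ := hs
      have hlt : (U.filter (· ∉ f db b)).card < (U.filter (· ∉ db)).card := by
        refine Finset.card_lt_card ⟨fun v hv => ?_, fun h => ?_⟩
        · rw [Finset.mem_filter] at hv ⊢
          exact ⟨hv.1, fun h => hv.2 (hf db b h)⟩
        · exact (Finset.mem_filter.1 (h (Finset.mem_filter.2 ⟨hw, h2⟩))).2 h1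
      rcases ih (f db b) (hInv db b hdb) (by simp only [List.length_cons] at hl; omega) with h | h
      · exact Or.inl h
      · obtain ⟨db', b', h3, h4, h5, h6⟩ := h
        exact Or.inr ⟨db', b', List.Subset.trans (hf db b) h3, h4, h5, h6⟩

/-- When the rules are executed often enough, all derivable facts of a finite set are there. -/
theorem exists_closed (rs : List Rule) (xs : List (Fin 14)) (U : Finset (List Symb))
    (hU : U.card ≤ d true ^ xs.length) (hc : ∀ r' ∈ r :: rs, r'.closed = true)
    (h : ∀ r' ∈ r :: rs, ∀ db₀, r'.Sound d Φ db₀) (ρ : Fin 14 → ℕ) (db : List (List Symb))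
    (hdb : ∀ w ∈ db, Φ w) :
    (∀ w ∈ U, w ∈ (Cmd.forAll true xs (cmds r rs)).run d ρ db) ∨
      ∃ db', db ⊆ db' ∧ db' ⊆ (Cmd.forAll true xs (cmds r rs)).run d ρ db ∧
        ∀ r' ∈ r :: rs, ∀ τ, r'.InRange d τ → (∀ p ∈ r'.neg, ¬ Φ (patternWord τ p)) →
          (∀ p ∈ r'.body, patternWord τ p ∈ db') → patternWord τ r'.head ∈ U →
          patternWord τ r'.head ∈ db' := by
  obtain ⟨l, hl, hrun⟩ := Cmd.exists_run_forAll (cmds r rs) d xs ρ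
  rw [hrun]
  rcases exists_stationary (fun db ρ => (cmds r rs).run d ρ db)
    (fun db ρ => Cmd.subset_run d _ ρ db) (fun db => ∀ w ∈ db, Φ w)
    (fun db ρ hdb => preserves_cmds rs hc (fun r' hr' => h r' hr' db) ρ db (List.Subset.refl _) hdb)
    U l db hdb ((Finset.card_filter_le _ _).trans (hU.trans hl.ge)) with h1 | h1
  · exact Or.inl h1
  · obtain ⟨db', ρ', h2, h3, h4, h5⟩ := h1
    exact Or.inr ⟨db', h2, h3, fun r' hr' τ hτ hn hb hm => h5 _ hm
      (yields_cmds rs hc (fun r' hr' => h r' hr' db') ρ' hr' τ hτ hn hb db' (List.Subset.refl _) h4)⟩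

end Rule

/-! ### Words for facts, and their meaning -/

/-- Transitions begin with a name, derived facts with one of the other letters, so the two kinds of
words cannot be confused. -/
theorem encodeName_append_eq_cons {i : ℕ} {x y : List Symb} {a : Symb}
    (h : encodeName i ++ x = a :: y) : a = .fin ∨ ∃ b, a = .bit b := by
  unfold encodeName at h
  cases he : Computability.encodeNat i with
  | nil => simp [he] at h; exact Or.inl h.1.symm
  | cons b l => simp [he] at h; exact Or.inr ⟨b, h.1.symm⟩

/-- The fact with the given first letters about the given numbers. -/
def factWord (a b : Symb) (l : List ℕ) : List Symb := a :: b :: l.flatMap encodeName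

theorem flatMap_encodeName_injective : Function.Injective fun l : List ℕ => l.flatMap encodeName := by
  intro l
  induction l with
  | nil =>
    intro l' h
    cases l' with
    | nil => rfl
    | cons i l' => simp [encodeName] at h
  | cons i l ih =>
    intro l' h
    cases l' with
    | nil => simp [encodeName] at h
    | cons j l' =>
      obtain ⟨rfl, h'⟩ := encodeName_append_inj (by simpa using h)
      rw [ih h']

theorem factWord_inj {a b a' b' : Symb} {l l' : List ℕ} :
    factWord a b l = factWord a' b' l' ↔ a = a' ∧ b = b' ∧ l = l' := by
  simp only [factWord, List.cons.injEq]
  exact and_congr_right fun _ => and_congr_right fun _ => flatMap_encodeName_injective.eq_iff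

/-- The words of the transitions between the given numbers. -/
def internalWord (i j : ℕ) : List Symb := encodeName i ++ .tau :: encodeName j

def broadcastWord (i m j : ℕ) : List Symb :=
  encodeName i ++ .bang :: (encodeName m ++ encodeName j)

def receiveWord (i m j : ℕ) : List Symb :=
  encodeName i ++ .quest :: (encodeName m ++ encodeName j)

/-- The pattern of a fact with the given first letters. -/
def tagged (a b : Symb) (l : List (Fin 14)) : List Piece := .sym a :: .sym b :: l.map .var

def internalPattern (i j : Fin 14) : List Piece := [.var i, .sym .tau, .var j]

def broadcastPattern (i m j : Fin 14) : List Piece := [.var i, .sym .bang, .var m, .var j]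

def receivePattern (i m j : Fin 14) : List Piece := [.var i, .sym .quest, .var m, .var j]

@[simp] theorem patternWord_tagged (ρ : Fin 14 → ℕ) (a b : Symb) (l : List (Fin 14)) :
    patternWord ρ (tagged a b l) = factWord a b (l.map ρ) := by
  simp [patternWord, tagged, factWord, Piece.word, List.flatMap_map]

@[simp] theorem patternWord_internal (ρ : Fin 14 → ℕ) (i j : Fin 14) :
    patternWord ρ (internalPattern i j) = internalWord (ρ i) (ρ j) := by
  simp [patternWord, internalPattern, internalWord, Piece.word]

@[simp] theorem patternWord_broadcast (ρ : Fin 14 → ℕ) (i m j : Fin 14) :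
    patternWord ρ (broadcastPattern i m j) = broadcastWord (ρ i) (ρ m) (ρ j) := by
  simp [patternWord, broadcastPattern, broadcastWord, Piece.word]

@[simp] theorem patternWord_receive (ρ : Fin 14 → ℕ) (i m j : Fin 14) :
    patternWord ρ (receivePattern i m j) = receiveWord (ρ i) (ρ m) (ρ j) := by
  simp [patternWord, receivePattern, receiveWord, Piece.word]

@[simp] theorem patternWord_answer (ρ : Fin 14 → ℕ) :
    patternWord ρ answerPattern = factWord .bang .tau [] := rfl

namespace CoverInput

variable (I : CoverInput)

/-- The meaning of the fact with the given first letters about the given numbers. -/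
def Meaning : Symb → Symb → List ℕ → Prop
  | .tau, .tau, l => l = [↑I.init]
  | .tau, .quest, l => l = [↑I.target]
  | .tau, .bang, l => ∃ q m, m ∈ I.protocol.receivable q ∧ l = [↑q, ↑m]
  | .quest, .quest, l => ∃ m q q', I.protocol.Reacts m q q' ∧ l = [↑m, ↑q, ↑q']
  | .bang, .bang, l => ∃ a c, I.protocol.Pair a c ∧ l = [↑a, ↑c]
  | .bang, .quest, l => ∃ w u v x z, I.protocol.Five w u v x z ∧ l = [↑w, ↑u, ↑v, ↑x, ↑z]
  | .bang, .tau, _ => ∃ w u x z, I.protocol.Five w u I.target x z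
  | _, _, _ => True

/-- The word is not a false fact. -/
def Valid (w : List Symb) : Prop :=
  (∀ t, w = encodeTransition t → t ∈ I.protocol.trans) ∧
    ∀ a b l, w = factWord a b l → I.Meaning a b l

variable {I}

theorem valid_factWord {a b : Symb} (h : a ≠ .fin ∧ ∀ x, a ≠ .bit x) (l : List ℕ) :
    I.Valid (factWord a b l) ↔ I.Meaning a b l := by
  refine ⟨fun hv => hv.2 _ _ _ rfl, fun hm => ⟨fun t ht => ?_, fun a' b' l' he => ?_⟩⟩
  · rw [encodeTransition, List.append_assoc] at ht
    rcases encodeName_append_eq_cons ht.symm with h' | ⟨x, h'⟩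
    · exact absurd h' h.1
    · exact absurd h' (h.2 x)
  · obtain ⟨rfl, rfl, rfl⟩ := factWord_inj.1 he
    exact hm

theorem valid_encodeTransition (t : Transition (Fin I.numStates) (Fin I.numMessages)) :
    I.Valid (encodeTransition t) ↔ t ∈ I.protocol.trans := by
  refine ⟨fun hv => hv.1 _ rfl, fun hm => ⟨fun t' ht => ?_, fun a b l he => ?_⟩⟩
  · obtain ⟨rfl, -⟩ := encodeTransition_append_inj t t' [] [] (by rw [ht])
    exact hm
  · rw [encodeTransition, List.append_assoc] at he
    rcases encodeName_append_eq_cons he with rfl | ⟨x, rfl⟩ <;> simp [Meaning]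

theorem encode_internal (q q' : Fin I.numStates) : internalWord q q' =
    encodeTransition ⟨q, (Action.internal : Action (Fin I.numMessages)), q'⟩ := by
  simp [internalWord, encodeTransition, encodeAction]

theorem encode_broadcast (q q' : Fin I.numStates) (m : Fin I.numMessages) : broadcastWord q m q' =
    encodeTransition ⟨q, .broadcast m, q'⟩ := by
  simp [broadcastWord, encodeTransition, encodeAction]

theorem encode_receive (q q' : Fin I.numStates) (m : Fin I.numMessages) : receiveWord q m q' =
    encodeTransition ⟨q, .receive m, q'⟩ := by
  simp [receiveWord, encodeTransition, encodeAction]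

variable (q q' a c w u v x z : Fin I.numStates) (m : Fin I.numMessages)

@[simp] theorem valid_internal :
    I.Valid (internalWord q q') ↔ ⟨q, .internal, q'⟩ ∈ I.protocol.trans := by
  rw [encode_internal, valid_encodeTransition]

@[simp] theorem valid_broadcast :
    I.Valid (broadcastWord q m q') ↔ ⟨q, .broadcast m, q'⟩ ∈ I.protocol.trans := by
  rw [encode_broadcast, valid_encodeTransition]

@[simp] theorem valid_receive :
    I.Valid (receiveWord q m q') ↔ ⟨q, .receive m, q'⟩ ∈ I.protocol.trans := by
  rw [encode_receive, valid_encodeTransition]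

@[simp] theorem valid_init : I.Valid (factWord .tau .tau [↑q]) ↔ q = I.init := by
  rw [valid_factWord (by simp)]
  simp [Meaning, Fin.val_inj]

@[simp] theorem valid_target : I.Valid (factWord .tau .quest [↑q]) ↔ q = I.target := by
  rw [valid_factWord (by simp)]
  simp [Meaning, Fin.val_inj]

@[simp] theorem valid_receivable :
    I.Valid (factWord .tau .bang [↑q, ↑m]) ↔ m ∈ I.protocol.receivable q := by
  rw [valid_factWord (by simp)]
  simp [Meaning, Fin.val_inj]

@[simp] theorem valid_reacts :
    I.Valid (factWord .quest .quest [↑m, ↑q, ↑q']) ↔ I.protocol.Reacts m q q' := by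
  rw [valid_factWord (by simp)]
  simp [Meaning, Fin.val_inj]

@[simp] theorem valid_pair : I.Valid (factWord .bang .bang [↑a, ↑c]) ↔ I.protocol.Pair a c := by
  rw [valid_factWord (by simp)]
  simp [Meaning, Fin.val_inj]

@[simp] theorem valid_five : I.Valid (factWord .bang .quest [↑w, ↑u, ↑v, ↑x, ↑z]) ↔
    I.protocol.Five w u v x z := by
  rw [valid_factWord (by simp)]
  simp [Meaning, Fin.val_inj]

@[simp] theorem valid_answer : I.Valid (factWord .bang .tau []) ↔
    ∃ w u x z, I.protocol.Five w u I.target x z := by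
  rw [valid_factWord (by simp)]
  simp [Meaning]

end CoverInput

/-! ### The rules that decide coverability, and their soundness -/

/-- The rule for the messages that can be received in a state. -/
def receivableRule : Rule where
  states := [0, 1]
  messages := [5]
  body := [receivePattern 0 5 1]
  head := tagged .tau .bang [0, 5]

/-- The rules for the reactions of a state to a message. -/
def receiveRule : Rule where
  states := [0, 1]
  messages := [5]
  body := [receivePattern 0 5 1]
  head := tagged .quest .quest [5, 0, 1]

def ignoreRule : Rule where
  states := [0]
  messages := [5]
  neg := [tagged .tau .bang [0, 5]]
  body := []
  head := tagged .quest .quest [5, 0, 0]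

def pairPattern (a c : Fin 14) : List Piece := tagged .bang .bang [a, c]

def reactPattern (m q q' : Fin 14) : List Piece := tagged .quest .quest [m, q, q']

def fivePattern (w u v x z : Fin 14) : List Piece := tagged .bang .quest [w, u, v, x, z]

/-- The rules of `Protocol.Pair`. -/
def pairStart : Rule where
  states := [0]
  body := [tagged .tau .tau [0]]
  head := pairPattern 0 0

def pairRules : List Rule := [
  { states := [0, 1, 2]
    body := [pairPattern 0 1, tagged .tau .tau [2]]
    head := pairPattern 1 2 },
  { states := [0, 1, 2]
    body := [pairPattern 0 1, internalPattern 0 2]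
    head := pairPattern 2 1 },
  { states := [0, 1, 2]
    body := [pairPattern 0 1, internalPattern 1 2]
    head := pairPattern 0 2 },
  { states := [0, 1, 2, 3]
    messages := [5]
    body := [pairPattern 0 1, broadcastPattern 0 5 2, reactPattern 5 1 3]
    head := pairPattern 2 3 }]

/-- The rules of `Protocol.Five`. -/
def fiveStart : Rule where
  states := [0, 1, 2, 3, 4]
  body := [pairPattern 0 1, pairPattern 2 3, tagged .tau .tau [4]]
  head := fivePattern 1 4 4 4 3

def fiveRules : List Rule := [
  { states := [0, 1, 2, 3, 4]
    body := [fivePattern 0 1 2 3 4]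
    head := fivePattern 4 3 2 1 0 },
  { states := [0, 1, 2, 3, 4, 6]
    body := [fivePattern 0 1 2 3 4, internalPattern 0 6]
    head := fivePattern 6 1 2 3 4 },
  { states := [0, 1, 2, 3, 4, 6]
    body := [fivePattern 0 1 2 3 4, internalPattern 1 6]
    head := fivePattern 0 6 2 3 4 },
  { states := [0, 1, 2, 3, 4, 6]
    body := [fivePattern 0 1 2 3 4, internalPattern 2 6]
    head := fivePattern 0 1 6 3 4 },
  { states := [0, 1, 2, 3, 4, 6, 7]
    messages := [5]
    body := [fivePattern 0 1 2 3 4, broadcastPattern 0 5 6, reactPattern 5 1 7]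
    head := fivePattern 6 7 2 3 4 },
  { states := [0, 1, 2, 3, 4, 6, 7, 8]
    messages := [5]
    body := [fivePattern 0 1 2 3 4, broadcastPattern 1 5 7, reactPattern 5 0 6, reactPattern 5 2 8]
    head := fivePattern 6 7 8 3 4 },
  { states := [0, 1, 2, 3, 4, 6, 7, 8]
    messages := [5]
    body := [fivePattern 0 1 2 3 4, broadcastPattern 2 5 7, reactPattern 5 1 6, reactPattern 5 3 8]
    head := fivePattern 0 6 7 8 4 }]

/-- The rule for the answer. -/
def answerRule : Rule where
  states := [0, 1, 2, 3, 4]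
  body := [tagged .tau .quest [2], fivePattern 0 1 2 3 4]
  head := answerPattern

/-- The command that decides coverability on lines. -/
def coverCmd : Cmd :=
  .seq receivableRule.cmd <| .seq (Rule.cmds receiveRule [ignoreRule]) <|
  .seq (.forAll true [9, 10] (Rule.cmds pairStart pairRules)) <|
  .seq (.forAll true [9, 10, 11, 12, 13] (Rule.cmds fiveStart fiveRules)) answerRule.cmd

theorem ok_coverCmd : coverCmd.ok [] = true := by decide +kernel

namespace CoverInput

variable {I : CoverInput}

theorem exists_eq_of_inRange {r : Rule} {ρ : Fin 14 → ℕ} (h : r.InRange I.sizes ρ) :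
    (∀ x ∈ r.states, ∃ q : Fin I.numStates, ρ x = q) ∧
      ∀ x ∈ r.messages, ∃ m : Fin I.numMessages, ρ x = m :=
  ⟨fun x hx => ⟨⟨ρ x, h.1 x hx⟩, rfl⟩, fun x hx => ⟨⟨ρ x, h.2 x hx⟩, rfl⟩⟩

theorem sound_receivableRule (db₀ : List (List Symb)) :
    receivableRule.Sound I.sizes I.Valid db₀ := by
  intro ρ hρ _ hb
  have h := exists_eq_of_inRange hρ
  simp only [receivableRule, List.forall_mem_cons, List.not_mem_nil, IsEmpty.forall_iff, implies_true,
      and_true] at h hb ⊢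
  obtain ⟨⟨⟨q, h0⟩, ⟨q', h1⟩⟩, ⟨m, h5⟩⟩ := h
  simp [h0, h1, h5] at hb ⊢
  exact ⟨q', hb⟩

/-- Ignoring a message depends on the absence of a fact. This is sound because the receivable
messages have been computed completely before, which is the hypothesis `hdb`. -/
theorem sound_reactRules (db₀ : List (List Symb)) (hdb : ∀ (q : Fin I.numStates)
      (m : Fin I.numMessages), m ∈ I.protocol.receivable q → factWord .tau .bang [↑q, ↑m] ∈ db₀) :
    ∀ r ∈ [receiveRule, ignoreRule], r.Sound I.sizes I.Valid db₀ := by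
  simp only [List.forall_mem_cons, List.not_mem_nil, IsEmpty.forall_iff, implies_true, and_true]
  constructor
  · intro ρ hρ _ hb
    have h := exists_eq_of_inRange hρ
    simp only [receiveRule, List.forall_mem_cons, List.not_mem_nil, IsEmpty.forall_iff, implies_true,
      and_true] at h hb ⊢
    obtain ⟨⟨⟨q, h0⟩, ⟨q', h1⟩⟩, ⟨m, h5⟩⟩ := h
    simp [h0, h1, h5] at hb ⊢
    exact Or.inl hb
  · intro ρ hρ hn _
    have h := exists_eq_of_inRange hρ
    simp only [ignoreRule, List.forall_mem_cons, List.not_mem_nil, IsEmpty.forall_iff, implies_true,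
      and_true] at h hn ⊢
    obtain ⟨⟨q, h0⟩, ⟨m, h5⟩⟩ := h
    simp [h0, h5] at hn ⊢
    exact Or.inr ⟨fun h => hn (hdb q m h), rfl⟩

theorem sound_pairRules (db₀ : List (List Symb)) :
    ∀ r ∈ pairStart :: pairRules, r.Sound I.sizes I.Valid db₀ := by
  simp only [pairRules, List.forall_mem_cons, List.not_mem_nil, IsEmpty.forall_iff, implies_true,
      and_true]
  refine ⟨fun ρ hρ _ hb => ?_, fun ρ hρ _ hb => ?_, fun ρ hρ _ hb => ?_, fun ρ hρ _ hb => ?_,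
    fun ρ hρ _ hb => ?_⟩ <;>
  have h := exists_eq_of_inRange hρ <;>
  simp only [pairStart, List.forall_mem_cons, List.not_mem_nil, IsEmpty.forall_iff, implies_true,
      and_true] at h hb ⊢
  · obtain ⟨q, h0⟩ := h
    simp [h0, pairPattern] at hb ⊢
    exact hb ▸ .start
  · obtain ⟨⟨q0, h0⟩, ⟨q1, h1⟩, ⟨q2, h2⟩⟩ := h
    simp [h0, h1, h2, pairPattern] at hb ⊢
    exact hb.2 ▸ .next _ _ hb.1
  · obtain ⟨⟨q0, h0⟩, ⟨q1, h1⟩, ⟨q2, h2⟩⟩ := h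
    simp [h0, h1, h2, pairPattern] at hb ⊢
    exact .internal_left _ _ _ hb.1 hb.2
  · obtain ⟨⟨q0, h0⟩, ⟨q1, h1⟩, ⟨q2, h2⟩⟩ := h
    simp [h0, h1, h2, pairPattern] at hb ⊢
    exact .internal_right _ _ _ hb.1 hb.2
  · obtain ⟨⟨⟨q0, h0⟩, ⟨q1, h1⟩, ⟨q2, h2⟩, ⟨q3, h3⟩⟩, ⟨m, h5⟩⟩ := h
    simp [h0, h1, h2, h3, h5, pairPattern, reactPattern] at hb ⊢
    exact .broadcast _ _ _ _ _ hb.1 hb.2.1 hb.2.2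

theorem sound_fiveRules (db₀ : List (List Symb)) :
    ∀ r ∈ fiveStart :: fiveRules, r.Sound I.sizes I.Valid db₀ := by
  simp only [fiveRules, List.forall_mem_cons, List.not_mem_nil, IsEmpty.forall_iff, implies_true,
      and_true]
  refine ⟨fun ρ hρ _ hb => ?_, fun ρ hρ _ hb => ?_, fun ρ hρ _ hb => ?_, fun ρ hρ _ hb => ?_,
    fun ρ hρ _ hb => ?_, fun ρ hρ _ hb => ?_, fun ρ hρ _ hb => ?_, fun ρ hρ _ hb => ?_⟩ <;>
  have h := exists_eq_of_inRange hρ <;>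
  simp only [fiveStart, List.forall_mem_cons, List.not_mem_nil, IsEmpty.forall_iff, implies_true,
      and_true] at h hb ⊢
  · obtain ⟨⟨q0, h0⟩, ⟨q1, h1⟩, ⟨q2, h2⟩, ⟨q3, h3⟩, ⟨q4, h4⟩⟩ := h
    simp [h0, h1, h2, h3, h4, pairPattern, fivePattern] at hb ⊢
    exact hb.2.2 ▸ .start _ _ _ _ hb.1 hb.2.1
  · obtain ⟨⟨q0, h0⟩, ⟨q1, h1⟩, ⟨q2, h2⟩, ⟨q3, h3⟩, ⟨q4, h4⟩⟩ := h
    simp [h0, h1, h2, h3, h4, fivePattern] at hb ⊢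
    exact .mirror _ _ _ _ _ hb
  · obtain ⟨⟨q0, h0⟩, ⟨q1, h1⟩, ⟨q2, h2⟩, ⟨q3, h3⟩, ⟨q4, h4⟩, ⟨q6, h6⟩⟩ := h
    simp [h0, h1, h2, h3, h4, h6, fivePattern] at hb ⊢
    exact .internal_outer _ _ _ _ _ _ hb.1 hb.2
  · obtain ⟨⟨q0, h0⟩, ⟨q1, h1⟩, ⟨q2, h2⟩, ⟨q3, h3⟩, ⟨q4, h4⟩, ⟨q6, h6⟩⟩ := h
    simp [h0, h1, h2, h3, h4, h6, fivePattern] at hb ⊢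
    exact .internal_inner _ _ _ _ _ _ hb.1 hb.2
  · obtain ⟨⟨q0, h0⟩, ⟨q1, h1⟩, ⟨q2, h2⟩, ⟨q3, h3⟩, ⟨q4, h4⟩, ⟨q6, h6⟩⟩ := h
    simp [h0, h1, h2, h3, h4, h6, fivePattern] at hb ⊢
    exact .internal_center _ _ _ _ _ _ hb.1 hb.2
  · obtain ⟨⟨⟨q0, h0⟩, ⟨q1, h1⟩, ⟨q2, h2⟩, ⟨q3, h3⟩, ⟨q4, h4⟩, ⟨q6, h6⟩, ⟨q7, h7⟩⟩, ⟨m, h5⟩⟩ := h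
    simp [h0, h1, h2, h3, h4, h5, h6, h7, fivePattern, reactPattern] at hb ⊢
    exact .broadcast_outer _ _ _ _ _ _ _ _ hb.1 hb.2.1 hb.2.2
  · obtain ⟨⟨⟨q0, h0⟩, ⟨q1, h1⟩, ⟨q2, h2⟩, ⟨q3, h3⟩, ⟨q4, h4⟩, ⟨q6, h6⟩, ⟨q7, h7⟩, ⟨q8, h8⟩⟩,
      ⟨m, h5⟩⟩ := h
    simp [h0, h1, h2, h3, h4, h5, h6, h7, h8, fivePattern, reactPattern] at hb ⊢
    exact .broadcast_inner _ _ _ _ _ _ _ _ _ hb.1 hb.2.1 hb.2.2.1 hb.2.2.2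
  · obtain ⟨⟨⟨q0, h0⟩, ⟨q1, h1⟩, ⟨q2, h2⟩, ⟨q3, h3⟩, ⟨q4, h4⟩, ⟨q6, h6⟩, ⟨q7, h7⟩, ⟨q8, h8⟩⟩,
      ⟨m, h5⟩⟩ := h
    simp [h0, h1, h2, h3, h4, h5, h6, h7, h8, fivePattern, reactPattern] at hb ⊢
    exact .broadcast_center _ _ _ _ _ _ _ _ _ hb.1 hb.2.1 hb.2.2.1 hb.2.2.2

theorem sound_answerRule (db₀ : List (List Symb)) : answerRule.Sound I.sizes I.Valid db₀ := by
  intro ρ hρ _ hb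
  have h := exists_eq_of_inRange hρ
  simp only [answerRule, List.forall_mem_cons, List.not_mem_nil, IsEmpty.forall_iff, implies_true,
      and_true] at h hb ⊢
  obtain ⟨⟨q0, h0⟩, ⟨q1, h1⟩, ⟨q2, h2⟩, ⟨q3, h3⟩, ⟨q4, h4⟩⟩ := h
  simp [h0, h1, h2, h3, h4, fivePattern] at hb ⊢
  exact ⟨_, _, _, _, hb.1 ▸ hb.2⟩

theorem closed_reactRules : ∀ r ∈ [receiveRule, ignoreRule], r.closed = true := by decide

theorem closed_pairRules : ∀ r ∈ pairStart :: pairRules, r.closed = true := by decide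

theorem closed_fiveRules : ∀ r ∈ fiveStart :: fiveRules, r.closed = true := by decide


/-! ### Completeness of the rules -/

@[simp] theorem protocol_init : I.protocol.init = I.init := rfl

/-- The facts about `k` states. -/
def stateFacts (I : CoverInput) (a b : Symb) (k : ℕ) : Finset (List Symb) :=
  Finset.univ.image fun t : Fin k → Fin I.numStates => factWord a b (List.ofFn fun i => (t i : ℕ))

theorem card_stateFacts_le (a b : Symb) (k : ℕ) :
    (I.stateFacts a b k).card ≤ I.sizes true ^ k :=
  Finset.card_image_le.trans (by simp [sizes])

theorem pair_mem_stateFacts (a c : Fin I.numStates) :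
    factWord .bang .bang [↑a, ↑c] ∈ I.stateFacts .bang .bang 2 :=
  Finset.mem_image.2 ⟨![a, c], Finset.mem_univ _, rfl⟩

theorem five_mem_stateFacts (w u v x z : Fin I.numStates) :
    factWord .bang .quest [↑w, ↑u, ↑v, ↑x, ↑z] ∈ I.stateFacts .bang .quest 5 :=
  Finset.mem_image.2 ⟨![w, u, v, x, z], Finset.mem_univ _, rfl⟩

theorem valid_facts : ∀ w ∈ I.facts, I.Valid w := by
  intro w hw
  simp only [facts, List.mem_cons, List.mem_append, List.mem_map, List.not_mem_nil, or_false] at hw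
  rcases hw with rfl | ⟨t, ht, rfl⟩ | rfl
  · have := I.valid_target I.target
    simpa [factWord] using this
  · exact (valid_encodeTransition t).2 ht
  · have := I.valid_init I.init
    simpa [factWord] using this

/-- The list contains the words of the transitions and of the initial state. -/
structure HasInput (I : CoverInput) (db : List (List Symb)) : Prop where
  trans : ∀ t ∈ I.protocol.trans, encodeTransition t ∈ db
  init : factWord .tau .tau [↑I.init] ∈ db

theorem HasInput.mono {db db' : List (List Symb)} (h : I.HasInput db) (hs : db ⊆ db') :
    I.HasInput db' := ⟨fun t ht => hs (h.trans t ht), hs h.init⟩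

theorem hasInput_facts : I.HasInput I.facts :=
  ⟨fun t ht => by
    simp only [facts, List.mem_cons, List.mem_append, List.mem_map]
    exact Or.inr (Or.inl ⟨t, ht, rfl⟩), by simp [facts, factWord]⟩

variable {db : List (List Symb)}

theorem receivable_mem (hdb : I.HasInput db) (hv : ∀ w ∈ db, I.Valid w) (ρ : Fin 14 → ℕ)
    {q : Fin I.numStates} {m : Fin I.numMessages} (h : m ∈ I.protocol.receivable q) :
    factWord .tau .bang [↑q, ↑m] ∈ receivableRule.cmd.run I.sizes ρ db := by
  obtain ⟨q', h⟩ := h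
  have h2 := hdb.trans _ h
  rw [← encode_receive] at h2
  -- The vector gives the values of the variables `0` to `13`. In all rules with a message it is
  -- variable `5`; places that the rule does not bind are filled with `0`.
  simpa [receivableRule] using Rule.yields (r := receivableRule) (by decide)
    (sound_receivableRule db) ρ ![↑q, ↑q', 0, 0, 0, ↑m, 0, 0, 0, 0, 0, 0, 0, 0]
    (by simp [Rule.InRange, receivableRule, sizes]) (by simp [receivableRule])
    (by simpa [receivableRule] using h2) db (List.Subset.refl _) hv

theorem reacts_mem (hdb : I.HasInput db) (hv : ∀ w ∈ db, I.Valid w) (hr : ∀ (q : Fin I.numStates)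
      (m : Fin I.numMessages), m ∈ I.protocol.receivable q → factWord .tau .bang [↑q, ↑m] ∈ db)
    (ρ : Fin 14 → ℕ) {q q' : Fin I.numStates} {m : Fin I.numMessages}
    (h : I.protocol.Reacts m q q') :
    factWord .quest .quest [↑m, ↑q, ↑q'] ∈
      (Rule.cmds receiveRule [ignoreRule]).run I.sizes ρ db := by
  have key := fun r' (hr' : r' ∈ [receiveRule, ignoreRule]) τ h1 h2 h3 =>
    Rule.yields_cmds (r' := r') _ closed_reactRules (sound_reactRules db hr) ρ hr' τ h1 h2 h3 db
      (List.Subset.refl _) hv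
  rcases h with h | ⟨h, rfl⟩
  · have h2 := hdb.trans _ h
    rw [← encode_receive] at h2
    simpa [receiveRule] using key receiveRule (by simp)
      ![↑q, ↑q', 0, 0, 0, ↑m, 0, 0, 0, 0, 0, 0, 0, 0]
      (by simp [Rule.InRange, receiveRule, sizes]) (by simp [receiveRule])
      (by simpa [receiveRule] using h2)
  · simpa [ignoreRule] using key ignoreRule (by simp)
      ![↑q', 0, 0, 0, 0, ↑m, 0, 0, 0, 0, 0, 0, 0, 0]
      (by simp [Rule.InRange, ignoreRule, sizes]) (by simpa [ignoreRule] using h)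
      (by simp [ignoreRule])

/-- Induction on the derivation of the pair, inside the list of a stationary round, which is closed
under the rules. -/
theorem pair_mem (hdb : I.HasInput db) (hv : ∀ w ∈ db, I.Valid w) (hr : ∀ (m : Fin I.numMessages)
      (q q' : Fin I.numStates), I.protocol.Reacts m q q' →
      factWord .quest .quest [↑m, ↑q, ↑q'] ∈ db)
    (ρ : Fin 14 → ℕ) {a c : Fin I.numStates} (h : I.protocol.Pair a c) :
    factWord .bang .bang [↑a, ↑c] ∈
      (Cmd.forAll true [9, 10] (Rule.cmds pairStart pairRules)).run I.sizes ρ db := by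
  -- No rule mentions the variables `9` and `10`: two loops over the states give as many rounds as
  -- there are possible pair facts. In the same way five loops serve the quintuples.
  rcases Rule.exists_closed pairRules [9, 10] (I.stateFacts .bang .bang 2)
    (I.card_stateFacts_le _ _ _) closed_pairRules (fun r hr db₀ => sound_pairRules db₀ r hr) ρ db hv
    with h1 | ⟨db', h1, h2, h3⟩
  · exact h1 _ (pair_mem_stateFacts a c)
  refine h2 ?_
  replace hdb := hdb.mono h1
  replace hr := fun m q q' h => h1 (hr m q q' h)
  simp only [pairRules, List.forall_mem_cons, List.not_mem_nil, IsEmpty.forall_iff, implies_true,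
    and_true] at h3
  obtain ⟨s1, s2, s3, s4, s5⟩ := h3
  have hi := hdb.init
  induction h with
  | start =>
    simpa [pairStart, pairPattern] using s1 ![↑I.init, 0, 0, 0, 0, 0, 0, 0, 0, 0, 0, 0, 0, 0]
      (by simp [Rule.InRange, pairStart, sizes])
      (by simp [pairStart]) (by simpa [pairStart] using hi)
      (by simpa [pairStart, pairPattern] using pair_mem_stateFacts _ _)
  | next x a _ ih =>
    simpa [pairPattern] using s2 ![↑x, ↑a, ↑I.init, 0, 0, 0, 0, 0, 0, 0, 0, 0, 0, 0]
      (by simp [Rule.InRange, sizes]) (by simp) (by simpa [pairPattern] using ⟨ih, hi⟩)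
      (by simpa [pairPattern] using pair_mem_stateFacts _ _)
  | internal_left a c a' _ ht ih =>
    have ht := hdb.trans _ ht
    rw [← encode_internal] at ht
    simpa [pairPattern] using s3 ![↑a, ↑c, ↑a', 0, 0, 0, 0, 0, 0, 0, 0, 0, 0, 0]
      (by simp [Rule.InRange, sizes]) (by simp) (by simpa [pairPattern] using ⟨ih, ht⟩)
      (by simpa [pairPattern] using pair_mem_stateFacts _ _)
  | internal_right a c c' _ ht ih =>
    have ht := hdb.trans _ ht
    rw [← encode_internal] at ht
    simpa [pairPattern] using s4 ![↑a, ↑c, ↑c', 0, 0, 0, 0, 0, 0, 0, 0, 0, 0, 0]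
      (by simp [Rule.InRange, sizes]) (by simp) (by simpa [pairPattern] using ⟨ih, ht⟩)
      (by simpa [pairPattern] using pair_mem_stateFacts _ _)
  | broadcast a c a' c' m _ ht hc ih =>
    have ht := hdb.trans _ ht
    rw [← encode_broadcast] at ht
    simpa [pairPattern] using s5 ![↑a, ↑c, ↑a', ↑c', 0, ↑m, 0, 0, 0, 0, 0, 0, 0, 0]
      (by simp [Rule.InRange, sizes]) (by simp)
      (by simpa [pairPattern, reactPattern] using ⟨ih, ht, hr _ _ _ hc⟩)
      (by simpa [pairPattern] using pair_mem_stateFacts _ _)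

theorem five_mem (hdb : I.HasInput db) (hv : ∀ w ∈ db, I.Valid w) (hr : ∀ (m : Fin I.numMessages)
      (q q' : Fin I.numStates), I.protocol.Reacts m q q' →
      factWord .quest .quest [↑m, ↑q, ↑q'] ∈ db)
    (hp : ∀ a c : Fin I.numStates, I.protocol.Pair a c → factWord .bang .bang [↑a, ↑c] ∈ db)
    (ρ : Fin 14 → ℕ) {w u v x z : Fin I.numStates} (h : I.protocol.Five w u v x z) :
    factWord .bang .quest [↑w, ↑u, ↑v, ↑x, ↑z] ∈
      (Cmd.forAll true [9, 10, 11, 12, 13] (Rule.cmds fiveStart fiveRules)).run I.sizes ρ db := by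
  rcases Rule.exists_closed fiveRules [9, 10, 11, 12, 13] (I.stateFacts .bang .quest 5)
    (I.card_stateFacts_le _ _ _) closed_fiveRules (fun r hr db₀ => sound_fiveRules db₀ r hr) ρ db hv
    with h1 | ⟨db', h1, h2, h3⟩
  · exact h1 _ (five_mem_stateFacts ..)
  refine h2 ?_
  replace hdb := hdb.mono h1
  replace hr := fun m q q' h => h1 (hr m q q' h)
  replace hp := fun a c h => h1 (hp a c h)
  simp only [fiveRules, List.forall_mem_cons, List.not_mem_nil, IsEmpty.forall_iff, implies_true,
    and_true] at h3
  obtain ⟨s1, s2, s3, s4, s5, s6, s7, s8⟩ := h3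
  have hi := hdb.init
  induction h with
  | start x y w z hw hz =>
    simpa [fiveStart, fivePattern] using s1
      ![↑x, ↑w, ↑y, ↑z, ↑I.init, 0, 0, 0, 0, 0, 0, 0, 0, 0]
      (by simp [Rule.InRange, fiveStart, sizes]) (by simp [fiveStart])
      (by simpa [fiveStart, pairPattern] using ⟨hp _ _ hw, hp _ _ hz, hi⟩)
      (by simpa [fiveStart, fivePattern] using five_mem_stateFacts ..)
  | mirror w u v x z _ ih =>
    simpa [fivePattern] using s2 ![↑w, ↑u, ↑v, ↑x, ↑z, 0, 0, 0, 0, 0, 0, 0, 0, 0]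
      (by simp [Rule.InRange, sizes]) (by simp) (by simpa [fivePattern] using ih)
      (by simpa [fivePattern] using five_mem_stateFacts ..)
  | internal_outer w u v x z w' _ ht ih =>
    have ht := hdb.trans _ ht
    rw [← encode_internal] at ht
    simpa [fivePattern] using s3 ![↑w, ↑u, ↑v, ↑x, ↑z, 0, ↑w', 0, 0, 0, 0, 0, 0, 0]
      (by simp [Rule.InRange, sizes]) (by simp) (by simpa [fivePattern] using ⟨ih, ht⟩)
      (by simpa [fivePattern] using five_mem_stateFacts ..)
  | internal_inner w u v x z u' _ ht ih =>
    have ht := hdb.trans _ ht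
    rw [← encode_internal] at ht
    simpa [fivePattern] using s4 ![↑w, ↑u, ↑v, ↑x, ↑z, 0, ↑u', 0, 0, 0, 0, 0, 0, 0]
      (by simp [Rule.InRange, sizes]) (by simp) (by simpa [fivePattern] using ⟨ih, ht⟩)
      (by simpa [fivePattern] using five_mem_stateFacts ..)
  | internal_center w u v x z v' _ ht ih =>
    have ht := hdb.trans _ ht
    rw [← encode_internal] at ht
    simpa [fivePattern] using s5 ![↑w, ↑u, ↑v, ↑x, ↑z, 0, ↑v', 0, 0, 0, 0, 0, 0, 0]
      (by simp [Rule.InRange, sizes]) (by simp) (by simpa [fivePattern] using ⟨ih, ht⟩)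
      (by simpa [fivePattern] using five_mem_stateFacts ..)
  | broadcast_outer w u v x z w' u' m _ ht hu ih =>
    have ht := hdb.trans _ ht
    rw [← encode_broadcast] at ht
    simpa [fivePattern] using s6 ![↑w, ↑u, ↑v, ↑x, ↑z, ↑m, ↑w', ↑u', 0, 0, 0, 0, 0, 0]
      (by simp [Rule.InRange, sizes]) (by simp)
      (by simpa [fivePattern, reactPattern] using ⟨ih, ht, hr _ _ _ hu⟩)
      (by simpa [fivePattern] using five_mem_stateFacts ..)
  | broadcast_inner w u v x z w' u' v' m _ ht hw hv ih =>
    have ht := hdb.trans _ ht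
    rw [← encode_broadcast] at ht
    simpa [fivePattern] using s7 ![↑w, ↑u, ↑v, ↑x, ↑z, ↑m, ↑w', ↑u', ↑v', 0, 0, 0, 0, 0]
      (by simp [Rule.InRange, sizes]) (by simp)
      (by simpa [fivePattern, reactPattern] using ⟨ih, ht, hr _ _ _ hw, hr _ _ _ hv⟩)
      (by simpa [fivePattern] using five_mem_stateFacts ..)
  | broadcast_center w u v x z u' v' x' m _ ht hu hx ih =>
    have ht := hdb.trans _ ht
    rw [← encode_broadcast] at ht
    simpa [fivePattern] using s8 ![↑w, ↑u, ↑v, ↑x, ↑z, ↑m, ↑u', ↑v', ↑x', 0, 0, 0, 0, 0]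
      (by simp [Rule.InRange, sizes]) (by simp)
      (by simpa [fivePattern, reactPattern] using ⟨ih, ht, hr _ _ _ hu, hr _ _ _ hx⟩)
      (by simpa [fivePattern] using five_mem_stateFacts ..)

theorem answer_mem (hv : ∀ w ∈ db, I.Valid w) (ht : factWord .tau .quest [↑I.target] ∈ db)
    (ρ : Fin 14 → ℕ) {w u x z : Fin I.numStates}
    (h : factWord .bang .quest [↑w, ↑u, ↑I.target, ↑x, ↑z] ∈ db) :
    patternWord ρ answerPattern ∈ answerRule.cmd.run I.sizes ρ db := by
  simpa [answerRule] using Rule.yields (r := answerRule) (by decide) (sound_answerRule db) ρ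
    ![↑w, ↑u, ↑I.target, ↑x, ↑z, 0, 0, 0, 0, 0, 0, 0, 0, 0]
    (by simp [Rule.InRange, answerRule, sizes]) (by simp [answerRule])
    (by simpa [answerRule, fivePattern] using ⟨ht, h⟩) db (List.Subset.refl _) hv

/-- After each part of the command two things are kept: all facts are valid, and the relation just
computed is complete. Validity of the final list gives one direction, completeness the other. -/
theorem answer_mem_run_coverCmd (I : CoverInput) (ρ : Fin 14 → ℕ) :
    patternWord ρ answerPattern ∈ coverCmd.run I.sizes ρ I.facts ↔
      ∃ w u x z, I.protocol.Five w u I.target x z := by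
  have v0 := I.valid_facts
  have i0 := I.hasInput_facts
  have t0 : factWord .tau .quest [↑I.target] ∈ I.facts := by simp [facts, factWord]
  simp only [coverCmd, Cmd.run]
  have s1 := Cmd.subset_run I.sizes receivableRule.cmd ρ I.facts
  have v1 := Rule.preserves (by decide) (sound_receivableRule I.facts) ρ _ (List.Subset.refl _) v0
  have r1 := fun q m => receivable_mem (q := q) (m := m) i0 v0 ρ
  generalize receivableRule.cmd.run I.sizes ρ I.facts = db1 at *
  have i1 := i0.mono s1
  have t1 := s1 t0
  have s2 := Cmd.subset_run I.sizes (Rule.cmds receiveRule [ignoreRule]) ρ db1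
  have v2 := Rule.preserves_cmds _ closed_reactRules (sound_reactRules db1 r1) ρ _
    (List.Subset.refl _) v1
  have r2 := fun m q q' => reacts_mem (q := q) (q' := q') (m := m) i1 v1 r1 ρ
  generalize (Rule.cmds receiveRule [ignoreRule]).run I.sizes ρ db1 = db2 at *
  have i2 := i1.mono s2
  have t2 := s2 t1
  have s3 := Cmd.subset_run I.sizes (Cmd.forAll true [9, 10] (Rule.cmds pairStart pairRules)) ρ db2
  have v3 := Cmd.Preserves.forAll (b := true) [9, 10] (ρ := ρ) (fun ρ' _ _ =>
    Rule.preserves_cmds _ closed_pairRules (sound_pairRules db2) ρ') _ (List.Subset.refl _) v2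
  have p3 := fun a c => pair_mem (a := a) (c := c) i2 v2 r2 ρ
  generalize (Cmd.forAll true [9, 10] (Rule.cmds pairStart pairRules)).run I.sizes ρ db2 = db3 at *
  have i3 := i2.mono s3
  have t3 := s3 t2
  have r3 := fun m q q' h => s3 (r2 m q q' h)
  have s4 := Cmd.subset_run I.sizes
    (Cmd.forAll true [9, 10, 11, 12, 13] (Rule.cmds fiveStart fiveRules)) ρ db3
  have v4 := Cmd.Preserves.forAll (b := true) [9, 10, 11, 12, 13] (ρ := ρ) (fun ρ' _ _ =>
    Rule.preserves_cmds _ closed_fiveRules (sound_fiveRules db3) ρ') _ (List.Subset.refl _) v3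
  have f4 := fun w u v x z => five_mem (w := w) (u := u) (v := v) (x := x) (z := z) i3 v3 r3 p3 ρ
  generalize (Cmd.forAll true [9, 10, 11, 12, 13] (Rule.cmds fiveStart fiveRules)).run I.sizes ρ db3
    = db4 at *
  have t4 := s4 t3
  constructor
  · intro h
    have := Rule.preserves (by decide) (sound_answerRule db4) ρ _ (List.Subset.refl _) v4 _ h
    simpa using this
  · rintro ⟨w, u, x, z, h⟩
    exact answer_mem v4 t4 ρ (f4 _ _ _ _ _ h)

end CoverInput
end BroadcastNetwork

/-- For `k ∈ {1, 2}`, coverability over line topologies, restricted to the inputs whose protocol is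
`k`-phase-bounded, is in P. -/
theorem mainTheorem5 (k : ℕ) (hk : k ∈ ({1, 2} : Set ℕ)) :
    BroadcastNetwork.InPolyTime
      (fun I : {I : BroadcastNetwork.CoverInput // I.protocol.IsPhaseBounded k} => I.1.encode)
      (fun I => I.1.protocol.Coverable BroadcastNetwork.Lines I.1.target) := by
  have h12 : 1 ≤ k ∧ k ≤ 2 := by
    rcases hk with rfl | hk
    · simp
    · rw [Set.mem_singleton_iff.1 hk]
      simp
  refine BroadcastNetwork.inPolyTime_of_cmd BroadcastNetwork.coverCmd BroadcastNetwork.ok_coverCmd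
    (inp := Subtype.val) (fun _ => 0) _ fun I => ?_
  -- One command serves both values of `k`: the partition into phases is never computed, it only
  -- proves that the answer is right.
  obtain ⟨ph, hph⟩ := I.2.exists_staging h12.1 h12.2
  rw [BroadcastNetwork.CoverInput.answer_mem_run_coverCmd,
    BroadcastNetwork.Protocol.coverable_lines_iff hph]
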